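/- For maximizing a DR-submodular quadratic function over a down-closed convex quadratic constraint there is a $(\frac1e-O(\epsilon))$-approximation algorithm whose running time is polynomial in the input size and in $\frac1\epsilon$. Precisely: there are a deterministic algorithm, a polynomial $p$ and an absolute constant $c$ such that the following holds. Let $n\ge 0$ be an integer, let $A^*\in\mathbb Q^{n\times n}$, $a\in\mathbb Q^n$, $Q\in\mathbb Q^{n\times n}$, $C\in\mathbb Q$ with $C>0$, and let $f(x)=x^{T}A^*x+a^{T}x$. Suppose that $A^*\le 0$ entrywise, that $f(x)\ge 0$ for all $x\in\{0,1\}^n$, that $Q\ge 0$ entrywise, and that $Q$ is symmetric positive semidefinite; let $q$ be the vector of the diagonal entries of $Q$, and let $$S=\{x\in[0,1]^n:\ x^{T}Qx\le C,\ q^{T}x\le C\}.$$ Then for every rational $\epsilon>0$ the algorithm, given $(n,A^*,a,Q,C,\epsilon)$, halts within $p(N+\lceil 1/\epsilon\rceil)$ bit operations (time on a random access machine with logarithmic cost), where $N$ is the length of the input in binary (with $n$ counted in unary), and outputs a rational point $x\in S$ with $$f(x)\ \ge\ \Bigl(\frac1e-c\,\epsilon\Bigr)\cdot\max_{y\in S}f(y).$$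 -/

import Mathlib

namespace QuadApprox

/-! ### A machine model with logarithmic cost

Programs are structured `while` programs over a random access memory. A memory cell is named by a
triple: an array name, which is fixed in the program text, and two computed indices. Each cell holds
a rational number. Every value that is computed, read, compared or used as an index is charged its
length in binary, so that polynomial time here is the usual polynomial time. -/

/-- The contents of the memory: `s r i j` is the entry `(i, j)` of array number `r`. -/
abbrev Store := ℕ → ℕ → ℕ → ℚ

/-- Length of the binary representation of a rational number in lowest terms. -/
def bitSize (q : ℚ) : ℕ := Nat.size q.num.natAbs + Nat.size q.den

/-- Arithmetic expressions. -/
inductive Expr where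
  | const (q : ℚ)
  | get (r : ℕ) (i j : Expr)
  | add (e₁ e₂ : Expr)
  | sub (e₁ e₂ : Expr)
  | mul (e₁ e₂ : Expr)
  | div (e₁ e₂ : Expr)
  | floor (e : Expr)

/-- The value of an expression; the indices of an array access are rounded down to a natural
number, and division by zero gives zero. -/
def Expr.eval (s : Store) : Expr → ℚ
  | .const q => q
  | .get r i j => s r ⌊i.eval s⌋₊ ⌊j.eval s⌋₊
  | .add e₁ e₂ => e₁.eval s + e₂.eval s
  | .sub e₁ e₂ => e₁.eval s - e₂.eval s
  | .mul e₁ e₂ => e₁.eval s * e₂.eval s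
  | .div e₁ e₂ => e₁.eval s / e₂.eval s
  | .floor e => (⌊e.eval s⌋ : ℚ)

/-- The cost of evaluating an expression: the total binary length of the values of all of its
subexpressions, itself included. -/
def Expr.cost (s : Store) : Expr → ℕ
  | .const q => bitSize q
  | .get r i j => i.cost s + j.cost s + bitSize ((Expr.get r i j).eval s)
  | .add e₁ e₂ => e₁.cost s + e₂.cost s + bitSize ((Expr.add e₁ e₂).eval s)
  | .sub e₁ e₂ => e₁.cost s + e₂.cost s + bitSize ((Expr.sub e₁ e₂).eval s)
  | .mul e₁ e₂ => e₁.cost s + e₂.cost s + bitSize ((Expr.mul e₁ e₂).eval s)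
  | .div e₁ e₂ => e₁.cost s + e₂.cost s + bitSize ((Expr.div e₁ e₂).eval s)
  | .floor e => e.cost s + bitSize ((Expr.floor e).eval s)

/-- Programs. `assign r i j e` writes the value of `e` into the entry `(i, j)` of array `r`;
the tests of `ite e₁ e₂ p₁ p₂` and `loop e₁ e₂ p` are `e₁ < e₂`. -/
inductive Prog where
  | skip
  | assign (r : ℕ) (i j e : Expr)
  | seq (p₁ p₂ : Prog)
  | ite (e₁ e₂ : Expr) (p₁ p₂ : Prog)
  | loop (e₁ e₂ : Expr) (p : Prog)

/-- The store after writing `q` into the entry `(i, j)` of array `r`. -/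
def Store.write (s : Store) (r i j : ℕ) (q : ℚ) : Store :=
  fun r' i' j' => if r' = r ∧ i' = i ∧ j' = j then q else s r' i' j'

/-- `Exec p s s' t`: the program `p`, started with store `s`, halts with store `s'` after
time `t`. -/
inductive Exec : Prog → Store → Store → ℕ → Prop where
  | skip (s : Store) : Exec .skip s s 1
  | assign (s : Store) (r : ℕ) (i j e : Expr) :
      Exec (.assign r i j e) s (s.write r ⌊i.eval s⌋₊ ⌊j.eval s⌋₊ (e.eval s))
        (i.cost s + j.cost s + e.cost s + 1)
  | seq {p₁ p₂ : Prog} {s s' s'' : Store} {t₁ t₂ : ℕ} :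
      Exec p₁ s s' t₁ → Exec p₂ s' s'' t₂ → Exec (.seq p₁ p₂) s s'' (t₁ + t₂)
  | ite_true {e₁ e₂ : Expr} {p₁ p₂ : Prog} {s s' : Store} {t : ℕ} :
      e₁.eval s < e₂.eval s → Exec p₁ s s' t →
      Exec (.ite e₁ e₂ p₁ p₂) s s' (e₁.cost s + e₂.cost s + 1 + t)
  | ite_false {e₁ e₂ : Expr} {p₁ p₂ : Prog} {s s' : Store} {t : ℕ} :
      ¬ e₁.eval s < e₂.eval s → Exec p₂ s s' t →
      Exec (.ite e₁ e₂ p₁ p₂) s s' (e₁.cost s + e₂.cost s + 1 + t)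
  | loop_true {e₁ e₂ : Expr} {p : Prog} {s s' s'' : Store} {t₁ t₂ : ℕ} :
      e₁.eval s < e₂.eval s → Exec p s s' t₁ → Exec (.loop e₁ e₂ p) s' s'' t₂ →
      Exec (.loop e₁ e₂ p) s s'' (e₁.cost s + e₂.cost s + 1 + t₁ + t₂)
  | loop_false {e₁ e₂ : Expr} {p : Prog} {s : Store} :
      ¬ e₁.eval s < e₂.eval s →
      Exec (.loop e₁ e₂ p) s s (e₁.cost s + e₂.cost s + 1)

/-- Programs are deterministic: the final store and the running time are determined. -/
theorem Exec.det {p : Prog} {s s₁ s₂ : Store} {t₁ t₂ : ℕ}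
    (h₁ : Exec p s s₁ t₁) (h₂ : Exec p s s₂ t₂) : s₁ = s₂ ∧ t₁ = t₂ := by
  induction h₁ generalizing s₂ t₂ with
  | skip s => cases h₂; exact ⟨rfl, rfl⟩
  | assign s r i j e => cases h₂; exact ⟨rfl, rfl⟩
  | seq _ _ ih₁ ih₂ =>
    cases h₂ with
    | seq g₁ g₂ =>
      obtain ⟨rfl, rfl⟩ := ih₁ g₁
      obtain ⟨rfl, rfl⟩ := ih₂ g₂
      exact ⟨rfl, rfl⟩
  | ite_true hc _ ih =>
    cases h₂ with
    | ite_true _ g => obtain ⟨rfl, rfl⟩ := ih g; exact ⟨rfl, rfl⟩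
    | ite_false hn _ => exact absurd hc hn
  | ite_false hn _ ih =>
    cases h₂ with
    | ite_true hc _ => exact absurd hc hn
    | ite_false _ g => obtain ⟨rfl, rfl⟩ := ih g; exact ⟨rfl, rfl⟩
  | loop_true hc _ _ ih₁ ih₂ =>
    cases h₂ with
    | loop_true _ g₁ g₂ =>
      obtain ⟨rfl, rfl⟩ := ih₁ g₁
      obtain ⟨rfl, rfl⟩ := ih₂ g₂
      exact ⟨rfl, rfl⟩
    | loop_false hn => exact absurd hc hn
  | loop_false hn =>
    cases h₂ with
    | loop_true hc _ _ => exact absurd hc hn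
    | loop_false _ => exact ⟨rfl, rfl⟩

/-! ### The optimization problem -/

/-- The rational input data of a problem with `n` variables. -/
structure Problem (n : ℕ) where
  /-- the matrix `A*` of the objective -/
  A : Matrix (Fin n) (Fin n) ℚ
  /-- the linear part of the objective -/
  a : Fin n → ℚ
  /-- the matrix of the quadratic constraint -/
  Q : Matrix (Fin n) (Fin n) ℚ
  /-- the capacity -/
  C : ℚ

namespace Problem

variable {n : ℕ}

/-- The objective `f(x) = xᵀ A* x + aᵀ x`. -/
def obj (I : Problem n) (x : Fin n → ℝ) : ℝ :=
  ∑ i, ∑ j, x i * (I.A i j : ℝ) * x j + ∑ i, (I.a i : ℝ) * x i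

/-- The feasible set: `x ∈ [0,1]ⁿ`, `xᵀ Q x ≤ C` and `qᵀ x ≤ C`, where `q` is the diagonal
of `Q`. -/
def feasible (I : Problem n) : Set (Fin n → ℝ) :=
  {x | (∀ i, 0 ≤ x i ∧ x i ≤ 1) ∧
    ∑ i, ∑ j, x i * (I.Q i j : ℝ) * x j ≤ (I.C : ℝ) ∧
    ∑ i, (I.Q i i : ℝ) * x i ≤ (I.C : ℝ)}

/-- The length of the binary representation of the input (with the number of variables in
unary). -/
def size (I : Problem n) : ℕ :=
  n + ∑ i, ∑ j, bitSize (I.A i j) + ∑ i, bitSize (I.a i) + ∑ i, ∑ j, bitSize (I.Q i j)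
    + bitSize I.C

/-- The initial store: arrays 0, …, 5 hold `n`, `ε`, `C`, `a`, `A*` and `Q`, with indices from
zero; everything else is zero. -/
def load (I : Problem n) (ε : ℚ) : Store
  | 0, 0, 0 => n
  | 1, 0, 0 => ε
  | 2, 0, 0 => I.C
  | 3, i, 0 => if hi : i < n then I.a ⟨i, hi⟩ else 0
  | 4, i, j => if h : i < n ∧ j < n then I.A ⟨i, h.1⟩ ⟨j, h.2⟩ else 0
  | 5, i, j => if h : i < n ∧ j < n then I.Q ⟨i, h.1⟩ ⟨j, h.2⟩ else 0
  | _, _, _ => 0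

end Problem

/-- The output vector of a computation, left in the first column of array 6. -/
def output (n : ℕ) (s : Store) : Fin n → ℝ := fun i => (s 6 i 0 : ℝ)

end QuadApprox

/-! Write x_i = u_i y_i, where u_i = min(1, C / Q_ii) bounds the coordinate x_i on S, and divide the
objective by M = ∑ u_i a_i. Nonnegativity at the vertices with one or two ones gives a ≥ 0 and
bounds the Hessian from below by the linear part, so in the new coordinates all data have unit size
(`IsNormalized`). Call the scaled objective F.

The algorithm is measured continuous greedy in which the optimization over directions is replaced by
projected gradient ascent. In each of T iterations y_i grows by (1 - u_i y_i) z_i / T, while z makes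
a projected gradient step for the linear gain at y minus K times the violation of the two convex
constraints at z. For every feasible x the potential F(y) - κ‖z - x‖², with κ = Γ / (2T), grows in
one iteration by at least ((1 - θ) F(x) - F(y) + K · violation(z)) / T up to small errors, where u_i
y_i ≤ θ (`IsStep.potential_ge`). This rests on diminishing returns (`quadGrad_measured_ge`) and on
the usual regret bound for gradient steps (`sq_dist_step_le`).

The potential is used twice in `iterate_guarantee`. With 1 - θ = (1 - 1/T)^t and the penalty
dropped, the recursion unrolls to F(y_T) ≥ F(x)/e minus errors. Since F is at most 1, the same
inequality bounds the average violation of the z's by O(1/K). As y_T lies below the average of the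
z's, convexity and Q ≥ 0 show that y_T violates the constraints by at most 1/E, with E = ⌈1/ε⌉.
Dividing by the maximum of 1 and the constraint values restores feasibility at the cost of a factor
1 + 1/E, because f is concave along rays in the nonnegative orthant. The bound M ≤ 4n·OPT
(`objSize_le`) turns the additive errors into relative ones (`result_spec`).

For the running time, both points are rounded to a grid whose denominator is polynomial in n and E.
Hence lengths do not accumulate over the iterations, and every intermediate number has polynomial
length. `Run` counts elementary steps under such a length bound, and `Run.exec` converts the count
into logarithmic cost. -/

namespace QuadApprox

open Matrix

/-! ### Quadratic functions with nonpositive Hessian entries -/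

section Quadratic

variable {ι : Type*} [Fintype ι]

/-- The quadratic function `yᵀHy/2 + bᵀy`. -/
noncomputable def quadFun (H : Matrix ι ι ℝ) (b y : ι → ℝ) : ℝ :=
  (y ⬝ᵥ H *ᵥ y) / 2 + b ⬝ᵥ y

/-- The gradient of `quadFun` for symmetric `H`. -/
noncomputable def quadGrad (H : Matrix ι ι ℝ) (b y : ι → ℝ) : ι → ℝ :=
  b + H *ᵥ y

theorem quadForm_comm {H : Matrix ι ι ℝ} (hH : H.IsSymm) (x y : ι → ℝ) :
    x ⬝ᵥ H *ᵥ y = y ⬝ᵥ H *ᵥ x := by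
  rw [dotProduct_mulVec, ← mulVec_transpose, hH.eq, dotProduct_comm]

theorem quadForm_add {H : Matrix ι ι ℝ} (hH : H.IsSymm) (y d : ι → ℝ) :
    (y + d) ⬝ᵥ H *ᵥ (y + d) = y ⬝ᵥ H *ᵥ y + 2 * (H *ᵥ y ⬝ᵥ d) + d ⬝ᵥ H *ᵥ d := by
  rw [mulVec_add, add_dotProduct, dotProduct_add, dotProduct_add, quadForm_comm hH y d,
    dotProduct_comm (H *ᵥ y) d]
  ring

theorem quadForm_smul (H : Matrix ι ι ℝ) (c : ℝ) (y : ι → ℝ) :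
    (c • y) ⬝ᵥ H *ᵥ (c • y) = c ^ 2 * (y ⬝ᵥ H *ᵥ y) := by
  rw [mulVec_smul, smul_dotProduct, dotProduct_smul, smul_eq_mul, smul_eq_mul]
  ring

theorem quadFun_add {H : Matrix ι ι ℝ} (hH : H.IsSymm) (b y d : ι → ℝ) :
    quadFun H b (y + d) = quadFun H b y + quadGrad H b y ⬝ᵥ d + (d ⬝ᵥ H *ᵥ d) / 2 := by
  simp only [quadFun, quadGrad, quadForm_add hH, add_dotProduct, dotProduct_add]
  ring

theorem quadForm_mono {H : Matrix ι ι ℝ} (hH : ∀ i j, 0 ≤ H i j) {x y : ι → ℝ}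
    (hx : 0 ≤ x) (hxy : x ≤ y) : x ⬝ᵥ H *ᵥ x ≤ y ⬝ᵥ H *ᵥ y := by
  simp only [dotProduct, mulVec]
  refine Finset.sum_le_sum fun i _ => mul_le_mul (hxy i) ?_ ?_ ((hx i).trans (hxy i))
  · exact Finset.sum_le_sum fun j _ => mul_le_mul_of_nonneg_left (hxy j) (hH i j)
  · exact Finset.sum_nonneg fun j _ => mul_nonneg (hH i j) (hx j)

theorem quadForm_nonpos {H : Matrix ι ι ℝ} (hH : ∀ i j, H i j ≤ 0) {d : ι → ℝ} (hd : 0 ≤ d) :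
    d ⬝ᵥ H *ᵥ d ≤ 0 := by
  simp only [dotProduct, mulVec]
  exact Finset.sum_nonpos fun i _ => mul_nonpos_of_nonneg_of_nonpos (hd i)
    (Finset.sum_nonpos fun j _ => mul_nonpos_of_nonpos_of_nonneg (hH i j) (hd j))

/-- A convex quadratic form lies above its tangents. -/
theorem quadForm_tangent {Q : Matrix ι ι ℝ} (hQ : Q.IsSymm) (hpsd : ∀ x, 0 ≤ x ⬝ᵥ Q *ᵥ x)
    (x y : ι → ℝ) : y ⬝ᵥ Q *ᵥ y + 2 * (Q *ᵥ y ⬝ᵥ (x - y)) ≤ x ⬝ᵥ Q *ᵥ x := by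
  have h := quadForm_add hQ y (x - y)
  rw [add_sub_cancel] at h
  linarith [hpsd (x - y)]

theorem quadFun_le_linear {H : Matrix ι ι ℝ} (hH : ∀ i j, H i j ≤ 0) (b : ι → ℝ)
    {y : ι → ℝ} (hy : 0 ≤ y) : quadFun H b y ≤ b ⬝ᵥ y := by
  have := quadForm_nonpos hH hy
  unfold quadFun; linarith

/-- On a ray from the origin into the nonnegative orthant the function is concave and vanishes at
the origin. This bounds the loss when an almost feasible point is shrunk. -/
theorem quadFun_smul_ge {H : Matrix ι ι ℝ} (hH : ∀ i j, H i j ≤ 0) (b : ι → ℝ)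
    {y : ι → ℝ} (hy : 0 ≤ y) {s : ℝ} (hs : 0 ≤ s) (hs1 : s ≤ 1) :
    s * quadFun H b y ≤ quadFun H b (s • y) := by
  have := quadForm_nonpos hH hy
  simp only [quadFun, quadForm_smul, dotProduct_smul, smul_eq_mul]
  nlinarith [mul_nonneg hs (sub_nonneg.2 hs1)]

/-- The diminishing returns bound behind the measured continuous greedy method. -/
theorem quadGrad_measured_ge {H : Matrix ι ι ℝ} (hsym : H.IsSymm) (hH : ∀ i j, H i j ≤ 0)
    {b u : ι → ℝ} (hF : ∀ y : ι → ℝ, 0 ≤ y → (∀ i, u i * y i ≤ 1) → 0 ≤ quadFun H b y)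
    {y x : ι → ℝ} (hy : 0 ≤ y) (hx : 0 ≤ x) (hux : ∀ i, u i * x i ≤ 1)
    {θ : ℝ} (hθ : 0 < θ) (hθ1 : θ ≤ 1) (huy : ∀ i, u i * y i ≤ θ) :
    (1 - θ) * quadFun H b x - quadFun H b y ≤
      quadGrad H b y ⬝ᵥ fun i => (1 - u i * y i) * x i := by
  set v : ι → ℝ := fun i => (1 - u i * y i) * x i with hv
  set w : ι → ℝ := fun i => y i * (1 - u i * x i) with hw
  have hv0 : 0 ≤ v := fun i => mul_nonneg (by linarith [huy i]) (hx i)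
  have hw0 : 0 ≤ w := fun i => mul_nonneg (hy i) (by linarith [hux i])
  -- Both sides are the probabilistic sum of the two points: multiplied by u_i, each becomes 1 - (1
  -- - u_i x_i)(1 - u_i y_i).
  have hvw : y + v = x + w := by
    funext i; simp only [hv, hw, Pi.add_apply]; ring
  have h1 := quadFun_add hsym b y v
  have h2 := quadFun_add hsym b x w
  have h3 := quadFun_add hsym b x (θ⁻¹ • w)
  rw [quadForm_smul, dotProduct_smul, smul_eq_mul] at h3
  have hq := quadForm_nonpos hH hv0
  have hqw := quadForm_nonpos hH hw0
  -- Because u_i y_i ≤ θ, the point x + w/θ is still in the box where the function is nonnegative.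
  -- Concavity along w between x and this point gives F(x + w) ≥ (1 - θ) F(x), while concavity along
  -- v bounds F(y + v) from above by its tangent at y.
  have h4 : 0 ≤ quadFun H b (x + θ⁻¹ • w) := by
    refine hF _ (add_nonneg hx (smul_nonneg (inv_nonneg.2 hθ.le) hw0)) fun i => ?_
    have e : u i * (x + θ⁻¹ • w) i = u i * x i + (θ⁻¹ * (u i * y i)) * (1 - u i * x i) := by
      simp only [hw, Pi.add_apply, Pi.smul_apply, smul_eq_mul]; ring
    have h5 : θ⁻¹ * (u i * y i) ≤ 1 := by
      rw [inv_mul_le_iff₀ hθ, mul_one]; exact huy i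
    rw [e]
    nlinarith [hux i]
  rw [hvw] at h1
  have h6 : θ * (θ⁻¹ * (quadGrad H b x ⬝ᵥ w)) = quadGrad H b x ⬝ᵥ w := by
    field_simp
  have h7 : θ * (θ⁻¹ ^ 2 * (w ⬝ᵥ H *ᵥ w)) = θ⁻¹ * (w ⬝ᵥ H *ᵥ w) := by
    field_simp
  have h8 : θ⁻¹ * (w ⬝ᵥ H *ᵥ w) ≤ w ⬝ᵥ H *ᵥ w := by
    have : 1 ≤ θ⁻¹ := (one_le_inv₀ hθ).2 hθ1
    nlinarith
  have h9 := mul_nonneg hθ.le h4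
  rw [h3] at h9
  have h10 : θ * (quadFun H b x + θ⁻¹ * (quadGrad H b x ⬝ᵥ w) + θ⁻¹ ^ 2 * (w ⬝ᵥ H *ᵥ w) / 2) =
      θ * quadFun H b x + quadGrad H b x ⬝ᵥ w + θ⁻¹ * (w ⬝ᵥ H *ᵥ w) / 2 := by
    rw [mul_add, mul_add, h6, mul_div_assoc', h7]
  linarith

/-- Hessian entries `H i j ≥ -(b i + b j)` bound the loss of second order of a small step. -/
theorem quadForm_small_ge {H : Matrix ι ι ℝ} {b : ι → ℝ}
    (hlow : ∀ i j, -(b i + b j) ≤ H i j) (hb : 0 ≤ b) (hsum : ∑ i, b i ≤ 1)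
    {d : ι → ℝ} {δ : ℝ} (hδ : 0 ≤ δ) (hd : 0 ≤ d) (hdδ : ∀ i, d i ≤ δ) :
    -(2 * Fintype.card ι * δ ^ 2) ≤ d ⬝ᵥ H *ᵥ d := by
  have h1 : ∀ i j, -(δ ^ 2 * (b i + b j)) ≤ d i * (H i j * d j) := fun i j => by
    have : d i * d j ≤ δ ^ 2 := by
      rw [sq]; exact mul_le_mul (hdδ i) (hdδ j) (hd j) hδ
    nlinarith [mul_nonneg (hd i) (hd j), hlow i j, add_nonneg (hb i) (hb j)]
  have h2 : d ⬝ᵥ H *ᵥ d = ∑ i, ∑ j, d i * (H i j * d j) := by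
    simp only [dotProduct, mulVec, Finset.mul_sum]
  have h3 : ∑ i : ι, ∑ j : ι, -(δ ^ 2 * (b i + b j)) = -(2 * Fintype.card ι * δ ^ 2) * ∑ i, b i := by
    simp only [Finset.sum_neg_distrib, ← Finset.mul_sum, Finset.sum_add_distrib, Finset.sum_const,
      Finset.card_univ, nsmul_eq_mul]
    ring
  have h4 : ∑ i : ι, ∑ j : ι, -(δ ^ 2 * (b i + b j)) ≤ d ⬝ᵥ H *ᵥ d := by
    rw [h2]
    exact Finset.sum_le_sum fun i _ => Finset.sum_le_sum fun j _ => h1 i j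
  rw [h3] at h4
  have : (0 : ℝ) ≤ 2 * Fintype.card ι * δ ^ 2 := by positivity
  nlinarith

theorem quadGrad_le {H : Matrix ι ι ℝ} (hH : ∀ i j, H i j ≤ 0) (b : ι → ℝ) {y : ι → ℝ}
    (hy : 0 ≤ y) (i : ι) : quadGrad H b y i ≤ b i := by
  simp only [quadGrad, Pi.add_apply, mulVec, dotProduct]
  have : ∑ j, H i j * y j ≤ 0 :=
    Finset.sum_nonpos fun j _ => mul_nonpos_of_nonpos_of_nonneg (hH i j) (hy j)
  linarith

/-- Summed over j, the lower bound on row i of the Hessian costs at most n b_i + ∑ b_j ≤ n + 1. The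
gradient method needs this bound on its step lengths. -/
theorem abs_quadGrad_le {H : Matrix ι ι ℝ} {b : ι → ℝ} (hH : ∀ i j, H i j ≤ 0)
    (hlow : ∀ i j, -(b i + b j) ≤ H i j) (hb : 0 ≤ b) (hsum : ∑ i, b i ≤ 1)
    {y : ι → ℝ} (hy : 0 ≤ y) (hy1 : ∀ i, y i ≤ 1) (i : ι) :
    |quadGrad H b y i| ≤ Fintype.card ι + 1 := by
  have hbi : b i ≤ 1 := (Finset.single_le_sum (fun j _ => hb j) (Finset.mem_univ i)).trans hsum
  have h1 := quadGrad_le hH b hy i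
  have h2 : -∑ j, (b i + b j) ≤ ∑ j, H i j * y j := by
    rw [← Finset.sum_neg_distrib]
    refine Finset.sum_le_sum fun j _ => ?_
    nlinarith [hlow i j, hH i j, hy j, hy1 j]
  rw [Finset.sum_add_distrib, Finset.sum_const, Finset.card_univ, nsmul_eq_mul] at h2
  have h3 : quadGrad H b y i = b i + ∑ j, H i j * y j := rfl
  have hc : (0 : ℝ) ≤ Fintype.card ι := by positivity
  have h0 : 0 ≤ b i := hb i
  rw [abs_le]
  constructor <;> nlinarith

end Quadratic

/-- One coordinate of a rounded projected gradient step. -/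
theorem sq_dist_clamp_le {z z' y g ρ : ℝ} (hy : 0 ≤ y) (hy1 : y ≤ 1) (hz : 0 ≤ z')
    (hz1 : z' ≤ 1) (hρ : |z' - max 0 (min 1 (z + g))| ≤ ρ) :
    (z' - y) ^ 2 ≤ (z - y) ^ 2 - 2 * g * (y - z) + g ^ 2 + 2 * ρ := by
  set c := max 0 (min 1 (z + g)) with hc
  have hc0 : 0 ≤ c := le_max_left _ _
  have hc1 : c ≤ 1 := max_le zero_le_one (min_le_left _ _)
  -- Projection to [0,1] does not increase the distance to a point y of that interval.
  have h1 : (c - y) ^ 2 ≤ (z + g - y) ^ 2 := by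
    rw [sq_le_sq, hc]
    rcases le_total (z + g) 0 with h | h
    · rw [min_eq_right (h.trans zero_le_one), max_eq_left h, zero_sub, abs_neg, abs_of_nonneg hy,
        abs_of_nonpos (by linarith)]
      linarith
    · rcases le_total 1 (z + g) with h' | h'
      · rw [min_eq_left h', max_eq_right zero_le_one, abs_of_nonneg (by linarith),
          abs_of_nonneg (by linarith)]
        linarith
      · rw [min_eq_right h', max_eq_right h]
  -- On [0,1] the squared distance to y is Lipschitz with constant 2, so rounding by ρ costs at most
  -- 2ρ.
  have h2 : (z' - y) ^ 2 - (c - y) ^ 2 ≤ 2 * ρ := by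
    have e : (z' - y) ^ 2 - (c - y) ^ 2 = (z' - c) * (z' + c - 2 * y) := by ring
    rw [e]
    refine (le_abs_self _).trans ?_
    rw [abs_mul]
    have : |z' + c - 2 * y| ≤ 2 := by rw [abs_le]; constructor <;> linarith
    nlinarith [abs_nonneg (z' - c), abs_nonneg (z' + c - 2 * y)]
  nlinarith

/-! ### Projected gradient steps and the penalty for violated constraints -/

section Potential

variable {ι : Type*} [Fintype ι]

/-- A rounded projected gradient step for the linear gain `k`. -/
theorem sq_dist_step_le {z z' y k : ι → ℝ} {γ L ρ : ℝ}
    (hy : ∀ i, 0 ≤ y i ∧ y i ≤ 1) (hz : ∀ i, 0 ≤ z' i ∧ z' i ≤ 1)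
    (hk : ∀ i, |k i| ≤ L)
    (hρ : ∀ i, |z' i - max 0 (min 1 (z i + γ * k i))| ≤ ρ) :
    ∑ i, (z' i - y i) ^ 2 ≤ ∑ i, (z i - y i) ^ 2 - 2 * γ * (k ⬝ᵥ (y - z))
      + Fintype.card ι * (γ ^ 2 * L ^ 2 + 2 * ρ) := by
  have h : ∀ i, (z' i - y i) ^ 2 ≤ (z i - y i) ^ 2 - 2 * γ * (k i * (y i - z i))
      + (γ ^ 2 * L ^ 2 + 2 * ρ) := fun i => by
    have h1 := sq_dist_clamp_le (hy i).1 (hy i).2 (hz i).1 (hz i).2 (hρ i)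
    have h2 : k i ^ 2 ≤ L ^ 2 := sq_le_sq.2 ((hk i).trans (le_abs_self L))
    nlinarith [mul_le_mul_of_nonneg_left h2 (sq_nonneg γ)]
  refine (Finset.sum_le_sum fun i _ => h i).trans (le_of_eq ?_)
  rw [Finset.sum_add_distrib, Finset.sum_sub_distrib, Finset.sum_const, Finset.card_univ,
    nsmul_eq_mul, ← Finset.mul_sum]
  rfl

/-- The indicator of `1 < c`. -/
noncomputable def exceeds (c : ℝ) : ℝ := if 1 < c then 1 else 0

theorem exceeds_cases (c : ℝ) : (1 < c ∧ exceeds c = 1) ∨ (c ≤ 1 ∧ exceeds c = 0) := by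
  unfold exceeds
  by_cases h : 1 < c
  · simp [h]
  · exact Or.inr ⟨not_lt.1 h, if_neg h⟩

/-- The total violation of the constraints `zᵀQz ≤ 1` and `qᵀz ≤ 1`. -/
noncomputable def violation (Q : Matrix ι ι ℝ) (q z : ι → ℝ) : ℝ :=
  exceeds (z ⬝ᵥ Q *ᵥ z) * (z ⬝ᵥ Q *ᵥ z - 1) + exceeds (q ⬝ᵥ z) * (q ⬝ᵥ z - 1)

/-- A subgradient of `violation`. -/
noncomputable def violationGrad (Q : Matrix ι ι ℝ) (q z : ι → ℝ) : ι → ℝ := fun i =>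
  exceeds (z ⬝ᵥ Q *ᵥ z) * (2 * (Q *ᵥ z) i) + exceeds (q ⬝ᵥ z) * q i

theorem violation_bounds (Q : Matrix ι ι ℝ) (q z : ι → ℝ) :
    0 ≤ violation Q q z ∧ z ⬝ᵥ Q *ᵥ z ≤ 1 + violation Q q z ∧ q ⬝ᵥ z ≤ 1 + violation Q q z := by
  unfold violation
  rcases exceeds_cases (z ⬝ᵥ Q *ᵥ z) with ⟨h, e⟩ | ⟨h, e⟩ <;>
  rcases exceeds_cases (q ⬝ᵥ z) with ⟨h', e'⟩ | ⟨h', e'⟩ <;> rw [e, e'] <;>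
  refine ⟨?_, ?_, ?_⟩ <;> linarith

/-- A violated constraint is a convex function of z, so its tangent at z lies below its value at x,
which is at most 1. A satisfied constraint contributes zero to both terms. -/
theorem violation_subgradient {Q : Matrix ι ι ℝ} (hQ : Q.IsSymm)
    (hpsd : ∀ x, 0 ≤ x ⬝ᵥ Q *ᵥ x) (q z x : ι → ℝ) (h1 : x ⬝ᵥ Q *ᵥ x ≤ 1) (h2 : q ⬝ᵥ x ≤ 1) :
    violation Q q z + violationGrad Q q z ⬝ᵥ (x - z) ≤ 0 := by
  have e : violationGrad Q q z = (exceeds (z ⬝ᵥ Q *ᵥ z) * 2) • (Q *ᵥ z) + exceeds (q ⬝ᵥ z) • q := by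
    funext i; simp only [violationGrad, Pi.add_apply, Pi.smul_apply, smul_eq_mul]; ring
  have t := quadForm_tangent hQ hpsd x z
  have t' : q ⬝ᵥ (x - z) = q ⬝ᵥ x - q ⬝ᵥ z := dotProduct_sub _ _ _
  rw [e, add_dotProduct, smul_dotProduct, smul_dotProduct, smul_eq_mul, smul_eq_mul]
  unfold violation
  rcases exceeds_cases (z ⬝ᵥ Q *ᵥ z) with ⟨h, e⟩ | ⟨h, e⟩ <;>
  rcases exceeds_cases (q ⬝ᵥ z) with ⟨h', e'⟩ | ⟨h', e'⟩ <;> rw [e, e'] <;> linarith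

theorem violationGrad_le {Q : Matrix ι ι ℝ} {q z : ι → ℝ} (hQ : ∀ i j, 0 ≤ Q i j ∧ Q i j ≤ 1)
    (hq : ∀ i, 0 ≤ q i ∧ q i ≤ 1) (hz : ∀ i, 0 ≤ z i ∧ z i ≤ 1) (i : ι) :
    |violationGrad Q q z i| ≤ 2 * (Fintype.card ι + 1) := by
  have h0 : 0 ≤ (Q *ᵥ z) i := Finset.sum_nonneg fun j _ => mul_nonneg (hQ i j).1 (hz j).1
  have h1 : (Q *ᵥ z) i ≤ Fintype.card ι := by
    have : ∑ j, Q i j * z j ≤ ∑ _j : ι, (1 : ℝ) :=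
      Finset.sum_le_sum fun j _ => mul_le_one₀ (hQ i j).2 (hz j).1 (hz j).2
    simpa [mulVec, dotProduct] using this
  have hqi := hq i
  unfold violationGrad
  rcases exceeds_cases (z ⬝ᵥ Q *ᵥ z) with ⟨h, e⟩ | ⟨h, e⟩ <;>
  rcases exceeds_cases (q ⬝ᵥ z) with ⟨h', e'⟩ | ⟨h', e'⟩ <;> rw [e, e', abs_le] <;>
  constructor <;> linarith

end Potential

end QuadApprox

namespace QuadApprox

open Matrix

/-! ### One iteration of the measured greedy method -/

section Greedy

variable {ι : Type*} [Fintype ι]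

/-- The properties of the data after the coordinates, the objective and the constraints have been
scaled to unit size; `u` holds the scaling factors of the coordinates. -/
structure IsNormalized (H Q : Matrix ι ι ℝ) (b q u : ι → ℝ) : Prop where
  symH : H.IsSymm
  nonpos : ∀ i j, H i j ≤ 0
  low : ∀ i j, -(b i + b j) ≤ H i j
  b_nonneg : 0 ≤ b
  b_sum : ∑ i, b i = 1
  -- The box u_i y_i ≤ 1 contains the unit cube, since u_i ≤ 1. The larger region is needed: the
  -- auxiliary point in `quadGrad_measured_ge` may leave the unit cube.
  fun_nonneg : ∀ y : ι → ℝ, 0 ≤ y → (∀ i, u i * y i ≤ 1) → 0 ≤ quadFun H b y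
  symQ : Q.IsSymm
  psd : ∀ x, 0 ≤ x ⬝ᵥ Q *ᵥ x
  Q_mem : ∀ i j, 0 ≤ Q i j ∧ Q i j ≤ 1
  q_mem : ∀ i, 0 ≤ q i ∧ q i ≤ 1
  u_mem : ∀ i, 0 ≤ u i ∧ u i ≤ 1

/-- The direction of the update of the second sequence. -/
noncomputable def gain (H Q : Matrix ι ι ℝ) (b q u : ι → ℝ) (K : ℝ) (y z : ι → ℝ) : ι → ℝ :=
  fun i => (1 - u i * y i) * quadGrad H b y i - K * violationGrad Q q z i

/-- One iteration: `y` makes a measured greedy step along `z`, and `z` makes a projected gradient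
step, both up to rounding errors `1 / D`. -/
structure IsStep (H Q : Matrix ι ι ℝ) (b q u : ι → ℝ) (K Γ T D : ℝ)
    (y z y' z' : ι → ℝ) : Prop where
  y_le : ∀ i, y' i ≤ y i + (1 - u i * y i) * z i / T
  y_ge : ∀ i, y i + (1 - u i * y i) * z i / T - 1 / D ≤ y' i
  -- This does not follow from the two bounds above. It will hold because y is already a grid point
  -- when the new value is rounded down.
  y_mono : y ≤ y'
  z_mem : ∀ i, 0 ≤ z' i ∧ z' i ≤ 1
  z_near : ∀ i, |z' i - max 0 (min 1 (z i + 1 / Γ * gain H Q b q u K y z i))| ≤ 1 / D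

variable {H Q : Matrix ι ι ℝ} {b q u : ι → ℝ} {K Γ T D : ℝ}

theorem IsNormalized.quadFun_le_one (hN : IsNormalized H Q b q u) {y : ι → ℝ}
    (hy : ∀ i, 0 ≤ y i ∧ y i ≤ 1) : quadFun H b y ≤ 1 := by
  refine (quadFun_le_linear hN.nonpos b fun i => (hy i).1).trans ?_
  rw [← hN.b_sum]
  exact Finset.sum_le_sum fun i _ => mul_le_of_le_one_right (hN.b_nonneg i) (hy i).2

theorem IsNormalized.abs_gain_le (hN : IsNormalized H Q b q u) (hK : 0 ≤ K) {y z : ι → ℝ}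
    (hy : ∀ i, 0 ≤ y i ∧ y i ≤ 1) (hz : ∀ i, 0 ≤ z i ∧ z i ≤ 1) (i : ι) :
    |gain H Q b q u K y z i| ≤ (Fintype.card ι + 1) * (1 + 2 * K) := by
  have h1 := abs_quadGrad_le hN.nonpos hN.low hN.b_nonneg hN.b_sum.le (fun i => (hy i).1)
    (fun i => (hy i).2) i
  have h2 := violationGrad_le hN.Q_mem hN.q_mem hz i
  have h3 : |1 - u i * y i| ≤ 1 := by
    have := mul_nonneg (hN.u_mem i).1 (hy i).1
    have := mul_le_one₀ (hN.u_mem i).2 (hy i).1 (hy i).2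
    rw [abs_le]; constructor <;> linarith
  calc |gain H Q b q u K y z i| ≤ |(1 - u i * y i) * quadGrad H b y i| +
        |K * violationGrad Q q z i| := abs_sub _ _
    _ ≤ 1 * (Fintype.card ι + 1) + K * (2 * (Fintype.card ι + 1)) := by
        rw [abs_mul, abs_mul, abs_of_nonneg hK]
        gcongr
    _ = _ := by ring

/-- Progress of the potential `F(y) - κ ‖z - x‖²` in one iteration. -/
theorem IsStep.potential_ge {y z y' z' : ι → ℝ} (hS : IsStep H Q b q u K Γ T D y z y' z')
    (hN : IsNormalized H Q b q u) (hK : 0 ≤ K) (hΓ : 0 < Γ) (hT : 0 < T)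
    (hy : ∀ i, 0 ≤ y i ∧ y i ≤ 1) (hz : ∀ i, 0 ≤ z i ∧ z i ≤ 1)
    {θ : ℝ} (hθ : 0 ≤ θ) (hθ1 : θ ≤ 1) (huy : ∀ i, u i * y i ≤ θ) (h0 : θ = 0 → y = 0)
    {x : ι → ℝ} (hx : ∀ i, 0 ≤ x i ∧ x i ≤ 1) (hx1 : x ⬝ᵥ Q *ᵥ x ≤ 1) (hx2 : q ⬝ᵥ x ≤ 1) :
    quadFun H b y - Γ / (2 * T) * ∑ i, (z i - x i) ^ 2
      + ((1 - θ) * quadFun H b x - quadFun H b y + K * violation Q q z) / T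
      - (Fintype.card ι / T ^ 2 + 1 / D + Γ / (2 * T) * (Fintype.card ι *
        ((((Fintype.card ι + 1) * (1 + 2 * K)) / Γ) ^ 2 + 2 / D)))
      ≤ quadFun H b y' - Γ / (2 * T) * ∑ i, (z' i - x i) ^ 2 := by
  set h : ι → ℝ := fun i => (1 - u i * y i) * quadGrad H b y i with hh
  set d : ι → ℝ := y' - y with hd
  have hux : ∀ i, u i * x i ≤ 1 := fun i => mul_le_one₀ (hN.u_mem i).2 (hx i).1 (hx i).2
  have hd0 : 0 ≤ d := sub_nonneg.2 hS.y_mono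
  have hfac : ∀ i, 0 ≤ (1 - u i * y i) * z i ∧ (1 - u i * y i) * z i ≤ 1 := fun i => by
    have h1 := mul_nonneg (hN.u_mem i).1 (hy i).1
    have h2 := huy i
    exact ⟨mul_nonneg (by linarith) (hz i).1, mul_le_one₀ (by linarith) (hz i).1 (hz i).2⟩
  have hdT : ∀ i, d i ≤ 1 / T := fun i => by
    have h1 := hS.y_le i
    have h2 : (1 - u i * y i) * z i / T ≤ 1 / T := by gcongr; exact (hfac i).2
    simp only [hd, Pi.sub_apply]; linarith
  have e1 : quadFun H b y' = quadFun H b y + quadGrad H b y ⬝ᵥ d + (d ⬝ᵥ H *ᵥ d) / 2 := by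
    rw [← quadFun_add hN.symH, hd, add_sub_cancel]
  have e2 := quadForm_small_ge hN.low hN.b_nonneg hN.b_sum.le (by positivity) hd0 hdT
  -- The rounding of y is downward only. Where the gradient is negative this helps; elsewhere the
  -- gradient is at most b_i, and ∑ b_i = 1, so the total loss is at most 1/D.
  have e3 : (h ⬝ᵥ z) / T - 1 / D ≤ quadGrad H b y ⬝ᵥ d := by
    have h1 : ∀ i, h i * z i / T - b i * (1 / D) ≤ quadGrad H b y i * d i := fun i => by
      have g := quadGrad_le hN.nonpos b (fun i => (hy i).1) i
      have ρ0 : 0 ≤ (1 - u i * y i) * z i / T - d i := by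
        have := hS.y_le i
        simp only [hd, Pi.sub_apply]; linarith
      have ρ1 : (1 - u i * y i) * z i / T - d i ≤ 1 / D := by
        have := hS.y_ge i
        simp only [hd, Pi.sub_apply]; linarith
      have h2 := mul_le_mul_of_nonneg_right g ρ0
      have h3 := mul_le_mul_of_nonneg_left ρ1 (hN.b_nonneg i)
      have h4 : h i * z i / T = quadGrad H b y i * ((1 - u i * y i) * z i / T) := by
        simp only [hh]; ring
      rw [h4]; linarith
    have h2 := Finset.sum_le_sum fun i (_ : i ∈ Finset.univ) => h1 i
    rw [Finset.sum_sub_distrib, ← Finset.sum_mul, ← Finset.sum_div, hN.b_sum, one_mul] at h2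
    exact h2
  have e4 := sq_dist_step_le hx hS.z_mem (hN.abs_gain_le hK hy hz) hS.z_near
  have e5 : gain H Q b q u K y z ⬝ᵥ (x - z) =
      h ⬝ᵥ x - h ⬝ᵥ z - K * (violationGrad Q q z ⬝ᵥ (x - z)) := by
    have : gain H Q b q u K y z = h - K • violationGrad Q q z := by
      funext i; simp [gain, hh]
    rw [this, sub_dotProduct, smul_dotProduct, dotProduct_sub, smul_eq_mul]
  have e6 := mul_le_mul_of_nonneg_left (violation_subgradient hN.symQ hN.psd q z x hx1 hx2) hK
  have e7 : (1 - θ) * quadFun H b x - quadFun H b y ≤ h ⬝ᵥ x := by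
    have e : h ⬝ᵥ x = quadGrad H b y ⬝ᵥ fun i => (1 - u i * y i) * x i := by
      simp only [dotProduct, hh]
      exact Finset.sum_congr rfl fun i _ => by ring
    rw [e]
    -- The measured bound divides by θ, so θ = 0 is separate. There y = 0 and concavity along x
    -- suffices.
    rcases hθ.eq_or_lt with h | h
    · have hy0 := h0 h.symm
      have h1 := quadFun_add hN.symH b y x
      have h2 := quadForm_nonpos hN.nonpos (fun i => (hx i).1 : 0 ≤ x)
      have h3 : (fun i => (1 - u i * y i) * x i) = x := by
        funext i; simp [hy0]
      have h4 : y + x = x := by rw [hy0, zero_add]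
      rw [h4] at h1
      rw [h3, ← h]; linarith
    · exact quadGrad_measured_ge hN.symH hN.nonpos hN.fun_nonneg (fun i => (hy i).1)
        (fun i => (hx i).1) hux h hθ1 huy
  have e8 : (h ⬝ᵥ x - h ⬝ᵥ z + K * violation Q q z) / T ≤
      gain H Q b q u K y z ⬝ᵥ (x - z) / T := by
    gcongr
    rw [e5]; linarith
  have e9 : ((1 - θ) * quadFun H b x - quadFun H b y + K * violation Q q z) / T ≤
      (h ⬝ᵥ x + K * violation Q q z) / T := by
    gcongr
  have κ0 : 0 ≤ Γ / (2 * T) := by positivity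
  have e10 := mul_le_mul_of_nonneg_left e4 κ0
  -- The weight Γ / (2T) turns the regret term of a step of size 1/Γ into ⟨gain, x - z⟩ / T. Its
  -- part -⟨h, z⟩ / T cancels the growth ⟨h, z⟩ / T of F(y), and only ⟨h, x⟩ and the penalty remain.
  have e11 : Γ / (2 * T) * (2 * (1 / Γ) * (gain H Q b q u K y z ⬝ᵥ (x - z))) =
      gain H Q b q u K y z ⬝ᵥ (x - z) / T := by
    field_simp
  have e12 : (1 / Γ) ^ 2 * ((Fintype.card ι + 1) * (1 + 2 * K)) ^ 2 + 2 * (1 / D) =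
      (((Fintype.card ι + 1) * (1 + 2 * K)) / Γ) ^ 2 + 2 / D := by
    ring
  rw [e12, mul_add, mul_sub, e11] at e10
  have e15 : 2 * Fintype.card ι * (1 / T) ^ 2 = 2 * (Fintype.card ι / T ^ 2) := by ring
  rw [e15] at e2
  have e16 : (h ⬝ᵥ x - h ⬝ᵥ z + K * violation Q q z) / T =
      (h ⬝ᵥ x + K * violation Q q z) / T - (h ⬝ᵥ z) / T := by ring
  rw [e16] at e8
  linarith

/-- A recursion with contraction factor `1 - δ`. -/
theorem potential_unroll {R : ℕ → ℝ} {T : ℕ} {δ V c e : ℝ} (hδ : 0 ≤ δ) (hδ1 : δ ≤ 1)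
    (hc : 0 ≤ c) (he : 0 ≤ e) (h0 : -c ≤ R 0)
    (hR : ∀ t < T, (1 - δ) * R t + δ * (1 - δ) ^ t * V - e ≤ R (t + 1)) :
    ∀ t ≤ T, t * δ * (1 - δ) ^ (t - 1) * V - c - t * e ≤ R t := by
  intro t
  induction t with
  | zero => intro _; simpa using h0
  | succ t ih =>
    intro ht
    have h1 := mul_le_mul_of_nonneg_left (ih (by omega)) (sub_nonneg.2 hδ1)
    have h2 := hR t (by omega)
    -- At t = 0 the truncated exponent t - 1 is harmless because of the factor t.
    have h3 : (1 - δ) * (t * δ * (1 - δ) ^ (t - 1) * V) = t * δ * (1 - δ) ^ t * V := by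
      rcases t with _ | t
      · simp
      · simp only [Nat.add_sub_cancel]; ring
    have h4 : 0 ≤ δ * (c + t * e) := by positivity
    rw [Nat.add_sub_cancel]
    push_cast
    linarith

/-- With T = k + 1 the base is the inverse of 1 + 1/k, and (1 + 1/k)^k ≤ e. The exponent T - 1 is
exactly the one left by `potential_unroll`, so discretization costs nothing in this term. -/
theorem exp_neg_one_le_one_sub_inv_pow {T : ℕ} (hT : 0 < T) :
    Real.exp (-1) ≤ (1 - 1 / (T : ℝ)) ^ (T - 1) := by
  obtain ⟨k, rfl⟩ : ∃ k, T = k + 1 := ⟨T - 1, by omega⟩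
  rw [Nat.add_sub_cancel]
  rcases Nat.eq_zero_or_pos k with rfl | hk
  · simp
  · have hk' : (0 : ℝ) < k := by exact_mod_cast hk
    have h1 : 1 - 1 / ((k + 1 : ℕ) : ℝ) = (1 / (k : ℝ) + 1)⁻¹ := by
      push_cast; field_simp; ring
    have h2 : (1 / (k : ℝ) + 1) ^ k ≤ Real.exp 1 := by
      have := pow_le_pow_left₀ (by positivity) (Real.add_one_le_exp (1 / (k : ℝ))) k
      rwa [← Real.exp_nat_mul, mul_one_div_cancel hk'.ne'] at this
    rw [h1, inv_pow, Real.exp_neg]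
    exact inv_anti₀ (by positivity) h2

end Greedy

/-! ### All iterations together -/

section Run

variable {ι : Type*} [Fintype ι] {H Q : Matrix ι ι ℝ} {b q u : ι → ℝ} {K Γ D : ℝ} {T : ℕ}
  {y z : ℕ → ι → ℝ}

/-- The slack 1 - u_i y_i loses at most the fraction 1/T of itself in a step, since u_i z_i ≤ 1;
this gives the geometric bound. Dropping the measured factor, which is at most 1, gives domination
by the average of the z's. -/
theorem iterate_bounds (hN : IsNormalized H Q b q u) (hT : 0 < T) (hy0 : y 0 = 0) (hz0 : z 0 = 0)
    (hS : ∀ t, IsStep H Q b q u K Γ T D (y t) (z t) (y (t + 1)) (z (t + 1))) (t : ℕ) :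
    (∀ i, 0 ≤ z t i ∧ z t i ≤ 1) ∧ (∀ i, 0 ≤ y t i) ∧
      (∀ i, u i * y t i ≤ 1 - (1 - 1 / (T : ℝ)) ^ t) ∧
      ∀ i, y t i ≤ 1 / (T : ℝ) * ∑ s ∈ Finset.range t, z s i := by
  have hT' : (0 : ℝ) < T := by exact_mod_cast hT
  have hδ : 1 / (T : ℝ) ≤ 1 := by
    rw [div_le_one hT']; exact_mod_cast hT
  have hz : ∀ t, ∀ i, 0 ≤ z t i ∧ z t i ≤ 1 := fun t => by
    rcases t with _ | t
    · simp [hz0]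
    · exact (hS t).z_mem
  refine ⟨hz t, ?_⟩
  induction t with
  | zero => simp [hy0]
  | succ t ih =>
    obtain ⟨h1, h2, h3⟩ := ih
    have hpow : 0 ≤ (1 - 1 / (T : ℝ)) ^ t := pow_nonneg (by linarith) _
    have hfac : ∀ i, 0 ≤ 1 - u i * y t i := fun i => by linarith [h2 i]
    refine ⟨fun i => (h1 i).trans ((hS t).y_mono i), fun i => ?_, fun i => ?_⟩
    · have hz' := hz t i
      have hu := hN.u_mem i
      have a1 := mul_le_mul_of_nonneg_left ((hS t).y_le i) hu.1
      have a2 : u i * z t i ≤ 1 := mul_le_one₀ hu.2 hz'.1 hz'.2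
      have a3 := mul_le_mul_of_nonneg_left a2 (hfac i)
      have a4 := mul_le_mul_of_nonneg_left a3 (by positivity : 0 ≤ 1 / (T : ℝ))
      have a5 := mul_le_mul_of_nonneg_left (h2 i) (sub_nonneg.2 hδ)
      have a6 : u i * (y t i + (1 - u i * y t i) * z t i / T) =
          u i * y t i + 1 / (T : ℝ) * ((1 - u i * y t i) * (u i * z t i)) := by ring
      rw [a6] at a1
      rw [pow_succ]
      linarith
    · rw [Finset.sum_range_succ, mul_add]
      have a1 := (hS t).y_le i
      have a2 : (1 - u i * y t i) * z t i / T ≤ 1 / (T : ℝ) * z t i := by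
        rw [div_eq_mul_one_div, mul_comm]
        gcongr
        refine mul_le_of_le_one_left (hz t i).1 ?_
        linarith [mul_nonneg (hN.u_mem i).1 (h1 i)]
      linarith [h3 i]

/-- Jensen's inequality for a convex quadratic form. -/
theorem quadForm_average_le {Q : Matrix ι ι ℝ} (hQ : Q.IsSymm) (hpsd : ∀ x, 0 ≤ x ⬝ᵥ Q *ᵥ x)
    (z : ℕ → ι → ℝ) (hT : 0 < T) :
    ((1 / (T : ℝ)) • ∑ s ∈ Finset.range T, z s) ⬝ᵥ
      Q *ᵥ ((1 / (T : ℝ)) • ∑ s ∈ Finset.range T, z s) ≤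
      1 / (T : ℝ) * ∑ s ∈ Finset.range T, z s ⬝ᵥ Q *ᵥ z s := by
  have hT' : (0 : ℝ) < T := by exact_mod_cast hT
  set v := (1 / (T : ℝ)) • ∑ s ∈ Finset.range T, z s with hv
  have h := Finset.sum_le_sum fun s (_ : s ∈ Finset.range T) => quadForm_tangent hQ hpsd (z s) v
  -- The tangents are taken at the average, and the deviations from the average sum to zero.
  have h2 : ∑ s ∈ Finset.range T, 2 * (Q *ᵥ v ⬝ᵥ (z s - v)) = 0 := by
    rw [← Finset.mul_sum, ← dotProduct_sum, Finset.sum_sub_distrib, Finset.sum_const,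
      Finset.card_range, hv, ← Nat.cast_smul_eq_nsmul ℝ, smul_smul, mul_one_div_cancel hT'.ne',
      one_smul, sub_self, dotProduct_zero, mul_zero]
  rw [Finset.sum_add_distrib, h2, add_zero, Finset.sum_const, Finset.card_range, nsmul_eq_mul] at h
  rw [div_mul_eq_mul_div, one_mul, le_div_iff₀ hT']
  linarith

/-- The guarantee in terms of the accumulated errors. -/
theorem iterate_guarantee (hN : IsNormalized H Q b q u) (hK : 0 < K) (hΓ : 0 < Γ) (hD : 0 < D)
    (hT : 0 < T) (hy0 : y 0 = 0) (hz0 : z 0 = 0)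
    (hS : ∀ t, IsStep H Q b q u K Γ T D (y t) (z t) (y (t + 1)) (z (t + 1)))
    {x : ι → ℝ} (hx : ∀ i, 0 ≤ x i ∧ x i ≤ 1) (hx1 : x ⬝ᵥ Q *ᵥ x ≤ 1) (hx2 : q ⬝ᵥ x ≤ 1)
    {κ e η : ℝ} (hκ : Γ / (2 * T) * Fintype.card ι ≤ κ)
    (he : T * (Fintype.card ι / (T : ℝ) ^ 2 + 1 / D + Γ / (2 * T) * (Fintype.card ι *
        ((((Fintype.card ι + 1) * (1 + 2 * K)) / Γ) ^ 2 + 2 / D))) ≤ e)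
    (hη : (2 + κ + e) / K ≤ η) :
    Real.exp (-1) * quadFun H b x - (2 * κ + e) ≤ quadFun H b (y T) ∧
      y T ⬝ᵥ Q *ᵥ y T ≤ 1 + η ∧ q ⬝ᵥ y T ≤ 1 + η := by
  have hT' : (0 : ℝ) < T := by exact_mod_cast hT
  have hδ : 1 / (T : ℝ) ≤ 1 := by
    rw [div_le_one hT']; exact_mod_cast hT
  set δ := 1 / (T : ℝ) with hδdef
  have hδ0 : 0 < δ := by positivity
  have hB := iterate_bounds hN hT hy0 hz0 hS
  set err := Fintype.card ι / (T : ℝ) ^ 2 + 1 / D + Γ / (2 * T) * (Fintype.card ι *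
        ((((Fintype.card ι + 1) * (1 + 2 * K)) / Γ) ^ 2 + 2 / D)) with herr
  have herr0 : 0 ≤ err := by positivity
  have hκ0 : 0 ≤ κ := le_trans (by positivity) hκ
  set Φ : ℕ → ℝ := fun t => Γ / (2 * T) * ∑ i, (z t i - x i) ^ 2 with hΦ
  have hΦ0 : ∀ t, 0 ≤ Φ t := fun t => by simp only [hΦ]; positivity
  have hΦκ : ∀ t, Φ t ≤ κ := fun t => by
    refine le_trans ?_ hκ
    simp only [hΦ]
    gcongr
    have : ∑ i, (z t i - x i) ^ 2 ≤ ∑ _i : ι, (1 : ℝ) := Finset.sum_le_sum fun i _ => by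
      have h1 := (hB t).1 i
      have h2 := hx i
      rw [sq_le_one_iff_abs_le_one, abs_le]; constructor <;> linarith
    simpa using this
  have hyle : ∀ t ≤ T, ∀ i, 0 ≤ y t i ∧ y t i ≤ 1 := fun t ht i => by
    refine ⟨(hB t).2.1 i, ((hB t).2.2.2 i).trans ?_⟩
    have h1 : ∑ s ∈ Finset.range t, z s i ≤ ∑ s ∈ Finset.range t, (1 : ℝ) :=
      Finset.sum_le_sum fun s _ => ((hB s).1 i).2
    rw [Finset.sum_const, Finset.card_range, nsmul_eq_mul, mul_one] at h1
    have h2 : (t : ℝ) ≤ T := by exact_mod_cast ht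
    rw [div_mul_eq_mul_div, one_mul, div_le_one hT']
    linarith
  have hpow : ∀ t, 0 ≤ (1 - δ) ^ t := fun t => pow_nonneg (by linarith) _
  have hpow1 : ∀ t, (1 - δ) ^ t ≤ 1 := fun t => pow_le_one₀ (by linarith) (by linarith)
  have hV0 : 0 ≤ quadFun H b x :=
    hN.fun_nonneg x (fun i => (hx i).1) fun i => mul_le_one₀ (hN.u_mem i).2 (hx i).1 (hx i).2
  set R : ℕ → ℝ := fun t => quadFun H b (y t) - Φ t with hR
  have key : ∀ t < T, R t + δ * ((1 - δ) ^ t * quadFun H b x - quadFun H b (y t) +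
      K * violation Q q (z t)) - err ≤ R (t + 1) := fun t ht => by
    have h := (hS t).potential_ge hN hK.le hΓ hT' (hyle t ht.le) (hB t).1
      (θ := 1 - (1 - δ) ^ t) (by linarith [hpow1 t]) (by linarith [hpow t]) (hB t).2.2.1
      (fun h => by
        rcases Nat.eq_zero_or_pos t with rfl | h'
        · exact hy0
        · exfalso
          have hlt : (1 - δ) ^ t < 1 := pow_lt_one₀ (by linarith) (by linarith) h'.ne'
          linarith) hx hx1 hx2
    rw [sub_sub_cancel] at h
    simp only [hR, hΦ, herr]
    rw [hδdef] at h ⊢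
    rw [one_div_mul_eq_div]
    linarith
  have hv := fun t => violation_bounds Q q (z t)
  have hFT := hN.quadFun_le_one (hyle T le_rfl)
  -- First use of the potential, with the penalty dropped. The contraction acts on F(y) = R + Φ
  -- rather than on R, which costs an additional δκ per step.
  have hmain := potential_unroll (R := R) (T := T) (V := quadFun H b x) hδ0.le hδ hκ0
    (e := δ * κ + err) (by positivity)
    (by
      have h1 := hΦκ 0
      have h2 : quadFun H b (y 0) = 0 := by simp [hy0, quadFun]
      simp only [hR, h2]; linarith)
    (fun t ht => by
      have h1 := key t ht
      have h2 := mul_nonneg hδ0.le (mul_nonneg hK.le (hv t).1)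
      have h3 := mul_le_mul_of_nonneg_left (hΦκ t) hδ0.le
      have h4 : quadFun H b (y t) = R t + Φ t := by simp only [hR]; ring
      rw [h4] at h1
      nlinarith) T le_rfl
  -- Second use: now F(x) ≥ 0 is dropped and F(y) ≤ 1 is used, so that the accumulated penalty is
  -- bounded by the range of the potential.
  have hpen : ∀ t ≤ T, -κ + δ * K * ∑ s ∈ Finset.range t, violation Q q (z s) - t * (δ + err) ≤
      R t := by
    intro t
    induction t with
    | zero =>
      intro _
      have h1 := hΦκ 0
      have h2 : quadFun H b (y 0) = 0 := by simp [hy0, quadFun]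
      simp only [hR, h2, Finset.range_zero, Finset.sum_empty, Nat.cast_zero]; linarith
    | succ t ih =>
      intro ht
      have h1 := key t (by omega)
      have h2 := ih (by omega)
      have h3 := mul_nonneg hδ0.le (mul_nonneg (hpow t) hV0)
      have h4 := mul_le_mul_of_nonneg_left (hN.quadFun_le_one (hyle t (by omega))) hδ0.le
      rw [Finset.sum_range_succ]
      push_cast
      linarith
  have hTδ : (T : ℝ) * δ = 1 := mul_one_div_cancel hT'.ne'
  have hΦT := hΦ0 T
  have hη' : δ * ∑ s ∈ Finset.range T, violation Q q (z s) ≤ η := by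
    refine le_trans ?_ hη
    rw [le_div_iff₀ hK]
    have h1 := hpen T le_rfl
    have h2 : (T : ℝ) * (δ + err) = 1 + T * err := by rw [mul_add, hTδ]
    simp only [hR] at h1
    rw [h2] at h1
    linarith
  have havg : y T ≤ δ • ∑ s ∈ Finset.range T, z s := fun i => by
    have := (hB T).2.2.2 i
    rwa [Pi.smul_apply, Finset.sum_apply, smul_eq_mul]
  have hcount : δ * ∑ _s ∈ Finset.range T, (1 : ℝ) = 1 := by
    rw [Finset.sum_const, Finset.card_range, nsmul_eq_mul, mul_one, mul_comm, hTδ]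
  refine ⟨?_, ?_, ?_⟩
  · have h1 := mul_le_mul_of_nonneg_right (exp_neg_one_le_one_sub_inv_pow hT) hV0
    have h2 : (T : ℝ) * (δ * κ + err) = κ + T * err := by rw [mul_add, ← mul_assoc, hTδ, one_mul]
    rw [hTδ, one_mul, h2] at hmain
    simp only [hR] at hmain
    linarith
  -- Nonnegative entries allow y_T to be replaced by the larger average of the z's; Jensen's
  -- inequality then leads to the average violation.
  · refine (quadForm_mono (fun i j => (hN.Q_mem i j).1) (hB T).2.1 havg).trans ?_
    refine (quadForm_average_le hN.symQ hN.psd z hT).trans ?_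
    have h1 := mul_le_mul_of_nonneg_left
      (Finset.sum_le_sum fun s (_ : s ∈ Finset.range T) => (hv s).2.1) hδ0.le
    rw [Finset.sum_add_distrib, mul_add, hcount] at h1
    linarith
  · have h0 : q ⬝ᵥ y T ≤ q ⬝ᵥ (δ • ∑ s ∈ Finset.range T, z s) :=
      Finset.sum_le_sum fun i _ => mul_le_mul_of_nonneg_left (havg i) (hN.q_mem i).1
    have h1 := mul_le_mul_of_nonneg_left
      (Finset.sum_le_sum fun s (_ : s ∈ Finset.range T) => (hv s).2.2) hδ0.le
    rw [Finset.sum_add_distrib, mul_add, hcount] at h1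
    rw [dotProduct_smul, dotProduct_sum, smul_eq_mul] at h0
    linarith

end Run

/-! ### Choice of the parameters -/

/-- The penalty factor. -/
def penalty (E : ℕ) : ℕ := 16 * E

/-- The inverse of the step size of the gradient steps. -/
def invStep (n E : ℕ) : ℕ := (n + 1) ^ 4 * penalty E ^ 2 * E

/-- The number of iterations. -/
def numIter (n E : ℕ) : ℕ := (n + 1) ^ 2 * invStep n E * E

/-- The common denominator of the rounded points. -/
def gridDen (n E : ℕ) : ℕ := numIter n E ^ 2

theorem penalty_pos {E : ℕ} (hE : 0 < E) : 0 < penalty E := by unfold penalty; positivity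

theorem invStep_pos (n : ℕ) {E : ℕ} (hE : 0 < E) : 0 < invStep n E := by
  have := penalty_pos hE
  unfold invStep; positivity

theorem numIter_pos (n : ℕ) {E : ℕ} (hE : 0 < E) : 0 < numIter n E := by
  have := invStep_pos n hE
  unfold numIter; positivity

theorem gridDen_pos (n : ℕ) {E : ℕ} (hE : 0 < E) : 0 < gridDen n E := by
  have := numIter_pos n hE
  unfold gridDen; positivity

/-- The parameters form a hierarchy: Γ outweighs the squared gradient bound of order (nK)², T
outweighs Γ, and D = T² makes rounding negligible. Every error becomes a multiple of 1/((n+1)E); the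
factor n + 1 is there because the size of the objective is only known to be at most 4n·OPT. -/
theorem greedy_guarantee {n E : ℕ} (hE : 0 < E) {H Q : Matrix (Fin n) (Fin n) ℝ}
    {b q u : Fin n → ℝ} (hN : IsNormalized H Q b q u) {y z : ℕ → Fin n → ℝ}
    (hy0 : y 0 = 0) (hz0 : z 0 = 0)
    (hS : ∀ t, IsStep H Q b q u (penalty E) (invStep n E) (numIter n E) (gridDen n E)
      (y t) (z t) (y (t + 1)) (z (t + 1)))
    {x : Fin n → ℝ} (hx : ∀ i, 0 ≤ x i ∧ x i ≤ 1) (hx1 : x ⬝ᵥ Q *ᵥ x ≤ 1) (hx2 : q ⬝ᵥ x ≤ 1) :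
    Real.exp (-1) * quadFun H b x - 8 / ((n + 1) * E) ≤ quadFun H b (y (numIter n E)) ∧
      y (numIter n E) ⬝ᵥ Q *ᵥ y (numIter n E) ≤ 1 + 1 / E ∧
      q ⬝ᵥ y (numIter n E) ≤ 1 + 1 / E := by
  have hE' : (1 : ℝ) ≤ E := by exact_mod_cast hE
  have hK : (penalty E : ℝ) = 16 * E := by simp [penalty]
  have hΓ : (invStep n E : ℝ) = (n + 1) ^ 4 * penalty E ^ 2 * E := by simp [invStep]
  have hT : (numIter n E : ℝ) = (n + 1) ^ 2 * invStep n E * E := by simp [numIter]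
  have hD : (gridDen n E : ℝ) = numIter n E ^ 2 := by simp [gridDen]
  have hK0 : (0 : ℝ) < penalty E := by exact_mod_cast penalty_pos hE
  have hΓ0 : (0 : ℝ) < invStep n E := by exact_mod_cast invStep_pos n hE
  have hT0 : (0 : ℝ) < numIter n E := by exact_mod_cast numIter_pos n hE
  have hΓ1 : (1 : ℝ) ≤ invStep n E := by exact_mod_cast invStep_pos n hE
  have hT1 : (1 : ℝ) ≤ numIter n E := by exact_mod_cast numIter_pos n hE
  have hD0 : (0 : ℝ) < gridDen n E := by exact_mod_cast gridDen_pos n hE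
  have hn : (0 : ℝ) ≤ n := by positivity
  obtain ⟨m, hm⟩ : ∃ m : ℝ, m = n + 1 := ⟨_, rfl⟩
  have hnm : (n : ℝ) = m - 1 := by linarith
  have hm1 : 1 ≤ m := by linarith
  set K : ℝ := ((penalty E : ℕ) : ℝ)
  set Γ : ℝ := ((invStep n E : ℕ) : ℝ)
  set T : ℝ := ((numIter n E : ℕ) : ℝ)
  set D : ℝ := ((gridDen n E : ℕ) : ℝ)
  have hmE : 0 < m * E := by positivity
  have hTge : m * m * E ≤ T := by
    rw [hT, ← hm]
    have : m * m * E * 1 ≤ m * m * E * Γ := by gcongr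
    linarith [this]
  have hTge' : m * E ≤ T := by nlinarith
  have k1 : Γ / (2 * T) * n ≤ 1 / (2 * (m * E)) := by
    rw [hT, hnm, sub_add_cancel, div_mul_eq_mul_div, div_le_div_iff₀ (by positivity) (by positivity)]
    have : Γ * (m - 1) * (2 * (m * E)) ≤ Γ * m * (2 * (m * E)) := by gcongr; linarith
    linarith
  have c1 : m / T ≤ 1 / (m * E) := by
    rw [div_le_div_iff₀ hT0 hmE]; linarith
  have c2 : 1 / T ≤ 1 / (m * E) := one_div_le_one_div_of_le hmE hTge'
  have c3 : Γ * n / D ≤ 1 / (m * E) := by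
    rw [hD, div_le_div_iff₀ (by positivity) hmE, one_mul]
    have h1 : Γ * n * (m * E) ≤ T := by
      rw [hT, hnm, sub_add_cancel]
      have : Γ * (m - 1) * (m * E) ≤ Γ * m * (m * E) := by gcongr; linarith
      linarith
    nlinarith
  have c4 : n * ((m * (1 + 2 * K)) ^ 2 / (2 * Γ)) ≤ 9 / (2 * (m * E)) := by
    have h1 : (1 + 2 * K) ^ 2 ≤ (3 * K) ^ 2 := by
      have : 1 ≤ K := by rw [hK]; linarith
      gcongr; linarith
    calc n * ((m * (1 + 2 * K)) ^ 2 / (2 * Γ)) ≤ m * ((m * (3 * K)) ^ 2 / (2 * Γ)) := by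
          rw [mul_pow, mul_pow m]
          gcongr
          linarith
      _ = 9 / (2 * (m * E)) := by
          rw [hΓ, ← hm]; field_simp; norm_num
  have herr : T * (n / T ^ 2 + 1 / D + Γ / (2 * T) * (n *
        ((((n + 1) * (1 + 2 * K)) / Γ) ^ 2 + 2 / D))) ≤ 13 / (2 * (m * E)) := by
    have e : T * (n / T ^ 2 + 1 / D + Γ / (2 * T) * (n *
        ((((n + 1) * (1 + 2 * K)) / Γ) ^ 2 + 2 / D))) =
        n / T + 1 / T + n * ((m * (1 + 2 * K)) ^ 2 / (2 * Γ)) + Γ * n / D := by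
      rw [hD, ← hm]; field_simp; ring
    have e2 : m / T = n / T + 1 / T := by rw [hm]; ring
    have e3 : 9 / (2 * (m * E)) = 9 / 2 * (1 / (m * E)) := by field_simp
    have e4 : 13 / (2 * (m * E)) = 13 / 2 * (1 / (m * E)) := by field_simp
    rw [e, e4]
    rw [e3] at c4
    linarith
  -- The numerator is at most 2 + 1/2 + 13/2 = 9, which the factor 16 in the penalty covers.
  have hη : (2 + 1 / (2 * (m * E)) + 13 / (2 * (m * E))) / K ≤ 1 / E := by
    have h1 : 1 / (2 * (m * E)) ≤ 1 / 2 := one_div_le_one_div_of_le (by norm_num) (by nlinarith)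
    have h2 : 13 / (2 * (m * E)) = 13 * (1 / (2 * (m * E))) := by field_simp
    rw [hK, h2, div_le_div_iff₀ (by positivity) (by positivity), one_mul]
    nlinarith
  have h := iterate_guarantee hN hK0 hΓ0 hD0 (numIter_pos n hE) hy0 hz0 hS hx hx1 hx2
    (κ := 1 / (2 * (m * E))) (e := 13 / (2 * (m * E))) (η := 1 / E)
    (by rw [Fintype.card_fin]; exact k1) (by rw [Fintype.card_fin]; exact herr) hη
  refine ⟨?_, h.2⟩
  have e5 : 8 / ((n + 1) * E) = 8 * (1 / (m * E)) := by rw [hm]; field_simp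
  have e6 : 2 * (1 / (2 * (m * E))) + 13 / (2 * (m * E)) = 15 / 2 * (1 / (m * E)) := by
    field_simp; norm_num
  have h3 := h.1
  rw [e6] at h3
  rw [e5]
  have : 0 < 1 / (m * E) := by positivity
  linarith

end QuadApprox

namespace QuadApprox

/-! ### Binary lengths -/

theorem natSize_mul_le (a b : ℕ) : Nat.size (a * b) ≤ Nat.size a + Nat.size b := by
  rw [Nat.size_le, pow_add]
  exact Nat.mul_lt_mul'' (Nat.lt_size_self a) (Nat.lt_size_self b)

theorem natSize_le_self (a : ℕ) : Nat.size a ≤ a := by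
  rw [Nat.size_le]; exact Nat.lt_two_pow_self

theorem natSize_pos {a : ℕ} (h : 0 < a) : 1 ≤ Nat.size a := Nat.size_pos.2 h

/-- Reduction to lowest terms only divides numerator and denominator, so lengths may be estimated on
any convenient fraction. -/
theorem bitSize_le_of_eq_div {q : ℚ} {p : ℤ} {d : ℕ} (hd : d ≠ 0) (h : q = p / d) :
    bitSize q ≤ Nat.size p.natAbs + Nat.size d := by
  have h' : q = Rat.divInt p d := by rw [h, Rat.divInt_eq_div]; simp
  have hd' : (d : ℤ) ≠ 0 := by exact_mod_cast hd
  have h2 : q.den ∣ d := by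
    have := Rat.den_dvd p d
    rw [← h'] at this
    exact_mod_cast this
  unfold bitSize
  refine Nat.add_le_add ?_ (Nat.size_le_size (Nat.le_of_dvd (Nat.pos_of_ne_zero hd) h2))
  rcases eq_or_ne p 0 with rfl | hp
  · simp [h]
  · have h1 := Rat.num_dvd p hd'
    rw [← h'] at h1
    exact Nat.size_le_size (Nat.le_of_dvd (Int.natAbs_pos.2 hp) (Int.natAbs_dvd_natAbs.2 h1))

theorem one_le_bitSize (q : ℚ) : 1 ≤ bitSize q :=
  (natSize_pos q.den_pos).trans (Nat.le_add_left _ _)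

theorem natSize_add_le_of_pos {a b x y : ℕ} (ha : Nat.size a ≤ x) (hb : Nat.size b ≤ y)
    (hx : 1 ≤ x) (hy : 1 ≤ y) : Nat.size (a + b) ≤ x + y := by
  rw [Nat.size_le] at *
  obtain ⟨x, rfl⟩ := Nat.exists_eq_add_of_le' hx
  obtain ⟨y, rfl⟩ := Nat.exists_eq_add_of_le' hy
  have h1 : 1 ≤ 2 ^ x := Nat.one_le_two_pow
  have h2 : 1 ≤ 2 ^ y := Nat.one_le_two_pow
  have e : 2 ^ (x + 1 + (y + 1)) = 4 * (2 ^ x * 2 ^ y) := by ring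
  rw [e]
  rw [pow_succ] at ha hb
  nlinarith

theorem bitSize_add_le {a b : ℚ} {α β : ℕ} (ha : bitSize a ≤ α) (hb : bitSize b ≤ β) :
    bitSize (a + b) ≤ 2 * (α + β) := by
  have h : a + b = ((a.num * b.den + b.num * a.den : ℤ) : ℚ) / ((a.den * b.den : ℕ) : ℚ) := by
    conv_lhs => rw [← Rat.num_div_den a, ← Rat.num_div_den b]
    have h1 : (a.den : ℚ) ≠ 0 := by exact_mod_cast a.den_nz
    have h2 : (b.den : ℚ) ≠ 0 := by exact_mod_cast b.den_nz
    push_cast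
    field_simp
  have h1 := bitSize_le_of_eq_div (Nat.mul_ne_zero a.den_nz b.den_nz) h
  have h2 : Nat.size (a.num * b.den + b.num * a.den : ℤ).natAbs ≤
      (Nat.size a.num.natAbs + Nat.size b.den) + (Nat.size b.num.natAbs + Nat.size a.den) := by
    refine (Nat.size_le_size (Int.natAbs_add_le _ _)).trans ?_
    rw [Int.natAbs_mul, Int.natAbs_mul, Int.natAbs_natCast, Int.natAbs_natCast]
    exact natSize_add_le_of_pos (natSize_mul_le _ _) (natSize_mul_le _ _)
      ((natSize_pos b.den_pos).trans (Nat.le_add_left _ _))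
      ((natSize_pos a.den_pos).trans (Nat.le_add_left _ _))
  have h3 := natSize_mul_le a.den b.den
  unfold bitSize at ha hb h1 ⊢
  omega

theorem bitSize_neg (a : ℚ) : bitSize (-a) = bitSize a := by
  simp [bitSize]

theorem bitSize_sub_le {a b : ℚ} {α β : ℕ} (ha : bitSize a ≤ α) (hb : bitSize b ≤ β) :
    bitSize (a - b) ≤ 2 * (α + β) := by
  rw [sub_eq_add_neg]
  exact bitSize_add_le ha ((bitSize_neg b).trans_le hb)

theorem bitSize_mul_le {a b : ℚ} {α β : ℕ} (ha : bitSize a ≤ α) (hb : bitSize b ≤ β) :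
    bitSize (a * b) ≤ α + β := by
  have h : a * b = ((a.num * b.num : ℤ) : ℚ) / ((a.den * b.den : ℕ) : ℚ) := by
    conv_lhs => rw [← Rat.num_div_den a, ← Rat.num_div_den b]
    push_cast
    rw [div_mul_div_comm]
  have h1 := bitSize_le_of_eq_div (Nat.mul_ne_zero a.den_nz b.den_nz) h
  have h2 := natSize_mul_le a.num.natAbs b.num.natAbs
  have h3 := natSize_mul_le a.den b.den
  rw [Int.natAbs_mul] at h1
  unfold bitSize at ha hb h1 ⊢
  omega

theorem bitSize_zero : bitSize 0 = 1 := by decide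

theorem bitSize_one : bitSize 1 = 2 := by decide

theorem bitSize_inv_le (a : ℚ) : bitSize a⁻¹ ≤ bitSize a := by
  rcases eq_or_ne a 0 with rfl | h
  · simp
  · unfold bitSize
    rw [Rat.num_inv, Rat.den_inv_of_ne_zero h, Int.natAbs_mul, Int.natAbs_natCast,
      Int.natAbs_sign_of_ne_zero (Rat.num_ne_zero.2 h), one_mul, add_comm]

theorem bitSize_div_le {a b : ℚ} {α β : ℕ} (ha : bitSize a ≤ α) (hb : bitSize b ≤ β) :
    bitSize (a / b) ≤ α + β := by
  rw [div_eq_mul_inv]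
  exact bitSize_mul_le ha ((bitSize_inv_le b).trans hb)

theorem bitSize_intCast (z : ℤ) : bitSize z = Nat.size z.natAbs + 1 := by
  simp [bitSize]

theorem bitSize_natCast_le (k : ℕ) : bitSize k ≤ k + 1 := by
  have := bitSize_intCast k
  have h2 := natSize_le_self k
  simp only [Int.cast_natCast, Int.natAbs_natCast] at this
  omega

theorem bitSize_floor_le (a : ℚ) : bitSize (⌊a⌋ : ℚ) ≤ bitSize a := by
  rw [bitSize_intCast]
  unfold bitSize
  refine Nat.add_le_add (Nat.size_le_size ?_) (natSize_pos a.den_pos)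
  have hd : (1 : ℤ) ≤ a.den := by exact_mod_cast a.den_pos
  have h : ⌊a⌋ = a.num / (a.den : ℤ) := Rat.floor_def a
  rw [h]
  exact Int.natAbs_ediv_le_natAbs _ _

/-- Iterating `bitSize_add_le` would double the length with every summand. Over the product of the
denominators a sum of k terms has denominator at most 2^(kβ) and numerator at most k·2^(kβ), so the
growth is linear. The bound is uniform in k ≤ n because the accumulator of a loop holds all partial
sums. -/
theorem bitSize_sum_le {v : ℕ → ℚ} {β n : ℕ} (hv : ∀ j < n, bitSize (v j) ≤ β) {k : ℕ}
    (hk : k ≤ n) : bitSize (∑ j ∈ Finset.range k, v j) ≤ n * (2 * β + 1) + 2 := by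
  have h : ∀ k ≤ n, ∃ (p : ℤ) (d : ℕ), d ≠ 0 ∧ ∑ j ∈ Finset.range k, v j = p / d ∧
      d ≤ 2 ^ (k * β) ∧ p.natAbs ≤ k * 2 ^ (k * β) := by
    intro k
    induction k with
    | zero => exact fun _ => ⟨0, 1, one_ne_zero, by simp, by simp, by simp⟩
    | succ k ih =>
      intro hk
      obtain ⟨p, d, hd, he, h1, h2⟩ := ih (by omega)
      have hvk := hv k (by omega)
      have g1 : (v k).den ≤ 2 ^ β :=
        (Nat.size_le.1 ((Nat.le_add_left _ _).trans hvk)).le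
      have g2 : (v k).num.natAbs ≤ 2 ^ β :=
        (Nat.size_le.1 ((Nat.le_add_right _ _).trans hvk)).le
      have epow : 2 ^ ((k + 1) * β) = 2 ^ (k * β) * 2 ^ β := by ring
      refine ⟨p * (v k).den + (v k).num * d, d * (v k).den,
        Nat.mul_ne_zero hd (v k).den_nz, ?_, ?_, ?_⟩
      · rw [Finset.sum_range_succ, he]
        conv_lhs => rw [← Rat.num_div_den (v k)]
        have h1 : ((v k).den : ℚ) ≠ 0 := by exact_mod_cast (v k).den_nz
        have h2 : (d : ℚ) ≠ 0 := by exact_mod_cast hd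
        push_cast
        field_simp
      · rw [epow]; exact Nat.mul_le_mul h1 g1
      · refine (Int.natAbs_add_le _ _).trans ?_
        rw [Int.natAbs_mul, Int.natAbs_mul, Int.natAbs_natCast, Int.natAbs_natCast, epow]
        have a1 := Nat.mul_le_mul h2 g1
        have a2 := Nat.mul_le_mul g2 h1
        calc _ ≤ k * 2 ^ (k * β) * 2 ^ β + 2 ^ β * 2 ^ (k * β) := Nat.add_le_add a1 a2
          _ = _ := by ring
  obtain ⟨p, d, hd, he, h1, h2⟩ := h k hk
  have a1 := bitSize_le_of_eq_div hd he
  have hkβ : k * β ≤ n * β := Nat.mul_le_mul_right _ hk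
  have a2 : Nat.size d ≤ n * β + 1 := by
    rw [Nat.size_le, pow_succ]
    have := Nat.pow_le_pow_right (n := 2) (by norm_num) hkβ
    have : 0 < 2 ^ (n * β) := by positivity
    omega
  have a3 : Nat.size p.natAbs ≤ n + n * β + 1 := by
    rw [Nat.size_le, pow_succ, pow_add]
    have b1 := Nat.pow_le_pow_right (n := 2) (by norm_num) hkβ
    have b2 : k < 2 ^ n := hk.trans_lt Nat.lt_two_pow_self
    have b3 := Nat.mul_le_mul b2.le b1
    have : 0 < 2 ^ n * 2 ^ (n * β) := by positivity
    omega
  refine a1.trans ?_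
  have : n * (2 * β + 1) = 2 * (n * β) + n := by ring
  omega

/-! ### Counting steps in bounded memory -/

/-- Every cell holds a number of length at most `B`. -/
def Store.Small (B : ℕ) (s : Store) : Prop := ∀ r i j, bitSize (s r i j) ≤ B

theorem Store.Small.write {B : ℕ} {s : Store} (h : s.Small B) (r i j : ℕ) {q : ℚ}
    (hq : bitSize q ≤ B) : (s.write r i j q).Small B := fun r' i' j' => by
  unfold Store.write
  split
  · exact hq
  · exact h _ _ _

/-- The factor between the cost of an expression and the length of the numbers in memory. -/
def Expr.factor : Expr → ℕ
  | .const q => bitSize q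
  | .get _ i j => i.factor + j.factor + 1
  | .add e₁ e₂ | .sub e₁ e₂ | .mul e₁ e₂ | .div e₁ e₂ => 3 * (e₁.factor + e₂.factor)
  | .floor e => 2 * e.factor

theorem Expr.bitSize_eval_le_cost (s : Store) (e : Expr) : bitSize (e.eval s) ≤ e.cost s := by
  cases e <;> simp only [Expr.cost, Expr.eval] <;> omega

/-- Each operation lengthens numbers by a constant factor at most, and the expression is part of the
fixed program text; hence the cost is linear in the length of the stored numbers. -/
theorem Expr.cost_le {B : ℕ} {s : Store} (h : s.Small B) (e : Expr) :
    e.cost s ≤ e.factor * (B + 1) := by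
  induction e with
  | const q => exact Nat.le_mul_of_pos_right _ (Nat.succ_pos B)
  | get r i j hi hj =>
    have h1 := h r ⌊i.eval s⌋₊ ⌊j.eval s⌋₊
    simp only [Expr.cost, Expr.eval, Expr.factor, add_mul]
    omega
  | add a b ha hb =>
    have h1 := bitSize_add_le (a.bitSize_eval_le_cost s) (b.bitSize_eval_le_cost s)
    simp only [Expr.cost, Expr.eval, Expr.factor]
    nlinarith
  | sub a b ha hb =>
    have h1 := bitSize_sub_le (a.bitSize_eval_le_cost s) (b.bitSize_eval_le_cost s)
    simp only [Expr.cost, Expr.eval, Expr.factor]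
    nlinarith
  | mul a b ha hb =>
    have h1 := bitSize_mul_le (a.bitSize_eval_le_cost s) (b.bitSize_eval_le_cost s)
    simp only [Expr.cost, Expr.eval, Expr.factor]
    nlinarith
  | div a b ha hb =>
    have h1 := bitSize_div_le (a.bitSize_eval_le_cost s) (b.bitSize_eval_le_cost s)
    simp only [Expr.cost, Expr.eval, Expr.factor]
    nlinarith
  | floor a ha =>
    have h1 := (bitSize_floor_le (a.eval s)).trans (a.bitSize_eval_le_cost s)
    simp only [Expr.cost, Expr.eval, Expr.factor]
    nlinarith

/-- `Run B p s s' m`: the program `p` leads from `s` to `s'` in `m` elementary steps, and writes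
only numbers of length at most `B`. -/
inductive Run (B : ℕ) : Prog → Store → Store → ℕ → Prop where
  | skip (s : Store) : Run B .skip s s 1
  | assign (s : Store) (r : ℕ) (i j e : Expr) (h : bitSize (e.eval s) ≤ B) :
      Run B (.assign r i j e) s (s.write r ⌊i.eval s⌋₊ ⌊j.eval s⌋₊ (e.eval s)) 1
  | seq {p₁ p₂ : Prog} {s s' s'' : Store} {m₁ m₂ : ℕ} :
      Run B p₁ s s' m₁ → Run B p₂ s' s'' m₂ → Run B (.seq p₁ p₂) s s'' (m₁ + m₂)
  | ite_true {e₁ e₂ : Expr} {p₁ p₂ : Prog} {s s' : Store} {m : ℕ} :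
      e₁.eval s < e₂.eval s → Run B p₁ s s' m → Run B (.ite e₁ e₂ p₁ p₂) s s' (m + 1)
  | ite_false {e₁ e₂ : Expr} {p₁ p₂ : Prog} {s s' : Store} {m : ℕ} :
      ¬ e₁.eval s < e₂.eval s → Run B p₂ s s' m → Run B (.ite e₁ e₂ p₁ p₂) s s' (m + 1)
  | loop_true {e₁ e₂ : Expr} {p : Prog} {s s' s'' : Store} {m₁ m₂ : ℕ} :
      e₁.eval s < e₂.eval s → Run B p s s' m₁ → Run B (.loop e₁ e₂ p) s' s'' m₂ →
      Run B (.loop e₁ e₂ p) s s'' (m₁ + m₂ + 1)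
  | loop_false {e₁ e₂ : Expr} {p : Prog} {s : Store} :
      ¬ e₁.eval s < e₂.eval s → Run B (.loop e₁ e₂ p) s s 1

/-- The factor between the time of a program and the product of the number of steps with the
length of the numbers in memory. -/
def Prog.factor : Prog → ℕ
  | .skip => 1
  | .assign _ i j e => i.factor + j.factor + e.factor + 1
  | .seq p₁ p₂ => p₁.factor + p₂.factor
  | .ite e₁ e₂ p₁ p₂ => e₁.factor + e₂.factor + 1 + p₁.factor + p₂.factor
  | .loop e₁ e₂ p => e₁.factor + e₂.factor + 1 + p.factor

/-- The arrays that a program may write to. -/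
def Prog.mods : Prog → List ℕ
  | .skip => []
  | .assign r _ _ _ => [r]
  | .seq p₁ p₂ => p₁.mods ++ p₂.mods
  | .ite _ _ p₁ p₂ => p₁.mods ++ p₂.mods
  | .loop _ _ p => p.mods

/-- Separates the time analysis into a count of steps and a bound on lengths. A step evaluates
finitely many expressions of the program text, and since all written numbers have length at most B,
the bound on the memory persists to the next step. -/
theorem Run.exec {B : ℕ} {p : Prog} {s s' : Store} {m : ℕ} (h : Run B p s s' m)
    (hs : s.Small B) : ∃ t, Exec p s s' t ∧ t ≤ p.factor * (B + 1) * m ∧ s'.Small B := by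
  induction h with
  | skip s => exact ⟨1, .skip s, by simp [Prog.factor], hs⟩
  | assign s r i j e h =>
    refine ⟨_, .assign s r i j e, ?_, hs.write _ _ _ h⟩
    have h1 := i.cost_le hs
    have h2 := j.cost_le hs
    have h3 := e.cost_le hs
    simp only [Prog.factor]
    nlinarith
  | seq _ _ ih₁ ih₂ =>
    obtain ⟨t₁, e₁, h₁, hs₁⟩ := ih₁ hs
    obtain ⟨t₂, e₂, h₂, hs₂⟩ := ih₂ hs₁
    refine ⟨_, .seq e₁ e₂, (Nat.add_le_add h₁ h₂).trans ?_, hs₂⟩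
    simp only [Prog.factor, add_mul, mul_add]
    omega
  | @ite_true e₁ e₂ p₁ p₂ s s' m hc _ ih =>
    obtain ⟨t, e, h, hs'⟩ := ih hs
    refine ⟨_, .ite_true hc e, ?_, hs'⟩
    have h1 := e₁.cost_le hs
    have h2 := e₂.cost_le hs
    simp only [Prog.factor, add_mul, mul_add] at *
    omega
  | @ite_false e₁ e₂ p₁ p₂ s s' m hc _ ih =>
    obtain ⟨t, e, h, hs'⟩ := ih hs
    refine ⟨_, .ite_false hc e, ?_, hs'⟩
    have h1 := e₁.cost_le hs
    have h2 := e₂.cost_le hs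
    simp only [Prog.factor, add_mul, mul_add] at *
    omega
  | @loop_true e₁ e₂ p s s' s'' m₁ m₂ hc _ _ ih₁ ih₂ =>
    obtain ⟨t₁, g₁, h₁, hs₁⟩ := ih₁ hs
    obtain ⟨t₂, g₂, h₂, hs₂⟩ := ih₂ hs₁
    refine ⟨_, .loop_true hc g₁ g₂, ?_, hs₂⟩
    have h1 := e₁.cost_le hs
    have h2 := e₂.cost_le hs
    simp only [Prog.factor, add_mul, mul_add] at *
    omega
  | @loop_false e₁ e₂ p s hc =>
    refine ⟨_, .loop_false hc, ?_, hs⟩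
    have h1 := e₁.cost_le hs
    have h2 := e₂.cost_le hs
    simp only [Prog.factor, add_mul, mul_add] at *
    omega

theorem Run.frame {B : ℕ} {p : Prog} {s s' : Store} {m : ℕ} (h : Run B p s s' m) :
    ∀ r, r ∉ p.mods → s' r = s r := by
  induction h with
  | skip s => exact fun _ _ => rfl
  | assign s r i j e h =>
    intro r' hr'
    funext i' j'
    simp only [Prog.mods, List.mem_singleton] at hr'
    simp [Store.write, hr']
  | seq _ _ ih₁ ih₂ =>
    intro r hr
    simp only [Prog.mods, List.mem_append, not_or] at hr
    rw [ih₂ r hr.2, ih₁ r hr.1]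
  | ite_true _ _ ih =>
    intro r hr
    simp only [Prog.mods, List.mem_append, not_or] at hr
    exact ih r hr.1
  | ite_false _ _ ih =>
    intro r hr
    simp only [Prog.mods, List.mem_append, not_or] at hr
    exact ih r hr.2
  | loop_true _ _ _ ih₁ ih₂ =>
    intro r hr
    rw [ih₂ r hr, ih₁ r hr]
  | loop_false _ => exact fun _ _ => rfl

/-! ### Loops -/

/-- A scalar variable. -/
abbrev Expr.var (r : ℕ) : Expr := .get r (.const 0) (.const 0)

theorem Expr.eval_var (s : Store) (r : ℕ) : (Expr.var r).eval s = s r 0 0 := by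
  simp [Expr.eval]

/-- Assignment to a scalar variable. -/
abbrev Prog.set (r : ℕ) (e : Expr) : Prog := .assign r (.const 0) (.const 0) e

theorem Run.set {B : ℕ} (s : Store) (r : ℕ) (e : Expr) {q : ℚ} (he : e.eval s = q)
    (hq : bitSize q ≤ B) : Run B (.set r e) s (s.write r 0 0 q) 1 := by
  have := Run.assign (B := B) s r (.const 0) (.const 0) e (by rwa [he])
  simpa [Expr.eval, he] using this

/-- The loop with counter `c` from zero to the value of `bound`. -/
def Prog.forLoop (c : ℕ) (bound : Expr) (body : Prog) : Prog :=
  .seq (.set c (.const 0))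
    (.loop (.var c) bound (.seq body (.set c (.add (.var c) (.const 1)))))

/-- The invariant speaks of the store after the counter has been written. The bound of the loop is
evaluated anew at each test, so the invariant must determine its value; N + 1 ≤ B leaves room for
the counter itself. -/
theorem Run.forLoop {B c N mb : ℕ} {bound : Expr} {body : Prog} {Inv : ℕ → Store → Prop}
    (hN : N + 1 ≤ B) (hc : c ∉ body.mods) (s : Store) (h0 : Inv 0 (s.write c 0 0 0))
    (hb : ∀ k s, Inv k s → bound.eval s = N)
    (step : ∀ k < N, ∀ s, Inv k s → s c 0 0 = k → ∃ s' m, Run B body s s' m ∧ m ≤ mb ∧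
      Inv (k + 1) (s'.write c 0 0 ((k + 1 : ℕ) : ℚ))) :
    ∃ s' m, Run B (Prog.forLoop c bound body) s s' m ∧ m ≤ N * (mb + 2) + 2 ∧ Inv N s' := by
  have hsz : ∀ k : ℕ, k ≤ N → bitSize (k : ℚ) ≤ B := fun k hk =>
    (bitSize_natCast_le k).trans (by omega)
  have main : ∀ d k : ℕ, k + d = N → ∀ s, Inv k s → s c 0 0 = k →
      ∃ s' m, Run B (.loop (.var c) bound (.seq body (.set c (.add (.var c) (.const 1))))) s s' m ∧
        m ≤ d * (mb + 2) + 1 ∧ Inv N s' := by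
    intro d
    induction d with
    | zero =>
      intro k hk s hI hs
      obtain rfl : k = N := by omega
      exact ⟨s, 1, .loop_false (by rw [Expr.eval_var, hs, hb k s hI]; exact lt_irrefl _), by simp,
        hI⟩
    | succ d ih =>
      intro k hk s hI hs
      obtain ⟨s₁, m₁, r₁, hm₁, hI₁⟩ := step k (by omega) s hI hs
      have hs₁ : s₁ c 0 0 = k := by rw [r₁.frame c hc, hs]
      obtain ⟨s₂, m₂, r₂, hm₂, hI₂⟩ := ih (k + 1) (by omega) _ hI₁ (by simp [Store.write])
      have r := Run.set (B := B) s₁ c (.add (.var c) (.const 1)) (q := ((k + 1 : ℕ) : ℚ))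
        (by simp [Expr.eval, hs₁]) (hsz _ (by omega))
      refine ⟨s₂, _, .loop_true ?_ (.seq r₁ r) r₂, ?_, hI₂⟩
      · rw [Expr.eval_var, hs, hb k s hI]; exact_mod_cast (by omega : k < N)
      · rw [add_mul]; omega
  obtain ⟨s', m, r, hm, hI⟩ := main N 0 (by omega) _ h0 (by simp [Store.write])
  have r0 := Run.set (B := B) s c (.const 0) (q := 0) rfl (by rw [bitSize_zero]; omega)
  exact ⟨s', _, .seq r0 r, by omega, hI⟩

/-- A loop whose body at `i` computes the entries with index `i` of the arrays in `R`. -/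
theorem Run.mapLoop {B c n mb : ℕ} {bound : Expr} {body : Prog} {R : List ℕ}
    (hn : n + 1 ≤ B) (hc : c ∉ body.mods) (hcR : c ∉ R) (s₀ : Store)
    (hb : ∀ s : Store, (∀ r, r ∉ c :: body.mods → s r = s₀ r) → bound.eval s = n)
    (new : ℕ → ℕ → ℚ)
    (step : ∀ i < n, ∀ s : Store, (∀ r, r ∉ c :: body.mods → s r = s₀ r) → s c 0 0 = i →
      (∀ r ∈ R, s r i 0 = s₀ r i 0) → ∃ s' m, Run B body s s' m ∧ m ≤ mb ∧
        ∀ r ∈ R, ∀ i', s' r i' 0 = if i' = i then new r i else s r i' 0) :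
    ∃ s' m, Run B (Prog.forLoop c bound body) s₀ s' m ∧ m ≤ n * (mb + 2) + 2 ∧
      (∀ r, r ∉ c :: body.mods → s' r = s₀ r) ∧ ∀ r ∈ R, ∀ i < n, s' r i 0 = new r i := by
  have hw : ∀ (s : Store) (q : ℚ) (r : ℕ), r ≠ c → s.write c 0 0 q r = s r := fun s q r hr => by
    funext i j; simp [Store.write, hr]
  have hR : ∀ r ∈ R, r ≠ c := fun r hr h => hcR (h ▸ hr)
  obtain ⟨s', m, r, hm, hI⟩ := Run.forLoop (B := B) (c := c) (N := n) (mb := mb) (bound := bound)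
    (body := body)
    -- Entries from k on are still the initial ones, so the body may read the old entry at its own
    -- index of an array that is updated in place.
    (Inv := fun k s => (∀ r, r ∉ c :: body.mods → s r = s₀ r) ∧
      ∀ r ∈ R, ∀ i, s r i 0 = if i < k then new r i else s₀ r i 0) hn hc s₀
    ⟨fun r hr => hw _ _ _ (List.ne_of_not_mem_cons hr), fun r hr i => by
      rw [hw _ _ _ (hR r hr)]; simp⟩
    (fun k s hI => hb s hI.1)
    (fun k hk s hI hs => by
      obtain ⟨s', m, r, hm, h⟩ := step k hk s hI.1 hs (fun r hr => by simp [hI.2 r hr])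
      refine ⟨s', m, r, hm, fun r' hr' => ?_, fun r' hr' i => ?_⟩
      · rw [hw _ _ _ (List.ne_of_not_mem_cons hr'), r.frame r' (List.not_mem_of_not_mem_cons hr'),
          hI.1 r' hr']
      · rw [hw _ _ _ (hR r' hr'), h r' hr', hI.2 r' hr']
        rcases lt_trichotomy i k with h | h | h
        · simp [h, h.ne, h.trans (Nat.lt_succ_self k)]
        · simp [h]
        · have h1 : ¬ i < k := by omega
          have h2 : ¬ i < k + 1 := by omega
          simp [h1, h2, h.ne'])
  refine ⟨s', m, r, hm, hI.1, fun r hr i hi => ?_⟩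
  rw [hI.2 r hr, if_pos hi]

/-- Summation of the values of `e` over the counter `c` into the variable `acc`. -/
def Prog.sumLoop (acc c : ℕ) (bound e : Expr) : Prog :=
  .seq (.set acc (.const 0)) (.forLoop c bound (.set acc (.add (.var acc) e)))

theorem Run.sumLoop {B acc c n β : ℕ} {bound e : Expr} (hac : acc ≠ c) (hn : n + 1 ≤ B)
    (s₀ : Store) (v : ℕ → ℚ) (hv : ∀ j < n, bitSize (v j) ≤ β)
    (hβ : n * (2 * β + 1) + 2 ≤ B)
    (hb : ∀ s : Store, (∀ r, r ≠ acc → r ≠ c → s r = s₀ r) → bound.eval s = n)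
    (he : ∀ j < n, ∀ s : Store, (∀ r, r ≠ acc → r ≠ c → s r = s₀ r) → s c 0 0 = j →
      e.eval s = v j) :
    ∃ s' m, Run B (Prog.sumLoop acc c bound e) s₀ s' m ∧ m ≤ 3 * n + 3 ∧
      (∀ r, r ≠ acc → r ≠ c → s' r = s₀ r) ∧ s' acc 0 0 = ∑ j ∈ Finset.range n, v j := by
  have r0 := Run.set (B := B) s₀ acc (.const 0) (q := 0) rfl (by rw [bitSize_zero]; omega)
  have hw : ∀ (s : Store) (q : ℚ) (c r : ℕ), r ≠ c → s.write c 0 0 q r = s r :=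
    fun s q c r hr => by funext i j; simp [Store.write, hr]
  obtain ⟨s', m, r, hm, hI⟩ := Run.forLoop (B := B) (c := c) (N := n) (mb := 1) (bound := bound)
    (body := .set acc (.add (.var acc) e))
    (Inv := fun k s => (∀ r, r ≠ acc → r ≠ c → s r = s₀ r) ∧
      s acc 0 0 = ∑ j ∈ Finset.range k, v j) hn (by simp [Prog.mods, hac.symm])
    (s₀.write acc 0 0 0)
    ⟨fun r h1 h2 => by rw [hw _ _ _ _ h2, hw _ _ _ _ h1], by
      rw [hw _ _ _ _ hac]; simp [Store.write]⟩
    (fun k s hI => hb s hI.1)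
    (fun k hk s hI hs => by
      have hval : (Expr.add (.var acc) e).eval s = ∑ j ∈ Finset.range (k + 1), v j := by
        rw [Expr.eval, Expr.eval_var, hI.2, he k hk s hI.1 hs, Finset.sum_range_succ]
      refine ⟨_, 1, Run.set s acc _ hval ((bitSize_sum_le hv (by omega)).trans hβ), le_rfl,
        fun r h1 h2 => ?_, ?_⟩
      · rw [hw _ _ _ _ h2, hw _ _ _ _ h1, hI.1 r h1 h2]
      · rw [hw _ _ _ _ hac]; simp [Store.write])
  exact ⟨s', _, .seq r0 r, by omega, hI⟩

theorem Prog.mods_sumLoop (acc c : ℕ) (bound e : Expr) :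
    (Prog.sumLoop acc c bound e).mods = [acc, c, acc, c] := rfl

end QuadApprox

namespace QuadApprox

/-! ### The algorithm on rational data -/

/-- The input of the algorithm as functions on natural numbers; `E` is the accuracy. -/
structure Data where
  n : ℕ
  E : ℕ
  C : ℚ
  a : ℕ → ℚ
  A : ℕ → ℕ → ℚ
  Q : ℕ → ℕ → ℚ

namespace Data

variable (d : Data)

/-- The largest value of a coordinate that the diagonal of `Q` permits. -/
def u (i : ℕ) : ℚ := if d.C < d.Q i i then d.C / d.Q i i else 1

/-- The size of the objective. -/
def M : ℚ := ∑ i ∈ Finset.range d.n, d.u i * d.a i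

/-- The scaled quadratic constraint. -/
def scaledQ (i j : ℕ) : ℚ := d.u i * d.u j * d.Q i j / d.C

/-- The scaled linear constraint. -/
def scaledDiag (i : ℕ) : ℚ := d.u i * d.Q i i / d.C

/-- The scaled Hessian of the objective. -/
def scaledH (i j : ℕ) : ℚ := d.u i * d.u j * (d.A i j + d.A j i) / d.M

/-- The scaled linear part of the objective. -/
def scaledLin (i : ℕ) : ℚ := d.u i * d.a i / d.M

/-- The product of the scaled constraint matrix with a vector. -/
def mulQ (z : ℕ → ℚ) (i : ℕ) : ℚ := ∑ j ∈ Finset.range d.n, d.scaledQ i j * z j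

/-- The value of the quadratic constraint. -/
def formQ (z : ℕ → ℚ) : ℚ := ∑ i ∈ Finset.range d.n, z i * d.mulQ z i

/-- The value of the linear constraint. -/
def formDiag (z : ℕ → ℚ) : ℚ := ∑ i ∈ Finset.range d.n, d.scaledDiag i * z i

/-- The product of the scaled Hessian with a vector. -/
def mulH (y : ℕ → ℚ) (i : ℕ) : ℚ := ∑ j ∈ Finset.range d.n, d.scaledH i j * y j

/-- The indicator of `1 < c`. -/
def indicator (c : ℚ) : ℚ := if 1 < c then 1 else 0

/-- Truncation to the unit interval. -/
def clamp (r : ℚ) : ℚ := if 1 < (if r < 0 then 0 else r) then 1 else (if r < 0 then 0 else r)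

/-- The gradient step before truncation and rounding. -/
def rawStep (y z : ℕ → ℚ) (i : ℕ) : ℚ :=
  z i + ((1 - d.u i * y i) * (d.scaledLin i + d.mulH y i) -
    (penalty d.E : ℚ) * (indicator (d.formQ z) * (2 * d.mulQ z i) +
      indicator (d.formDiag z) * d.scaledDiag i)) / (invStep d.n d.E : ℚ)

/-- Rounding down to the grid. -/
def round (x : ℚ) : ℚ := (⌊(gridDen d.n d.E : ℚ) * x⌋ : ℚ) / (gridDen d.n d.E : ℚ)

/-- The measured greedy step. -/
def nextY (y z : ℕ → ℚ) (i : ℕ) : ℚ :=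
  d.round (y i + (1 - d.u i * y i) * z i / (numIter d.n d.E : ℚ))

/-- The projected gradient step. -/
def nextZ (y z : ℕ → ℚ) (i : ℕ) : ℚ := d.round (clamp (d.rawStep y z i))

/-- The two sequences of points. -/
def iter : ℕ → (ℕ → ℚ) × (ℕ → ℚ)
  | 0 => (0, 0)
  | t + 1 => (d.nextY (iter t).1 (iter t).2, d.nextZ (iter t).1 (iter t).2)

/-- The factor by which a point has to be shrunk. -/
def shrink (y : ℕ → ℚ) : ℚ :=
  if (if 1 < d.formQ y then d.formQ y else 1) < d.formDiag y then d.formDiag y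
  else (if 1 < d.formQ y then d.formQ y else 1)

/-- The output. -/
def result (i : ℕ) : ℚ :=
  d.u i * (d.iter (numIter d.n d.E)).1 i / d.shrink (d.iter (numIter d.n d.E)).1

/-- All numbers of the input, the grid points and the parameters have length at most `X`. -/
structure Bounded (X : ℕ) : Prop where
  C_le : bitSize d.C ≤ X
  a_le : ∀ i, bitSize (d.a i) ≤ X
  A_le : ∀ i j, bitSize (d.A i j) ≤ X
  Q_le : ∀ i j, bitSize (d.Q i j) ≤ X
  -- The grid denominator itself is bounded, not its length. It is polynomial in n and E anyway, and
  -- the same bound then covers all parameters and loop counters.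
  D_le : 2 * gridDen d.n d.E + 1 ≤ X
  E_pos : 0 < d.E

/-- A bound for the length of all numbers that occur. -/
def sizeBound (X : ℕ) : ℕ := 1000 * ((d.n + 1) ^ 2 * X)

variable {d} {X : ℕ}

theorem param_le (hE : 0 < d.E) : d.n + 1 ≤ numIter d.n d.E ∧ d.E ≤ numIter d.n d.E ∧
    penalty d.E ≤ invStep d.n d.E ∧ invStep d.n d.E ≤ numIter d.n d.E ∧
    numIter d.n d.E ≤ gridDen d.n d.E := by
  have h1 := penalty_pos hE
  have h2 := invStep_pos d.n hE
  have h3 := numIter_pos d.n hE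
  have h4 : penalty d.E ≤ invStep d.n d.E := by
    have : invStep d.n d.E = penalty d.E * ((d.n + 1) ^ 4 * penalty d.E * d.E) := by
      unfold invStep; ring
    rw [this]
    exact Nat.le_mul_of_pos_right _ (by positivity)
  have h5 : invStep d.n d.E ≤ numIter d.n d.E := by
    have : numIter d.n d.E = invStep d.n d.E * ((d.n + 1) ^ 2 * d.E) := by
      unfold numIter; ring
    rw [this]
    exact Nat.le_mul_of_pos_right _ (by positivity)
  refine ⟨?_, ?_, h4, h5, ?_⟩
  · have : numIter d.n d.E = (d.n + 1) * ((d.n + 1) * invStep d.n d.E * d.E) := by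
      unfold numIter; ring
    rw [this]
    exact Nat.le_mul_of_pos_right _ (by positivity)
  · have : penalty d.E = 16 * d.E := rfl
    omega
  · unfold gridDen
    rw [sq]
    exact Nat.le_mul_of_pos_right _ h3

theorem Bounded.param (hd : d.Bounded X) : d.n + 2 ≤ X ∧ numIter d.n d.E + 1 ≤ X ∧
    bitSize (d.n : ℚ) ≤ X ∧ bitSize (d.E : ℚ) ≤ X ∧ bitSize (penalty d.E : ℚ) ≤ X ∧
    bitSize (invStep d.n d.E : ℚ) ≤ X ∧ bitSize (numIter d.n d.E : ℚ) ≤ X ∧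
    bitSize (gridDen d.n d.E : ℚ) ≤ X := by
  have h := param_le hd.E_pos
  have h1 := hd.D_le
  have h2 := gridDen_pos d.n hd.E_pos
  refine ⟨by omega, by omega, ?_, ?_, ?_, ?_, ?_, ?_⟩ <;>
    refine (bitSize_natCast_le _).trans ?_ <;> omega

theorem Bounded.one (hd : d.Bounded X) : bitSize 1 ≤ X := by
  rw [bitSize_one]; have := hd.param.1; omega

theorem Bounded.size_u (hd : d.Bounded X) (i : ℕ) : bitSize (d.u i) ≤ 2 * X := by
  unfold u
  split
  · rw [two_mul]; exact bitSize_div_le hd.C_le (hd.Q_le _ _)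
  · have := hd.one; omega

theorem Bounded.size_M_term (hd : d.Bounded X) (i : ℕ) : bitSize (d.u i * d.a i) ≤ 3 * X :=
  (bitSize_mul_le (hd.size_u i) (hd.a_le i)).trans (by omega)

theorem Bounded.pos (hd : d.Bounded X) : 1 ≤ X := by
  have := hd.param.1; omega

theorem Bounded.sum_M_le (hd : d.Bounded X) :
    d.n * (2 * (3 * X) + 1) + 2 ≤ 9 * ((d.n + 1) * X) := by
  have := hd.pos
  nlinarith

theorem Bounded.size_M (hd : d.Bounded X) : bitSize d.M ≤ 9 * ((d.n + 1) * X) :=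
  (bitSize_sum_le (fun i _ => hd.size_M_term i) le_rfl).trans hd.sum_M_le

theorem Bounded.size_scaledDiag (hd : d.Bounded X) (i : ℕ) : bitSize (d.scaledDiag i) ≤ 4 * X :=
  (bitSize_div_le (bitSize_mul_le (hd.size_u i) (hd.Q_le i i)) hd.C_le).trans (by omega)

theorem Bounded.size_scaledQ (hd : d.Bounded X) (i j : ℕ) : bitSize (d.scaledQ i j) ≤ 6 * X :=
  (bitSize_div_le (bitSize_mul_le (bitSize_mul_le (hd.size_u i) (hd.size_u j)) (hd.Q_le i j))
    hd.C_le).trans (by omega)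

theorem Bounded.size_scaledH (hd : d.Bounded X) (i j : ℕ) :
    bitSize (d.scaledH i j) ≤ 8 * X + 9 * ((d.n + 1) * X) :=
  (bitSize_div_le (bitSize_mul_le (bitSize_mul_le (hd.size_u i) (hd.size_u j))
    (bitSize_add_le (hd.A_le i j) (hd.A_le j i))) hd.size_M).trans (by omega)

theorem Bounded.size_scaledLin (hd : d.Bounded X) (i : ℕ) :
    bitSize (d.scaledLin i) ≤ 3 * X + 9 * ((d.n + 1) * X) :=
  bitSize_div_le (hd.size_M_term i) hd.size_M

theorem Bounded.mul_le (hd : d.Bounded X) : X ≤ (d.n + 1) * X ∧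
    (d.n + 1) * X ≤ (d.n + 1) ^ 2 * X ∧ d.n + 1 ≤ (d.n + 1) * X := by
  have := hd.pos
  refine ⟨Nat.le_mul_of_pos_left _ (by omega), ?_, Nat.le_mul_of_pos_right _ this⟩
  rw [sq, mul_assoc]
  exact Nat.le_mul_of_pos_left _ (by omega)

section Vectors

variable {z : ℕ → ℚ}

theorem Bounded.size_mulQ_term (hd : d.Bounded X) (hz : ∀ i, bitSize (z i) ≤ X) (i j : ℕ) :
    bitSize (d.scaledQ i j * z j) ≤ 7 * X :=
  (bitSize_mul_le (hd.size_scaledQ i j) (hz j)).trans (by omega)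

theorem Bounded.sum_mulQ_le (hd : d.Bounded X) :
    d.n * (2 * (7 * X) + 1) + 2 ≤ 17 * ((d.n + 1) * X) := by
  have := hd.pos
  nlinarith

theorem Bounded.size_mulQ (hd : d.Bounded X) (hz : ∀ i, bitSize (z i) ≤ X) (i : ℕ) :
    bitSize (d.mulQ z i) ≤ 17 * ((d.n + 1) * X) :=
  (bitSize_sum_le (fun j _ => hd.size_mulQ_term hz i j) le_rfl).trans hd.sum_mulQ_le

theorem Bounded.size_formQ_term (hd : d.Bounded X) (hz : ∀ i, bitSize (z i) ≤ X) (i : ℕ) :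
    bitSize (z i * d.mulQ z i) ≤ 18 * ((d.n + 1) * X) :=
  (bitSize_mul_le (hz i) (hd.size_mulQ hz i)).trans (by have := hd.mul_le; omega)

theorem Bounded.sum_formQ_le (hd : d.Bounded X) :
    d.n * (2 * (18 * ((d.n + 1) * X)) + 1) + 2 ≤ 39 * ((d.n + 1) ^ 2 * X) := by
  have := hd.pos
  nlinarith [hd.mul_le]

theorem Bounded.size_formQ (hd : d.Bounded X) (hz : ∀ i, bitSize (z i) ≤ X) :
    bitSize (d.formQ z) ≤ 39 * ((d.n + 1) ^ 2 * X) :=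
  (bitSize_sum_le (fun i _ => hd.size_formQ_term hz i) le_rfl).trans hd.sum_formQ_le

theorem Bounded.size_formDiag_term (hd : d.Bounded X) (hz : ∀ i, bitSize (z i) ≤ X) (i : ℕ) :
    bitSize (d.scaledDiag i * z i) ≤ 7 * X :=
  (bitSize_mul_le (hd.size_scaledDiag i) (hz i)).trans (by omega)

theorem Bounded.size_formDiag (hd : d.Bounded X) (hz : ∀ i, bitSize (z i) ≤ X) :
    bitSize (d.formDiag z) ≤ 17 * ((d.n + 1) * X) :=
  (bitSize_sum_le (fun i _ => hd.size_formDiag_term hz i) le_rfl).trans hd.sum_mulQ_le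

theorem Bounded.size_mulH_term (hd : d.Bounded X) (hz : ∀ i, bitSize (z i) ≤ X) (i j : ℕ) :
    bitSize (d.scaledH i j * z j) ≤ 18 * ((d.n + 1) * X) :=
  (bitSize_mul_le (hd.size_scaledH i j) (hz j)).trans (by
    have h := hd.mul_le
    rcases Nat.eq_zero_or_pos d.n with h0 | h0
    · simp only [h0] at h ⊢; omega
    · have : 2 * X ≤ (d.n + 1) * X := Nat.mul_le_mul_right _ (by omega)
      omega)

theorem Bounded.size_mulH (hd : d.Bounded X) (hz : ∀ i, bitSize (z i) ≤ X) (i : ℕ) :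
    bitSize (d.mulH z i) ≤ 39 * ((d.n + 1) ^ 2 * X) :=
  (bitSize_sum_le (fun j _ => hd.size_mulH_term hz i j) le_rfl).trans hd.sum_formQ_le

theorem Bounded.size_indicator (hd : d.Bounded X) (c : ℚ) : bitSize (indicator c) ≤ X := by
  unfold indicator
  split
  · exact hd.one
  · rw [bitSize_zero]; exact hd.pos

theorem Bounded.size_clamp (hd : d.Bounded X) {r : ℚ} {β : ℕ} (hβ : X ≤ β) (h : bitSize r ≤ β) :
    bitSize (if r < 0 then 0 else r) ≤ β ∧ bitSize (clamp r) ≤ β := by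
  have h0 : bitSize 0 ≤ β := by rw [bitSize_zero]; exact hd.pos.trans hβ
  have h1 : bitSize 1 ≤ β := hd.one.trans hβ
  unfold clamp
  refine ⟨?_, ?_⟩
  · split <;> assumption
  · split
    · assumption
    · split <;> assumption

/-- This is the largest of the length bounds; the constant in `sizeBound` is chosen to exceed it. -/
theorem Bounded.size_rawStep (hd : d.Bounded X) {y : ℕ → ℚ} (hy : ∀ i, bitSize (y i) ≤ X)
    (hz : ∀ i, bitSize (z i) ≤ X) (i : ℕ) :
    bitSize (d.rawStep y z i) ≤ 900 * ((d.n + 1) ^ 2 * X) := by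
  have hm := hd.mul_le
  have hp := hd.param
  have h1 := bitSize_sub_le hd.one (bitSize_mul_le (hd.size_u i) (hy i))
  have h2 := bitSize_mul_le h1 (bitSize_add_le (hd.size_scaledLin i) (hd.size_mulH hy i))
  have h3 := bitSize_mul_le (hd.size_indicator (d.formQ z))
    (bitSize_mul_le (bitSize_natCast_le 2) (hd.size_mulQ hz i))
  have h4 := bitSize_mul_le (hd.size_indicator (d.formDiag z)) (hd.size_scaledDiag i)
  have h5 := bitSize_mul_le hp.2.2.2.2.1 (bitSize_add_le h3 h4)
  have h6 := bitSize_add_le (hz i) (bitSize_div_le (bitSize_sub_le h2 h5) hp.2.2.2.2.2.1)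
  refine h6.trans ?_
  omega

/-- This keeps the iterates short: a grid point of [0,1] is p/D with 0 ≤ p ≤ D, no matter how many
iterations have led to it. -/
theorem Bounded.size_round (hd : d.Bounded X) {x : ℚ} (h0 : 0 ≤ x) (h1 : x ≤ 1) :
    bitSize (d.round x) ≤ X := by
  unfold round
  have hD := gridDen_pos d.n hd.E_pos
  set D := gridDen d.n d.E with hDdef
  have hD' : (0 : ℚ) < D := by exact_mod_cast hD
  refine (bitSize_le_of_eq_div (p := ⌊(D : ℚ) * x⌋) hD.ne' rfl).trans ?_
  have f0 : 0 ≤ ⌊(D : ℚ) * x⌋ := Int.floor_nonneg.2 (by positivity)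
  have f1 : ⌊(D : ℚ) * x⌋ ≤ D := by
    have : (⌊(D : ℚ) * x⌋ : ℚ) ≤ D := (Int.floor_le _).trans (mul_le_of_le_one_right hD'.le h1)
    exact_mod_cast this
  have s1 := natSize_le_self (⌊(D : ℚ) * x⌋).natAbs
  have s2 := natSize_le_self D
  have := hd.D_le
  omega

end Vectors

end Data

end QuadApprox

namespace QuadApprox

/-! ### The program

Arrays 0 to 6 hold the input and the output, 7 to 11 the parameters, 12 the scaling factors, 13 the
size of the objective, 14 to 16 counters, 17 and 24 temporary values, 18 and 19 the products with
the matrices, 20 and 21 the two points, 22 and 23 the values of the constraints, and 25 and 26 the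
indicators of their violation. -/

namespace Code

open QuadApprox.Expr

/-- The number `k`. -/
abbrev lit (k : ℚ) : Expr := .const k

/-- The entry of array `r` with index `e`. -/
abbrev entry (r : ℕ) (e : Expr) : Expr := .get r e (.const 0)

/-- The scaled linear constraint at `e`. -/
abbrev diagTerm (e : Expr) : Expr := .div (.mul (entry 12 e) (.get 5 e e)) (var 2)

/-- Computation of the parameters. -/
def setParams : Prog :=
  -- The ceiling of 1/ε, expressed as a negated floor.
  .seq (.set 7 (.sub (lit 0) (.floor (.sub (lit 0) (.div (lit 1) (var 1))))))
  (.seq (.set 8 (.mul (lit 16) (var 7)))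
  (.seq (.set 9 (.mul (.mul (.mul (.mul (.add (var 0) (lit 1)) (.add (var 0) (lit 1)))
      (.mul (.add (var 0) (lit 1)) (.add (var 0) (lit 1)))) (.mul (var 8) (var 8))) (var 7)))
  (.seq (.set 10 (.mul (.mul (.mul (.add (var 0) (lit 1)) (.add (var 0) (lit 1))) (var 9)) (var 7)))
    (.set 11 (.mul (var 10) (var 10))))))

/-- Computation of the scaling factors. -/
def scaling : Prog :=
  .forLoop 14 (var 0) (.ite (var 2) (.get 5 (var 14) (var 14))
    (.assign 12 (var 14) (.const 0) (.div (var 2) (.get 5 (var 14) (var 14))))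
    (.assign 12 (var 14) (.const 0) (lit 1)))

/-- Computation of the size of the objective. -/
def objSize : Prog := .sumLoop 13 15 (var 0) (.mul (entry 12 (var 15)) (entry 3 (var 15)))

/-- Multiplication of a vector with a matrix. -/
def matVec (dst : ℕ) (term : Expr) : Prog :=
  .forLoop 14 (var 0) (.seq (.sumLoop 17 15 (var 0) term)
    (.assign dst (var 14) (.const 0) (var 17)))

/-- Evaluation of the constraints at the point in array `src`. -/
def constraints (src : ℕ) : Prog :=
  .seq (matVec 18 (.mul (.div (.mul (.mul (entry 12 (var 14)) (entry 12 (var 15)))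
    (.get 5 (var 14) (var 15))) (var 2)) (entry src (var 15))))
  (.seq (.sumLoop 22 15 (var 0) (.mul (entry src (var 15)) (entry 18 (var 15))))
    (.sumLoop 23 15 (var 0) (.mul (diagTerm (var 15)) (entry src (var 15)))))

/-- Multiplication of the first point with the Hessian. -/
def hessian : Prog :=
  matVec 19 (.mul (.div (.mul (.mul (entry 12 (var 14)) (entry 12 (var 15)))
    (.add (.get 4 (var 14) (var 15)) (.get 4 (var 15) (var 14)))) (var 13)) (entry 20 (var 15)))

/-- The indicator of `1 < c` for the variable `src`. -/
def flag (dst src : ℕ) : Prog := .ite (lit 1) (var src) (.set dst (lit 1)) (.set dst (lit 0))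

/-- The measured factor. -/
abbrev slack : Expr := .sub (lit 1) (.mul (entry 12 (var 14)) (entry 20 (var 14)))

/-- The gradient step. -/
def rawExpr : Expr :=
  .add (entry 21 (var 14)) (.div (.sub
    (.mul slack (.add (.div (.mul (entry 12 (var 14)) (entry 3 (var 14))) (var 13))
      (entry 19 (var 14))))
    (.mul (var 8) (.add (.mul (var 25) (.mul (lit 2) (entry 18 (var 14))))
      (.mul (var 26) (diagTerm (var 14)))))) (var 9))

/-- Rounding down to the grid. -/
def roundExpr (e : Expr) : Expr := .div (.floor (.mul (var 11) e)) (var 11)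

/-- The update of one coordinate. -/
def updateBody : Prog :=
  .seq (.set 24 rawExpr)
  (.seq (.ite (var 24) (lit 0) (.set 24 (lit 0)) .skip)
  (.seq (.ite (lit 1) (var 24) (.set 24 (lit 1)) .skip)
  -- The first point is overwritten after the raw gradient step has been stored and before the
  -- second point changes, so both updates use the old pair.
  (.seq (.assign 20 (var 14) (.const 0) (roundExpr (.add (entry 20 (var 14))
      (.div (.mul slack (entry 21 (var 14))) (var 10)))))
    (.assign 21 (var 14) (.const 0) (roundExpr (var 24))))))

/-- The update of the two points. -/
def update : Prog := .forLoop 14 (var 0) updateBody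

/-- One iteration. -/
def iteration : Prog :=
  .seq (constraints 21) (.seq hessian (.seq (flag 25 22) (.seq (flag 26 23) update)))

/-- The maximum of one and the values of the constraints. -/
def shrinkFactor : Prog :=
  .seq (.set 24 (lit 1))
  (.seq (.ite (var 24) (var 22) (.set 24 (var 22)) .skip)
    (.ite (var 24) (var 23) (.set 24 (var 23)) .skip))

/-- The output. -/
def writeOutput : Prog :=
  .forLoop 14 (var 0) (.assign 6 (var 14) (.const 0)
    (.div (.mul (entry 12 (var 14)) (entry 20 (var 14))) (var 24)))

/-- The algorithm. -/
def main : Prog :=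
  .seq setParams (.seq scaling (.seq objSize (.seq (.forLoop 16 (var 10) iteration)
    (.seq (constraints 20) (.seq shrinkFactor writeOutput)))))

end Code

/-! ### Correctness of the program -/

/-- The memory holds the input. -/
structure Loaded (d : Data) (s : Store) : Prop where
  n : s 0 0 0 = d.n
  C : s 2 0 0 = d.C
  a : ∀ i, s 3 i 0 = d.a i
  A : ∀ i j, s 4 i j = d.A i j
  Q : ∀ i j, s 5 i j = d.Q i j

/-- The memory holds the input, the parameters, the scaling factors and the size of the
objective. -/
structure Ready (d : Data) (s : Store) : Prop extends Loaded d s where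
  K : s 8 0 0 = penalty d.E
  Γ : s 9 0 0 = invStep d.n d.E
  T : s 10 0 0 = numIter d.n d.E
  D : s 11 0 0 = gridDen d.n d.E
  u : ∀ i < d.n, s 12 i 0 = d.u i
  M : s 13 0 0 = d.M

theorem Loaded.congr {d : Data} {s s' : Store} (h : Loaded d s)
    (hs : ∀ r ∈ [0, 2, 3, 4, 5], s' r = s r) : Loaded d s' := by
  constructor <;> intros <;> rw [hs _ (by decide)]
  exacts [h.n, h.C, h.a _, h.A _ _, h.Q _ _]

theorem Ready.congr {d : Data} {s s' : Store} (h : Ready d s)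
    (hs : ∀ r < 14, r ∉ [1, 6, 7] → s' r = s r) : Ready d s' := by
  refine ⟨h.toLoaded.congr fun r hr => ?_, ?_, ?_, ?_, ?_, ?_, ?_⟩
  · fin_cases hr <;> exact hs _ (by decide) (by decide)
  all_goals intros; rw [hs _ (by decide) (by decide)]
  exacts [h.K, h.Γ, h.T, h.D, h.u _ (by assumption), h.M]

section Pieces

variable {d : Data} {X : ℕ}

theorem Data.Bounded.counter_le (hd : d.Bounded X) : d.n + 1 ≤ d.sizeBound X := by
  have := hd.mul_le
  unfold Data.sizeBound; omega

theorem run_matVec {B β : ℕ} {dst : ℕ} {term : Expr} (hB : d.n + 1 ≤ B)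
    (hβB : d.n * (2 * β + 1) + 2 ≤ B) (hdst : dst ∉ [14, 15, 17]) (hdst0 : dst ≠ 0)
    {s₀ : Store} (hn : s₀ 0 0 0 = d.n) (v : ℕ → ℕ → ℚ)
    (hv : ∀ i < d.n, ∀ j < d.n, bitSize (v i j) ≤ β)
    (hterm : ∀ i < d.n, ∀ j < d.n, ∀ s : Store,
      (∀ r, r ∉ [14, 15, 17, dst] → s r = s₀ r) → s 14 0 0 = i → s 15 0 0 = j →
      term.eval s = v i j) :
    ∃ s' m, Run B (Code.matVec dst term) s₀ s' m ∧ m ≤ 9 * (d.n + 1) ^ 2 ∧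
      (∀ r, r ∉ [14, 15, 17, dst] → s' r = s₀ r) ∧
      ∀ i < d.n, s' dst i 0 = ∑ j ∈ Finset.range d.n, v i j := by
  simp only [List.mem_cons, List.not_mem_nil, or_false, not_or] at hdst
  have hmods : ∀ r, r ∉ [14, 15, 17, dst] ↔ r ∉ 14 :: (Prog.seq (.sumLoop 17 15 (.var 0) term)
      (.assign dst (.var 14) (.const 0) (.var 17))).mods := fun r => by
    simp only [Prog.mods, Prog.mods_sumLoop, List.mem_cons, List.mem_append, List.not_mem_nil,
      or_false, not_or]
    tauto
  obtain ⟨s', m, hr, hm, h1, h2⟩ := Run.mapLoop (B := B) (c := 14) (n := d.n) (mb := 3 * d.n + 4)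
    (bound := .var 0) (body := .seq (.sumLoop 17 15 (.var 0) term)
      (.assign dst (.var 14) (.const 0) (.var 17))) (R := [dst]) hB
    (by simp only [Prog.mods, Prog.mods_sumLoop, List.mem_cons, List.mem_append, List.not_mem_nil,
          or_false, not_or]
        omega)
    (by simp only [List.mem_singleton]; omega) s₀
    (fun s hs => by
      rw [Expr.eval_var, hs 0 ((hmods 0).1 (by simp; omega)), hn])
    (fun _ i => ∑ j ∈ Finset.range d.n, v i j)
    (fun i hi s hs hc _ => by
      have hs0 : ∀ r, r ∉ [14, 15, 17, dst] → s r = s₀ r := fun r hr => hs r ((hmods r).1 hr)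
      obtain ⟨s₁, m₁, r₁, hm₁, hf₁, ha₁⟩ := Run.sumLoop (B := B) (acc := 17) (c := 15) (n := d.n)
        (β := β) (bound := .var 0) (e := term) (by decide) hB s (v i) (hv i hi) hβB
        (fun s₁ h => by
          rw [Expr.eval_var, h 0 (by decide) (by decide), hs0 0 (by simp; omega), hn])
        (fun j hj s₁ h hc₁ => hterm i hi j hj s₁ (fun r hr => by
          simp only [List.mem_cons, List.not_mem_nil, or_false, not_or] at hr
          rw [h r (by omega) (by omega), hs0 r (by simp; omega)])
          (by rw [h 14 (by decide) (by decide), hc]) hc₁)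
      have r₂ := Run.assign (B := B) s₁ dst (.var 14) (.const 0) (.var 17) (by
        rw [Expr.eval_var, ha₁]
        exact (bitSize_sum_le (hv i hi) le_rfl).trans hβB)
      refine ⟨_, _, .seq r₁ r₂, by omega, fun r hr i' => ?_⟩
      obtain rfl : r = dst := by simpa using hr
      rw [Expr.eval_var, Expr.eval_var, ha₁, hf₁ 14 (by decide) (by decide), hc,
        Nat.floor_natCast, Store.write, hf₁ r (by omega) (by omega)]
      simp [Expr.eval])
  refine ⟨s', m, hr, hm.trans (by nlinarith), fun r hr => h1 r ((hmods r).1 hr),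
    fun i hi => h2 dst (by simp) i hi⟩

theorem run_constraints (hd : d.Bounded X) {src : ℕ} (hsrc : src = 20 ∨ src = 21) {s₀ : Store}
    (hs₀ : Ready d s₀) {z : ℕ → ℚ} (hz : ∀ i, bitSize (z i) ≤ X)
    (hsz : ∀ i < d.n, s₀ src i 0 = z i) :
    ∃ s' m, Run (d.sizeBound X) (Code.constraints src) s₀ s' m ∧ m ≤ 15 * (d.n + 1) ^ 2 ∧
      (∀ r, r ∉ [14, 15, 17, 18, 22, 23] → s' r = s₀ r) ∧ (∀ i < d.n, s' 18 i 0 = d.mulQ z i) ∧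
      s' 22 0 0 = d.formQ z ∧ s' 23 0 0 = d.formDiag z := by
  have hB := hd.counter_le
  have hm := hd.mul_le
  have g1 := hd.sum_mulQ_le
  have g2 := hd.sum_formQ_le
  obtain ⟨s₁, m₁, r₁, hm₁, f₁, v₁⟩ := run_matVec (d := d) (B := d.sizeBound X) (β := 7 * X)
    (dst := 18)
    (term := .mul (.div (.mul (.mul (Code.entry 12 (.var 14)) (Code.entry 12 (.var 15)))
      (.get 5 (.var 14) (.var 15))) (.var 2)) (Code.entry src (.var 15)))
    hB (by unfold Data.sizeBound; omega) (by decide) (by decide) hs₀.n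
    (fun i j => d.scaledQ i j * z j) (fun i _ j _ => hd.size_mulQ_term hz i j)
    (fun i hi j hj s hs h14 h15 => by
      have e12 := hs 12 (by decide)
      have e5 := hs 5 (by decide)
      have e2 := hs 2 (by decide)
      have es : s src = s₀ src := hs src (by rcases hsrc with rfl | rfl <;> decide)
      simp [Expr.eval, h14, h15, e12, e5, e2, es, hs₀.u i hi, hs₀.u j hj, hs₀.Q, hs₀.C, hsz j hj,
        Data.scaledQ])
  have hs₁ : Ready d s₁ := hs₀.congr fun r hr hr' => f₁ r (by simp; omega)
  have hsz₁ : ∀ i < d.n, s₁ src i 0 = z i := fun i hi => by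
    rw [f₁ src (by rcases hsrc with rfl | rfl <;> decide), hsz i hi]
  obtain ⟨s₂, m₂, r₂, hm₂, f₂, v₂⟩ := Run.sumLoop (B := d.sizeBound X) (acc := 22) (c := 15)
    (n := d.n) (β := 18 * ((d.n + 1) * X)) (bound := .var 0)
    (e := .mul (Code.entry src (.var 15)) (Code.entry 18 (.var 15))) (by decide) hB s₁
    (fun i => z i * d.mulQ z i) (fun i _ => hd.size_formQ_term hz i)
    (by unfold Data.sizeBound; omega)
    (fun s h => by rw [Expr.eval_var, h 0 (by decide) (by decide), hs₁.n])
    (fun j hj s h h15 => by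
      have e18 := h 18 (by decide) (by decide)
      have es : s src = s₁ src := h src (by rcases hsrc with rfl | rfl <;> decide)
        (by rcases hsrc with rfl | rfl <;> decide)
      simp [Expr.eval, h15, e18, es, hsz₁ j hj, v₁ j hj, Data.mulQ])
  have hs₂ : Ready d s₂ := hs₁.congr fun r hr hr' => f₂ r (by omega) (by omega)
  have hsz₂ : ∀ i < d.n, s₂ src i 0 = z i := fun i hi => by
    rw [f₂ src (by rcases hsrc with rfl | rfl <;> decide)
      (by rcases hsrc with rfl | rfl <;> decide), hsz₁ i hi]
  obtain ⟨s₃, m₃, r₃, hm₃, f₃, v₃⟩ := Run.sumLoop (B := d.sizeBound X) (acc := 23) (c := 15)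
    (n := d.n) (β := 7 * X) (bound := .var 0)
    (e := .mul (Code.diagTerm (.var 15)) (Code.entry src (.var 15))) (by decide) hB s₂
    (fun i => d.scaledDiag i * z i) (fun i _ => hd.size_formDiag_term hz i)
    (by unfold Data.sizeBound; omega)
    (fun s h => by rw [Expr.eval_var, h 0 (by decide) (by decide), hs₂.n])
    (fun j hj s h h15 => by
      have e12 := h 12 (by decide) (by decide)
      have e5 := h 5 (by decide) (by decide)
      have e2 := h 2 (by decide) (by decide)
      have es : s src = s₂ src := h src (by rcases hsrc with rfl | rfl <;> decide)
        (by rcases hsrc with rfl | rfl <;> decide)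
      simp [Expr.eval, h15, e12, e5, e2, es, hs₂.u j hj, hs₂.Q, hs₂.C, hsz₂ j hj, Data.scaledDiag])
  refine ⟨s₃, _, .seq r₁ (.seq r₂ r₃), by nlinarith, fun r hr => ?_, fun i hi => ?_, ?_, v₃⟩
  · simp only [List.mem_cons, List.not_mem_nil, or_false, not_or] at hr
    rw [f₃ r (by omega) (by omega), f₂ r (by omega) (by omega), f₁ r (by simp; omega)]
  · rw [f₃ 18 (by decide) (by decide), f₂ 18 (by decide) (by decide), v₁ i hi, Data.mulQ]
  · rw [f₃ 22 (by decide) (by decide), v₂, Data.formQ]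

theorem run_hessian (hd : d.Bounded X) {s₀ : Store} (hs₀ : Ready d s₀) {y : ℕ → ℚ}
    (hy : ∀ i, bitSize (y i) ≤ X) (hsy : ∀ i < d.n, s₀ 20 i 0 = y i) :
    ∃ s' m, Run (d.sizeBound X) Code.hessian s₀ s' m ∧ m ≤ 9 * (d.n + 1) ^ 2 ∧
      (∀ r, r ∉ [14, 15, 17, 19] → s' r = s₀ r) ∧ ∀ i < d.n, s' 19 i 0 = d.mulH y i := by
  have hm := hd.mul_le
  have g := hd.sum_formQ_le
  exact run_matVec (d := d) (B := d.sizeBound X) (β := 18 * ((d.n + 1) * X)) (dst := 19)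
    hd.counter_le (by unfold Data.sizeBound; omega) (by decide) (by decide) hs₀.n
    (fun i j => d.scaledH i j * y j) (fun i _ j _ => hd.size_mulH_term hy i j)
    (fun i hi j hj s hs h14 h15 => by
      have e12 := hs 12 (by decide)
      have e4 := hs 4 (by decide)
      have e13 := hs 13 (by decide)
      have e20 := hs 20 (by decide)
      simp [Expr.eval, h14, h15, e12, e4, e13, e20, hs₀.u i hi, hs₀.u j hj, hs₀.A, hs₀.M, hsy j hj,
        Data.scaledH])

theorem run_flag (hd : d.Bounded X) (dst src : ℕ) (s₀ : Store) :
    ∃ s' m, Run (d.sizeBound X) (Code.flag dst src) s₀ s' m ∧ m = 2 ∧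
      (∀ r, r ≠ dst → s' r = s₀ r) ∧ s' dst 0 0 = Data.indicator (s₀ src 0 0) := by
  have hX : X ≤ d.sizeBound X := by have := hd.mul_le; unfold Data.sizeBound; omega
  have hw : ∀ (q : ℚ) (r : ℕ), r ≠ dst → s₀.write dst 0 0 q r = s₀ r :=
    fun q r hr => by funext i j; simp [Store.write, hr]
  unfold Data.indicator
  by_cases h : 1 < s₀ src 0 0
  · refine ⟨_, _, .ite_true ?_ (Run.set (q := 1) s₀ dst (.const 1) rfl (hd.one.trans hX)), rfl, hw _, ?_⟩
    · rw [Expr.eval_var]; exact h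
    · simp [Store.write, h]
  · refine ⟨_, _, .ite_false ?_ (Run.set (q := 0) s₀ dst (.const 0) rfl ?_), rfl, hw _, ?_⟩
    · rw [Expr.eval_var]; exact h
    · rw [bitSize_zero]; exact hd.pos.trans hX
    · simp [Store.write, h]

end Pieces

end QuadApprox

namespace QuadApprox

/-! ### Invariants of the rational iterates -/

namespace Data

/-- The sign conditions on the input under which the points stay in the unit cube. -/
structure Valid (d : Data) : Prop where
  C_pos : 0 < d.C
  Q_nonneg : ∀ i j, 0 ≤ d.Q i j
  E_pos : 0 < d.E

variable {d : Data}

theorem Valid.u_mem (hd : d.Valid) (i : ℕ) : 0 < d.u i ∧ d.u i ≤ 1 := by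
  unfold u
  split
  · rename_i h
    exact ⟨div_pos hd.C_pos (hd.C_pos.trans h), (div_le_one (hd.C_pos.trans h)).2 h.le⟩
  · simp

theorem clamp_mem (r : ℚ) : 0 ≤ clamp r ∧ clamp r ≤ 1 := by
  unfold clamp
  split_ifs <;> constructor <;> linarith

theorem clamp_eq (r : ℚ) : clamp r = max 0 (min 1 r) := by
  unfold clamp
  rcases lt_or_ge r 0 with h | h
  · simp [h, min_eq_right (h.le.trans zero_le_one), h.le]
  · rcases lt_or_ge 1 r with h1 | h1
    · simp [not_lt.2 h, h1, min_eq_left h1.le]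
    · simp [not_lt.2 h, not_lt.2 h1, min_eq_right h1, h]

theorem Valid.round_le (hd : d.Valid) (x : ℚ) :
    d.round x ≤ x ∧ x - 1 / (gridDen d.n d.E : ℚ) ≤ d.round x := by
  have hD : (0 : ℚ) < gridDen d.n d.E := by exact_mod_cast gridDen_pos d.n hd.E_pos
  unfold round
  constructor
  · rw [div_le_iff₀ hD, mul_comm x]
    exact Int.floor_le _
  · rw [le_div_iff₀ hD, sub_mul, one_div_mul_cancel hD.ne', mul_comm x]
    exact (Int.sub_one_lt_floor _).le

/-- Rounding down never passes a grid point. This makes the sequence y monotone. -/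
theorem Valid.round_ge_of_grid (hd : d.Valid) {x : ℚ} {k : ℤ}
    (h : (k : ℚ) / (gridDen d.n d.E : ℚ) ≤ x) : (k : ℚ) / (gridDen d.n d.E : ℚ) ≤ d.round x := by
  have hD : (0 : ℚ) < gridDen d.n d.E := by exact_mod_cast gridDen_pos d.n hd.E_pos
  unfold round
  rw [div_le_iff₀ hD] at h
  refine div_le_div_of_nonneg_right ?_ hD.le
  have : k ≤ ⌊(gridDen d.n d.E : ℚ) * x⌋ := Int.le_floor.2 (by linarith)
  exact_mod_cast this

theorem Valid.round_nonneg (hd : d.Valid) {x : ℚ} (h : 0 ≤ x) : 0 ≤ d.round x := by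
  have := hd.round_ge_of_grid (x := x) (k := 0) (by simpa using h)
  simpa using this

/-- A coordinate of y grows by at most 1/T per iteration, so it stays in [0,1] for T iterations and
the length bound for grid points applies. The bound u_i y_i ≤ 1 keeps the measured factor
nonnegative. -/
theorem Valid.iter_mem (hd : d.Valid) (t i : ℕ) :
    (0 ≤ (d.iter t).2 i ∧ (d.iter t).2 i ≤ 1) ∧ 0 ≤ (d.iter t).1 i ∧
      d.u i * (d.iter t).1 i ≤ 1 ∧ (d.iter t).1 i ≤ t / (numIter d.n d.E : ℚ) ∧
      ∃ k : ℤ, (d.iter t).1 i = k / (gridDen d.n d.E : ℚ) := by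
  have hT : (1 : ℚ) ≤ numIter d.n d.E := by exact_mod_cast numIter_pos d.n hd.E_pos
  have hT0 : (0 : ℚ) < numIter d.n d.E := by linarith
  induction t with
  | zero => simpa [iter] using ⟨0, by simp⟩
  | succ t ih =>
    obtain ⟨hz, h0, hu, ht, k, hk⟩ := ih
    have ui := hd.u_mem i
    set y := (d.iter t).1 with hy
    set z := (d.iter t).2 with hz'
    have e1 : (d.iter (t + 1)).1 i = d.nextY y z i := rfl
    have e2 : (d.iter (t + 1)).2 i = d.nextZ y z i := rfl
    have c := clamp_mem (d.rawStep y z i)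
    have r1 := hd.round_le (y i + (1 - d.u i * y i) * z i / (numIter d.n d.E : ℚ))
    have hfac : 0 ≤ (1 - d.u i * y i) * z i := mul_nonneg (by linarith) hz.1
    have hstep : 0 ≤ (1 - d.u i * y i) * z i / (numIter d.n d.E : ℚ) := by positivity
    have hstep1 : (1 - d.u i * y i) * z i / (numIter d.n d.E : ℚ) ≤ 1 / (numIter d.n d.E : ℚ) := by
      gcongr
      refine mul_le_one₀ ?_ hz.1 hz.2
      linarith [mul_nonneg ui.1.le h0]
    have hstep2 : d.u i * ((1 - d.u i * y i) * z i / (numIter d.n d.E : ℚ)) ≤ 1 - d.u i * y i := by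
      rw [mul_div_assoc', div_le_iff₀ hT0]
      have a1 : d.u i * z i ≤ 1 := mul_le_one₀ ui.2 hz.1 hz.2
      have a2 : 0 ≤ 1 - d.u i * y i := by linarith
      nlinarith [mul_le_mul_of_nonneg_left a1 a2]
    rw [e1, e2]
    refine ⟨⟨hd.round_nonneg c.1, (hd.round_le _).1.trans c.2⟩,
      hd.round_nonneg (by linarith), ?_, ?_, ⟨_, rfl⟩⟩
    · have := mul_le_mul_of_nonneg_left r1.1 ui.1.le
      unfold nextY
      linarith
    · refine r1.1.trans ?_
      push_cast
      rw [add_div]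
      linarith

theorem Valid.size_next (hd : d.Valid) {X : ℕ} (hX : d.Bounded X) {t : ℕ}
    (ht : t < numIter d.n d.E) (i : ℕ) :
    bitSize ((d.iter (t + 1)).1 i) ≤ X ∧ bitSize ((d.iter (t + 1)).2 i) ≤ X := by
  have hT : (1 : ℚ) ≤ numIter d.n d.E := by exact_mod_cast numIter_pos d.n hd.E_pos
  have hT0 : (0 : ℚ) < numIter d.n d.E := by linarith
  obtain ⟨hz, h0, hu, hy, -⟩ := hd.iter_mem t i
  have ui := hd.u_mem i
  have c := clamp_mem (d.rawStep (d.iter t).1 (d.iter t).2 i)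
  refine ⟨hX.size_round ?_ ?_, hX.size_round c.1 c.2⟩
  · have : 0 ≤ (1 - d.u i * (d.iter t).1 i) * (d.iter t).2 i := mul_nonneg (by linarith) hz.1
    positivity
  · have h1 : (1 - d.u i * (d.iter t).1 i) * (d.iter t).2 i ≤ 1 :=
      mul_le_one₀ (by linarith [mul_nonneg ui.1.le h0]) hz.1 hz.2
    have h2 : ((t : ℚ) + 1) / (numIter d.n d.E : ℚ) ≤ 1 := by
      rw [div_le_one hT0]; exact_mod_cast ht
    have h3 := div_le_div_of_nonneg_right h1 hT0.le
    rw [add_div] at h2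
    linarith

theorem Valid.size_iter (hd : d.Valid) {X : ℕ} (hX : d.Bounded X) {t : ℕ}
    (ht : t ≤ numIter d.n d.E) (i : ℕ) :
    bitSize ((d.iter t).1 i) ≤ X ∧ bitSize ((d.iter t).2 i) ≤ X := by
  rcases t with _ | t
  · have h := hX.pos
    simp only [iter, Pi.zero_apply, bitSize_zero]
    exact ⟨h, h⟩
  · exact hd.size_next hX ht i

end Data

/-! ### Execution of the parts of the program -/

section Pieces

variable {d : Data} {X : ℕ}

theorem run_guard {B : ℕ} (e₁ e₂ : Expr) (r : ℕ) (e : Expr) (s : Store)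
    (he : bitSize (e.eval s) ≤ B) :
    ∃ s', Run B (.ite e₁ e₂ (.set r e) .skip) s s' 2 ∧ (∀ r', r' ≠ r → s' r' = s r') ∧
      s' r 0 0 = if e₁.eval s < e₂.eval s then e.eval s else s r 0 0 := by
  by_cases h : e₁.eval s < e₂.eval s
  · refine ⟨_, .ite_true h (Run.set s r e rfl he), fun r' hr => ?_, ?_⟩
    · funext i j; simp [Store.write, hr]
    · simp [Store.write, h]
  · exact ⟨s, .ite_false h (.skip s), fun _ _ => rfl, by simp [h]⟩

theorem run_assignAt {B c i : ℕ} (r : ℕ) (e : Expr) (s : Store) (hc : s c 0 0 = i) {q : ℚ}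
    (he : e.eval s = q) (hq : bitSize q ≤ B) :
    ∃ s', Run B (.assign r (.var c) (.const 0) e) s s' 1 ∧ (∀ r', r' ≠ r → s' r' = s r') ∧
      ∀ i', s' r i' 0 = if i' = i then q else s r i' 0 := by
  refine ⟨_, .assign s r (.var c) (.const 0) e (by rwa [he]), fun r' hr => ?_, fun i' => ?_⟩
  · funext i j; simp [Store.write, hr]
  · rw [Expr.eval_var, hc, Nat.floor_natCast, he]
    simp [Store.write, Expr.eval]

theorem run_update (hd : d.Bounded X) {s₀ : Store} (hs₀ : Ready d s₀) {y z : ℕ → ℚ}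
    (hy : ∀ i, bitSize (y i) ≤ X) (hz : ∀ i, bitSize (z i) ≤ X)
    (hy' : ∀ i, bitSize (d.nextY y z i) ≤ X) (hz' : ∀ i, bitSize (d.nextZ y z i) ≤ X)
    (hsy : ∀ i < d.n, s₀ 20 i 0 = y i) (hsz : ∀ i < d.n, s₀ 21 i 0 = z i)
    (h18 : ∀ i < d.n, s₀ 18 i 0 = d.mulQ z i) (h19 : ∀ i < d.n, s₀ 19 i 0 = d.mulH y i)
    (h25 : s₀ 25 0 0 = Data.indicator (d.formQ z))
    (h26 : s₀ 26 0 0 = Data.indicator (d.formDiag z)) :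
    ∃ s' m, Run (d.sizeBound X) Code.update s₀ s' m ∧ m ≤ 11 * (d.n + 1) ^ 2 ∧
      (∀ r, r ∉ [14, 20, 21, 24] → s' r = s₀ r) ∧ (∀ i < d.n, s' 20 i 0 = d.nextY y z i) ∧
      ∀ i < d.n, s' 21 i 0 = d.nextZ y z i := by
  have hB := hd.counter_le
  have hm := hd.mul_le
  have hX : X ≤ d.sizeBound X := by unfold Data.sizeBound; omega
  have hraw : 900 * ((d.n + 1) ^ 2 * X) ≤ d.sizeBound X := by unfold Data.sizeBound; omega
  have hmods : ∀ r, r ∉ 14 :: Code.updateBody.mods ↔ r ∉ [14, 20, 21, 24] := fun r => by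
    simp [Code.updateBody, Prog.mods]; omega
  obtain ⟨s', m, hr, hm', h1, h2⟩ := Run.mapLoop (B := d.sizeBound X) (c := 14) (n := d.n)
    (mb := 7) (bound := .var 0) (body := Code.updateBody) (R := [20, 21]) hB (by decide) (by decide)
    s₀ (fun s hs => by rw [Expr.eval_var, hs 0 (by decide), hs₀.n])
    (fun r i => if r = 20 then d.nextY y z i else d.nextZ y z i)
    (fun i hi s hs h14 hR => by
      have hs' : Ready d s := hs₀.congr fun r hr hr' => hs r ((hmods r).2 (by simp; omega))
      have e20 : s 20 i 0 = y i := by rw [hR 20 (by decide), hsy i hi]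
      have e21 : s 21 i 0 = z i := by rw [hR 21 (by decide), hsz i hi]
      have e18 := h18 i hi
      rw [← hs 18 (by decide)] at e18
      have e19 := h19 i hi
      rw [← hs 19 (by decide)] at e19
      rw [← hs 25 (by decide)] at h25
      rw [← hs 26 (by decide)] at h26
      have hval : Code.rawExpr.eval s = d.rawStep y z i := by
        simp [Code.rawExpr, Expr.eval, h14, e20, e21, e18, e19, h25, h26, hs'.u i hi, hs'.a, hs'.M,
          hs'.K, hs'.Γ, hs'.C, hs'.Q, Data.rawStep, Data.scaledLin, Data.scaledDiag]
      have hrs := hd.size_rawStep hy hz i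
      have hcl := hd.size_clamp (hm.1.trans (hm.2.1.trans (by omega))) hrs
      have r₁ := Run.set (B := d.sizeBound X) s 24 _ hval (hrs.trans hraw)
      set s₁ := s.write 24 0 0 (d.rawStep y z i)
      have f₁ : ∀ r, r ≠ 24 → s₁ r = s r := fun r hr => by
        funext i j; simp [s₁, Store.write, hr]
      have v₁ : s₁ 24 0 0 = d.rawStep y z i := by simp [s₁, Store.write]
      obtain ⟨s₂, r₂, f₂, v₂⟩ := run_guard (B := d.sizeBound X) (.var 24) (.const 0) 24 (.const 0) s₁
        (by rw [Expr.eval, bitSize_zero]; exact hd.pos.trans hX)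
      rw [Expr.eval_var, v₁, Expr.eval] at v₂
      obtain ⟨s₃, r₃, f₃, v₃⟩ := run_guard (B := d.sizeBound X) (.const 1) (.var 24) 24 (.const 1) s₂
        (hd.one.trans hX)
      rw [Expr.eval_var, v₂, Expr.eval] at v₃
      -- The two guards executed in turn are the nested conditionals of `Data.clamp`.
      change s₃ 24 0 0 = Data.clamp (d.rawStep y z i) at v₃
      have g₃ : ∀ r, r ≠ 24 → s₃ r = s r := fun r hr => by rw [f₃ r hr, f₂ r hr, f₁ r hr]
      obtain ⟨s₄, r₄, f₄, v₄⟩ := run_assignAt (B := d.sizeBound X) (c := 14) (i := i) 20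
        (Code.roundExpr (.add (Code.entry 20 (.var 14))
          (.div (.mul Code.slack (Code.entry 21 (.var 14))) (.var 10)))) s₃
        (by rw [g₃ 14 (by decide), h14]) (q := d.nextY y z i)
        (by
          have g14 := g₃ 14 (by decide)
          have g20 := g₃ 20 (by decide)
          have g21 := g₃ 21 (by decide)
          have g11 := g₃ 11 (by decide)
          have g10 := g₃ 10 (by decide)
          have g12 := g₃ 12 (by decide)
          simp [Code.roundExpr, Expr.eval, g14, h14, g20, g21, g11, g10, g12, e20, e21, hs'.D,
            hs'.T, hs'.u i hi, Data.nextY, Data.round])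
        ((hy' i).trans hX)
      obtain ⟨s₅, r₅, f₅, v₅⟩ := run_assignAt (B := d.sizeBound X) (c := 14) (i := i) 21
        (Code.roundExpr (.var 24)) s₄
        (by rw [f₄ 14 (by decide), g₃ 14 (by decide), h14]) (q := d.nextZ y z i)
        (by
          have g24 := f₄ 24 (by decide)
          have g11 := f₄ 11 (by decide)
          have g11' := g₃ 11 (by decide)
          simp [Code.roundExpr, Expr.eval, g24, g11, g11', v₃, hs'.D, Data.nextZ, Data.round])
        ((hz' i).trans hX)
      refine ⟨s₅, _, .seq r₁ (.seq r₂ (.seq r₃ (.seq r₄ r₅))), by norm_num, fun r hr i' => ?_⟩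
      rcases List.mem_cons.1 hr with rfl | hr
      · rw [f₅ 20 (by decide), v₄, g₃ 20 (by decide)]; simp
      · obtain rfl : r = 21 := by simpa using hr
        rw [v₅, f₄ 21 (by decide), g₃ 21 (by decide)]; simp)
  refine ⟨s', m, hr, hm'.trans (by nlinarith), fun r hr => h1 r ((hmods r).2 hr),
    fun i hi => by rw [h2 20 (by decide) i hi]; simp, fun i hi => by
      rw [h2 21 (by decide) i hi]; simp⟩

theorem run_iteration (hd : d.Bounded X) (hv : d.Valid) {s₀ : Store} (hs₀ : Ready d s₀) {t : ℕ}
    (ht : t < numIter d.n d.E) (hsy : ∀ i < d.n, s₀ 20 i 0 = (d.iter t).1 i)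
    (hsz : ∀ i < d.n, s₀ 21 i 0 = (d.iter t).2 i) :
    ∃ s' m, Run (d.sizeBound X) Code.iteration s₀ s' m ∧ m ≤ 40 * (d.n + 1) ^ 2 ∧
      (∀ r < 14, s' r = s₀ r) ∧
      (∀ i < d.n, s' 20 i 0 = (d.iter (t + 1)).1 i) ∧
      ∀ i < d.n, s' 21 i 0 = (d.iter (t + 1)).2 i := by
  have hy := fun i => (hv.size_iter hd ht.le i).1
  have hz := fun i => (hv.size_iter hd ht.le i).2
  obtain ⟨s₁, m₁, r₁, b₁, f₁, w₁, p₁, q₁⟩ := run_constraints hd (Or.inr rfl) hs₀ hz hsz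
  have hs₁ : Ready d s₁ := hs₀.congr fun r hr _ => f₁ r (by simp; omega)
  obtain ⟨s₂, m₂, r₂, b₂, f₂, w₂⟩ := run_hessian hd hs₁ hy
    (fun i hi => by rw [f₁ 20 (by decide), hsy i hi])
  have hs₂ : Ready d s₂ := hs₁.congr fun r hr _ => f₂ r (by simp; omega)
  obtain ⟨s₃, m₃, r₃, b₃, f₃, w₃⟩ := run_flag hd 25 22 s₂
  obtain ⟨s₄, m₄, r₄, b₄, f₄, w₄⟩ := run_flag hd 26 23 s₃
  have hs₃ : Ready d s₃ := hs₂.congr fun r hr _ => f₃ r (by omega)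
  have hs₄ : Ready d s₄ := hs₃.congr fun r hr _ => f₄ r (by omega)
  have g₄ : ∀ r, r ≠ 25 → r ≠ 26 → r ∉ [14, 15, 17, 19] → s₄ r = s₁ r := fun r h1 h2 h3 => by
    rw [f₄ r h2, f₃ r h1, f₂ r h3]
  obtain ⟨s₅, m₅, r₅, b₅, f₅, y₅, z₅⟩ := run_update hd hs₄ hy hz
    (fun i => (hv.size_next hd ht i).1) (fun i => (hv.size_next hd ht i).2)
    (fun i hi => by rw [g₄ 20 (by decide) (by decide) (by decide), f₁ 20 (by decide), hsy i hi])
    (fun i hi => by rw [g₄ 21 (by decide) (by decide) (by decide), f₁ 21 (by decide), hsz i hi])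
    (fun i hi => by rw [g₄ 18 (by decide) (by decide) (by decide), w₁ i hi])
    (fun i hi => by rw [f₄ 19 (by decide), f₃ 19 (by decide), w₂ i hi])
    (by rw [f₄ 25 (by decide), w₃, f₂ 22 (by decide), p₁])
    (by rw [w₄, f₃ 23 (by decide), f₂ 23 (by decide), q₁])
  have hpos : 0 < (d.n + 1) ^ 2 := by positivity
  refine ⟨s₅, _, .seq r₁ (.seq r₂ (.seq r₃ (.seq r₄ r₅))), by omega, fun r hr => ?_, y₅, z₅⟩
  rw [f₅ r (by simp; omega), g₄ r (by omega) (by omega) (by simp; omega), f₁ r (by simp; omega)]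

theorem run_iterations (hd : d.Bounded X) (hv : d.Valid) {s₀ : Store} (hs₀ : Ready d s₀)
    (h20 : ∀ i, s₀ 20 i 0 = 0) (h21 : ∀ i, s₀ 21 i 0 = 0) :
    ∃ s' m, Run (d.sizeBound X) (.forLoop 16 (.var 10) Code.iteration) s₀ s' m ∧
      m ≤ numIter d.n d.E * (40 * (d.n + 1) ^ 2 + 2) + 2 ∧ Ready d s' ∧
      ∀ i < d.n, s' 20 i 0 = (d.iter (numIter d.n d.E)).1 i := by
  have hw : ∀ (s : Store) (q : ℚ) (r : ℕ), r ≠ 16 → s.write 16 0 0 q r = s r :=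
    fun s q r hr => by funext i j; simp [Store.write, hr]
  obtain ⟨s', m, hr, hm, hI⟩ := Run.forLoop (B := d.sizeBound X) (c := 16) (N := numIter d.n d.E)
    (mb := 40 * (d.n + 1) ^ 2) (bound := .var 10) (body := Code.iteration)
    (Inv := fun t s => Ready d s ∧ (∀ i < d.n, s 20 i 0 = (d.iter t).1 i) ∧
      ∀ i < d.n, s 21 i 0 = (d.iter t).2 i)
    (by have := hd.mul_le; have := hd.param; unfold Data.sizeBound; omega) (by decide) s₀
    ⟨hs₀.congr fun r hr _ => hw _ _ _ (by omega), fun i _ => by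
      rw [hw _ _ _ (by decide), h20]; rfl, fun i _ => by rw [hw _ _ _ (by decide), h21]; rfl⟩
    (fun t s hI => by rw [Expr.eval_var, hI.1.T])
    (fun t ht s hI _ => by
      obtain ⟨s', m, r, hm, f, hy, hz⟩ := run_iteration hd hv hI.1 ht hI.2.1 hI.2.2
      refine ⟨s', m, r, hm, hI.1.congr fun r hr _ => ?_, fun i hi => ?_, fun i hi => ?_⟩
      · rw [hw _ _ _ (by omega), f r hr]
      · rw [hw _ _ _ (by decide), hy i hi]
      · rw [hw _ _ _ (by decide), hz i hi])
  exact ⟨s', m, hr, hm, hI.1, hI.2.1⟩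

theorem run_setParams (hd : d.Bounded X) {s₀ : Store} (hs₀ : Loaded d s₀)
    (hE : (0 : ℚ) - ((⌊(0 : ℚ) - 1 / s₀ 1 0 0⌋ : ℤ) : ℚ) = d.E) :
    ∃ s' m, Run (d.sizeBound X) Code.setParams s₀ s' m ∧ m ≤ 5 ∧
      (∀ r, r ∉ [7, 8, 9, 10, 11] → s' r = s₀ r) ∧ s' 8 0 0 = penalty d.E ∧
      s' 9 0 0 = invStep d.n d.E ∧ s' 10 0 0 = numIter d.n d.E ∧ s' 11 0 0 = gridDen d.n d.E := by
  have hp := hd.param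
  have hm := hd.mul_le
  have hX : X ≤ d.sizeBound X := by unfold Data.sizeBound; omega
  have hw : ∀ (s : Store) (q : ℚ) (c r : ℕ), r ≠ c → s.write c 0 0 q r = s r :=
    fun s q c r hr => by funext i j; simp [Store.write, hr]
  have hv : ∀ (s : Store) (q : ℚ) (c : ℕ), s.write c 0 0 q c 0 0 = q := fun s q c => by
    simp [Store.write]
  refine ⟨_, _, .seq (Run.set s₀ 7 _ (q := d.E) ?_ (hp.2.2.2.1.trans hX))
    (.seq (Run.set _ 8 _ (q := penalty d.E) ?_ (hp.2.2.2.2.1.trans hX))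
    (.seq (Run.set _ 9 _ (q := invStep d.n d.E) ?_ (hp.2.2.2.2.2.1.trans hX))
    (.seq (Run.set _ 10 _ (q := numIter d.n d.E) ?_ (hp.2.2.2.2.2.2.1.trans hX))
    (Run.set _ 11 _ (q := gridDen d.n d.E) ?_ (hp.2.2.2.2.2.2.2.trans hX))))), by norm_num,
    fun r hr => ?_, ?_, ?_, ?_, ?_⟩
  · rw [← hE]; simp [Expr.eval]
  · simp [Expr.eval, hv, penalty]
  · simp [Expr.eval, hv, hw, hs₀.n, invStep]; exact Or.inl (by ring)
  · simp [Expr.eval, hv, hw, hs₀.n, numIter]; exact Or.inl (Or.inl (by ring))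
  · simp [Expr.eval, hv, gridDen]; ring
  · simp only [List.mem_cons, List.not_mem_nil, or_false, not_or] at hr
    rw [hw _ _ _ _ (by omega), hw _ _ _ _ (by omega), hw _ _ _ _ (by omega),
      hw _ _ _ _ (by omega), hw _ _ _ _ (by omega)]
  all_goals simp [hv, hw]

theorem run_scaling (hd : d.Bounded X) {s₀ : Store} (hs₀ : Loaded d s₀) :
    ∃ s' m, Run (d.sizeBound X) Code.scaling s₀ s' m ∧ m ≤ 4 * d.n + 2 ∧
      (∀ r, r ∉ [12, 14] → s' r = s₀ r) ∧ ∀ i < d.n, s' 12 i 0 = d.u i := by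
  have hm := hd.mul_le
  have hX : 2 * X ≤ d.sizeBound X := by unfold Data.sizeBound; omega
  obtain ⟨s', m, hr, hm', h1, h2⟩ := Run.mapLoop (B := d.sizeBound X) (c := 14) (n := d.n)
    (mb := 2) (bound := .var 0) (body := .ite (.var 2) (.get 5 (.var 14) (.var 14))
    (.assign 12 (.var 14) (.const 0) (.div (.var 2) (.get 5 (.var 14) (.var 14))))
    (.assign 12 (.var 14) (.const 0) (.const 1))) (R := [12]) hd.counter_le (by decide) (by decide)
    s₀ (fun s hs => by rw [Expr.eval_var, hs 0 (by decide), hs₀.n]) (fun _ i => d.u i)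
    (fun i hi s hs h14 _ => by
      have hs' : Loaded d s := hs₀.congr fun r hr => hs r (by
        fin_cases hr <;> decide)
      have hu := (hd.size_u i).trans hX
      have hQ : (Expr.get 5 (.var 14) (.var 14)).eval s = d.Q i i := by
        simp [Expr.eval, h14, hs'.Q]
      by_cases h : d.C < d.Q i i
      · obtain ⟨s₁, r₁, _, v₁⟩ := run_assignAt (B := d.sizeBound X) (c := 14) (i := i) 12
          (.div (.var 2) (.get 5 (.var 14) (.var 14))) s h14 (q := d.u i)
          (by rw [Expr.eval, Expr.eval_var, hs'.C, hQ, Data.u, if_pos h]) hu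
        refine ⟨s₁, 2, .ite_true ?_ r₁, le_rfl, fun r hr => ?_⟩
        · rwa [Expr.eval_var, hs'.C, hQ]
        · obtain rfl : r = 12 := by simpa using hr
          exact v₁
      · obtain ⟨s₁, r₁, _, v₁⟩ := run_assignAt (B := d.sizeBound X) (c := 14) (i := i) 12
          (.const 1) s h14 (q := d.u i) (by rw [Expr.eval, Data.u, if_neg h]) hu
        refine ⟨s₁, 2, .ite_false ?_ r₁, le_rfl, fun r hr => ?_⟩
        · rwa [Expr.eval_var, hs'.C, hQ]
        · obtain rfl : r = 12 := by simpa using hr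
          exact v₁)
  exact ⟨s', m, hr, by omega, fun r hr => h1 r (by
    simp [Prog.mods] at hr ⊢; omega), fun i hi => h2 12 (by decide) i hi⟩

theorem run_shrinkFactor (hd : d.Bounded X) {s₀ : Store} {y : ℕ → ℚ}
    (hy : ∀ i, bitSize (y i) ≤ X) (h22 : s₀ 22 0 0 = d.formQ y) (h23 : s₀ 23 0 0 = d.formDiag y) :
    ∃ s', Run (d.sizeBound X) Code.shrinkFactor s₀ s' 5 ∧
      (∀ r, r ≠ 24 → s' r = s₀ r) ∧ s' 24 0 0 = d.shrink y := by
  have hm := hd.mul_le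
  have hX : X ≤ d.sizeBound X := by unfold Data.sizeBound; omega
  have r₁ := Run.set (B := d.sizeBound X) s₀ 24 (.const 1) (q := 1) rfl (hd.one.trans hX)
  set s₁ := s₀.write 24 0 0 1
  have f₁ : ∀ r, r ≠ 24 → s₁ r = s₀ r := fun r hr => by
    funext i j; simp [s₁, Store.write, hr]
  have v₁ : s₁ 24 0 0 = 1 := by simp [s₁, Store.write]
  have e22 : (Expr.var 22).eval s₁ = d.formQ y := by
    rw [Expr.eval_var, f₁ 22 (by decide), h22]
  obtain ⟨s₂, r₂, f₂, v₂⟩ := run_guard (B := d.sizeBound X) (.var 24) (.var 22) 24 (.var 22) s₁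
    (by rw [e22]; exact (hd.size_formQ hy).trans (by unfold Data.sizeBound; omega))
  have e23 : (Expr.var 23).eval s₂ = d.formDiag y := by
    rw [Expr.eval_var, f₂ 23 (by decide), f₁ 23 (by decide), h23]
  obtain ⟨s₃, r₃, f₃, v₃⟩ := run_guard (B := d.sizeBound X) (.var 24) (.var 23) 24 (.var 23) s₂
    (by rw [e23]; exact (hd.size_formDiag hy).trans (by unfold Data.sizeBound; omega))
  refine ⟨s₃, .seq r₁ (.seq r₂ r₃), fun r hr => by rw [f₃ r hr, f₂ r hr, f₁ r hr], ?_⟩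
  rw [e22, Expr.eval_var, v₁] at v₂
  rw [e23, Expr.eval_var, v₂] at v₃
  exact v₃

theorem run_writeOutput (hd : d.Bounded X) {s₀ : Store} (hs₀ : Ready d s₀) {y : ℕ → ℚ}
    (hy : ∀ i, bitSize (y i) ≤ X) (hsy : ∀ i < d.n, s₀ 20 i 0 = y i)
    (h24 : s₀ 24 0 0 = d.shrink y) :
    ∃ s' m, Run (d.sizeBound X) Code.writeOutput s₀ s' m ∧ m ≤ 3 * d.n + 2 ∧
      ∀ i < d.n, s' 6 i 0 = d.u i * y i / d.shrink y := by
  have hm := hd.mul_le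
  have hshrink : bitSize (d.shrink y) ≤ 39 * ((d.n + 1) ^ 2 * X) := by
    have h1 := hd.size_formQ hy
    have h2 := hd.size_formDiag hy
    have h3 := hd.one
    unfold Data.shrink
    split_ifs <;> omega
  obtain ⟨s', m, hr, hm', h1, h2⟩ := Run.mapLoop (B := d.sizeBound X) (c := 14) (n := d.n)
    (mb := 1) (bound := .var 0) (body := .assign 6 (.var 14) (.const 0)
    (.div (.mul (Code.entry 12 (.var 14)) (Code.entry 20 (.var 14))) (.var 24))) (R := [6])
    hd.counter_le (by decide) (by decide)
    s₀ (fun s hs => by rw [Expr.eval_var, hs 0 (by decide), hs₀.n])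
    (fun _ i => d.u i * y i / d.shrink y)
    (fun i hi s hs h14 _ => by
      have e12 := hs 12 (by decide)
      have e20 := hs 20 (by decide)
      have e24 := hs 24 (by decide)
      obtain ⟨s₁, r₁, _, v₁⟩ := run_assignAt (B := d.sizeBound X) (c := 14) (i := i) 6
        (.div (.mul (Code.entry 12 (.var 14)) (Code.entry 20 (.var 14))) (.var 24)) s h14
        (q := d.u i * y i / d.shrink y)
        (by simp [Expr.eval, h14, e12, e20, e24, hs₀.u i hi, hsy i hi, h24])
        ((bitSize_div_le (bitSize_mul_le (hd.size_u i) (hy i)) hshrink).trans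
          (by unfold Data.sizeBound; omega))
      refine ⟨s₁, 1, r₁, le_rfl, fun r hr => ?_⟩
      obtain rfl : r = 6 := by simpa using hr
      exact v₁)
  exact ⟨s', m, hr, by omega, fun i hi => h2 6 (by decide) i hi⟩

/-- The program computes the result of the algorithm in polynomially many steps. -/
theorem run_main (hd : d.Bounded X) (hv : d.Valid) {s₀ : Store} (hs₀ : Loaded d s₀)
    (hE : (0 : ℚ) - ((⌊(0 : ℚ) - 1 / s₀ 1 0 0⌋ : ℤ) : ℚ) = d.E)
    (h20 : ∀ i, s₀ 20 i 0 = 0) (h21 : ∀ i, s₀ 21 i 0 = 0) :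
    ∃ s' m, Run (d.sizeBound X) Code.main s₀ s' m ∧
      m ≤ 100 * (d.n + 1) ^ 2 * numIter d.n d.E ∧ ∀ i < d.n, s' 6 i 0 = d.result i := by
  have hm := hd.mul_le
  obtain ⟨s₁, m₁, r₁, b₁, f₁, k₁, g₁, t₁, d₁⟩ := run_setParams hd hs₀ hE
  have hs₁ : Loaded d s₁ := hs₀.congr fun r hr => f₁ r (by fin_cases hr <;> decide)
  obtain ⟨s₂, m₂, r₂, b₂, f₂, u₂⟩ := run_scaling hd hs₁
  have hs₂ : Loaded d s₂ := hs₁.congr fun r hr => f₂ r (by fin_cases hr <;> decide)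
  have hsum := hd.sum_M_le
  obtain ⟨s₃, m₃, r₃, b₃, f₃, v₃⟩ := Run.sumLoop (B := d.sizeBound X) (acc := 13) (c := 15)
    (n := d.n) (β := 3 * X) (bound := .var 0)
    (e := .mul (Code.entry 12 (.var 15)) (Code.entry 3 (.var 15))) (by decide) hd.counter_le s₂
    (fun i => d.u i * d.a i) (fun i _ => hd.size_M_term i)
    (by unfold Data.sizeBound; omega)
    (fun s h => by rw [Expr.eval_var, h 0 (by decide) (by decide), hs₂.n])
    (fun j hj s h h15 => by
      have e12 := h 12 (by decide) (by decide)
      have e3 := h 3 (by decide) (by decide)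
      simp [Expr.eval, h15, e12, e3, u₂ j hj, hs₂.a])
  have hs₃ : Ready d s₃ := by
    refine ⟨hs₂.congr fun r hr => f₃ r (by rintro rfl; simp at hr) (by rintro rfl; simp at hr),
      ?_, ?_, ?_, ?_, fun i hi => ?_, v₃⟩
    all_goals rw [f₃ _ (by decide) (by decide)]
    · rw [f₂ _ (by decide), k₁]
    · rw [f₂ _ (by decide), g₁]
    · rw [f₂ _ (by decide), t₁]
    · rw [f₂ _ (by decide), d₁]
    · exact u₂ i hi
  obtain ⟨s₄, m₄, r₄, b₄, hs₄, y₄⟩ := run_iterations hd hv hs₃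
    (fun i => by rw [f₃ _ (by decide) (by decide), f₂ _ (by decide), f₁ _ (by decide), h20])
    (fun i => by rw [f₃ _ (by decide) (by decide), f₂ _ (by decide), f₁ _ (by decide), h21])
  have hy := fun i => (hv.size_iter hd le_rfl i).1
  obtain ⟨s₅, m₅, r₅, b₅, f₅, -, p₅, q₅⟩ := run_constraints hd (Or.inl rfl) hs₄ hy y₄
  obtain ⟨s₆, r₆, f₆, v₆⟩ := run_shrinkFactor hd hy p₅ q₅
  have hs₆ : Ready d s₆ := hs₄.congr fun r hr _ => by
    rw [f₆ r (by omega), f₅ r (by simp; omega)]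
  obtain ⟨s₇, m₇, r₇, b₇, v₇⟩ := run_writeOutput hd hs₆ hy
    (fun i hi => by rw [f₆ 20 (by decide), f₅ 20 (by decide), y₄ i hi]) v₆
  refine ⟨s₇, _, .seq r₁ (.seq r₂ (.seq r₃ (.seq r₄ (.seq r₅ (.seq r₆ r₇))))), ?_, v₇⟩
  -- Everything outside the main loop takes O((n+1)²) steps and is absorbed by (n+1)²·T.
  have hT : d.n + 1 ≤ numIter d.n d.E := (Data.param_le hd.E_pos).1
  have h1 : d.n + 1 ≤ (d.n + 1) ^ 2 := Nat.le_self_pow two_ne_zero _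
  have h2 : (d.n + 1) ^ 2 ≤ (d.n + 1) ^ 2 * numIter d.n d.E :=
    Nat.le_mul_of_pos_right _ (by omega)
  have h3 : numIter d.n d.E ≤ (d.n + 1) ^ 2 * numIter d.n d.E :=
    Nat.le_mul_of_pos_left _ (by positivity)
  have h4 : numIter d.n d.E * (40 * (d.n + 1) ^ 2 + 2) =
    40 * ((d.n + 1) ^ 2 * numIter d.n d.E) + 2 * numIter d.n d.E := by ring
  rw [mul_assoc]
  omega

end Pieces

end QuadApprox

namespace QuadApprox

open Matrix

/-! ### Nonnegativity on the cube from nonnegativity at its vertices -/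

section Cube

variable {ι : Type*} [Fintype ι] [DecidableEq ι]

theorem quadFun_add_single {H : Matrix ι ι ℝ} (hH : H.IsSymm) (b x : ι → ℝ) (i : ι) (t : ℝ) :
    quadFun H b (x + Pi.single i t) =
      quadFun H b x + t * quadGrad H b x i + t ^ 2 * (H i i / 2) := by
  rw [quadFun_add hH, dotProduct_single]
  have : Pi.single i t ⬝ᵥ H *ᵥ Pi.single i t = t ^ 2 * H i i := by
    rw [single_dotProduct, mulVec_single]
    simp; ring
  rw [this]; ring

theorem quadFun_single {H : Matrix ι ι ℝ} (hH : H.IsSymm) (b : ι → ℝ) (i : ι) (t : ℝ) :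
    quadFun H b (Pi.single i t) = t * b i + t ^ 2 * (H i i / 2) := by
  have := quadFun_add_single hH b 0 i t
  rw [zero_add] at this
  rw [this]
  simp [quadFun, quadGrad]

/-- A quadratic function that is concave in each coordinate and nonnegative at the vertices of the
unit cube is nonnegative on the cube. -/
theorem quadFun_nonneg_of_vertices {H : Matrix ι ι ℝ} (hH : H.IsSymm) (hdiag : ∀ i, H i i ≤ 0)
    {b : ι → ℝ} (hv : ∀ z : ι → ℝ, (∀ i, z i = 0 ∨ z i = 1) → 0 ≤ quadFun H b z)
    {x : ι → ℝ} (hx : ∀ i, 0 ≤ x i ∧ x i ≤ 1) : 0 ≤ quadFun H b x := by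
  -- Induction on a set containing all fractional coordinates: moving one of them to 0 or to 1
  -- reaches a smaller set, and concavity in that coordinate interpolates between the two values.
  have main : ∀ s : Finset ι, ∀ x : ι → ℝ, (∀ i, 0 ≤ x i ∧ x i ≤ 1) →
      (∀ i, i ∉ s → x i = 0 ∨ x i = 1) → 0 ≤ quadFun H b x := by
    intro s
    induction s using Finset.induction_on with
    | empty => exact fun x _ h => hv x fun i => h i (Finset.notMem_empty i)
    | insert i s _ ih =>
      intro x hx h
      have hmem : ∀ t : ℝ, (t = 0 ∨ t = 1) → 0 ≤ quadFun H b (Function.update x i t) := by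
        intro t ht
        refine ih _ (fun j => ?_) fun j hj => ?_
        · rcases eq_or_ne j i with rfl | hji
          · rcases ht with rfl | rfl <;> simp
          · simpa [hji] using hx j
        · rcases eq_or_ne j i with rfl | hji
          · simpa using ht
          · simpa [hji] using h j (by simp [hji, hj])
      have e : ∀ t : ℝ, Function.update x i t = Function.update x i 0 + Pi.single i t := by
        intro t
        funext j
        rcases eq_or_ne j i with rfl | hji <;> simp [*]
      have h0 := hmem 0 (Or.inl rfl)
      have h1 := hmem 1 (Or.inr rfl)
      have h2 := quadFun_add_single hH b (Function.update x i 0) i 1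
      have h3 := quadFun_add_single hH b (Function.update x i 0) i (x i)
      rw [← e] at h2 h3
      rw [Function.update_eq_self] at h3
      rw [h2] at h1
      rw [h3]
      obtain ⟨hx0, hx1⟩ := hx i
      have a1 := mul_nonneg (sub_nonneg.2 hx1) h0
      have a2 := mul_nonneg hx0 h1
      have a3 := mul_nonneg (mul_nonneg hx0 (sub_nonneg.2 hx1)) (neg_nonneg.2 (hdiag i))
      linarith
  exact main Finset.univ x hx fun i hi => absurd (Finset.mem_univ i) hi

end Cube

/-! ### Rescaling of coordinates -/

section Scaling

variable {ι : Type*} [Fintype ι]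

theorem quadForm_scale (H : Matrix ι ι ℝ) (u y : ι → ℝ) (c : ℝ) :
    y ⬝ᵥ (Matrix.of fun i j => u i * u j * H i j / c) *ᵥ y =
      ((fun i => u i * y i) ⬝ᵥ H *ᵥ fun i => u i * y i) / c := by
  simp only [dotProduct, mulVec, of_apply, Finset.mul_sum, Finset.sum_div]
  refine Finset.sum_congr rfl fun i _ => Finset.sum_congr rfl fun j _ => ?_
  ring

theorem dotProduct_scale (b u y : ι → ℝ) (c : ℝ) :
    (fun i => u i * b i / c) ⬝ᵥ y = (b ⬝ᵥ fun i => u i * y i) / c := by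
  simp only [dotProduct, Finset.sum_div]
  exact Finset.sum_congr rfl fun i _ => by ring

theorem quadFun_scale (H : Matrix ι ι ℝ) (b u y : ι → ℝ) (c : ℝ) :
    quadFun (Matrix.of fun i j => u i * u j * H i j / c) (fun i => u i * b i / c) y =
      quadFun H b (fun i => u i * y i) / c := by
  unfold quadFun
  rw [quadForm_scale, dotProduct_scale]
  ring

end Scaling

/-! ### Normalization of a problem and return to the original coordinates -/

namespace Problem

variable {n : ℕ} (I : Problem n)

/-- The Hessian of the objective. -/
noncomputable def hess : Matrix (Fin n) (Fin n) ℝ :=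
  Matrix.of fun i j => (I.A i j : ℝ) + (I.A j i : ℝ)

/-- The linear part of the objective over the reals. -/
noncomputable def lin : Fin n → ℝ := fun i => (I.a i : ℝ)

/-- The constraint matrix over the reals. -/
noncomputable def con : Matrix (Fin n) (Fin n) ℝ := I.Q.map (fun q : ℚ => (q : ℝ))

variable {I}

theorem hess_symm : I.hess.IsSymm := by
  ext i j; simp [hess, add_comm]

theorem obj_eq (x : Fin n → ℝ) : I.obj x = quadFun I.hess I.lin x := by
  have h1 : x ⬝ᵥ I.hess *ᵥ x = ∑ i, ∑ j, x i * (I.A i j : ℝ) * x j +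
      ∑ i, ∑ j, x i * (I.A i j : ℝ) * x j := by
    conv_rhs => arg 2; rw [Finset.sum_comm]
    simp only [dotProduct, mulVec, hess, of_apply, Finset.mul_sum, ← Finset.sum_add_distrib]
    exact Finset.sum_congr rfl fun i _ => Finset.sum_congr rfl fun j _ => by ring
  unfold obj quadFun
  rw [h1]
  simp only [dotProduct, lin]
  ring

theorem mem_feasible_iff (x : Fin n → ℝ) : x ∈ I.feasible ↔ (∀ i, 0 ≤ x i ∧ x i ≤ 1) ∧
    x ⬝ᵥ I.con *ᵥ x ≤ I.C ∧ (fun i => I.con i i) ⬝ᵥ x ≤ I.C := by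
  have h1 : x ⬝ᵥ I.con *ᵥ x = ∑ i, ∑ j, x i * (I.Q i j : ℝ) * x j := by
    simp only [dotProduct, mulVec, con, map_apply, Finset.mul_sum]
    exact Finset.sum_congr rfl fun i _ => Finset.sum_congr rfl fun j _ => by ring
  rw [h1]
  rfl

/-- The hypotheses on a problem. -/
structure Admissible (I : Problem n) : Prop where
  A_nonpos : ∀ i j, I.A i j ≤ 0
  vertices : ∀ z : Fin n → ℝ, (∀ i, z i = 0 ∨ z i = 1) → 0 ≤ I.obj z
  Q_nonneg : ∀ i j, 0 ≤ I.Q i j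
  psd : I.con.PosSemidef
  C_pos : 0 < I.C

/-- The scaling factors over the reals. -/
noncomputable def scale (I : Problem n) (i : Fin n) : ℝ :=
  if (I.C : ℝ) < I.con i i then I.C / I.con i i else 1

/-- The size of the objective over the reals. -/
noncomputable def objSize (I : Problem n) : ℝ := ∑ i, I.scale i * I.lin i

namespace Admissible

theorem C_pos' (h : I.Admissible) : (0 : ℝ) < I.C := by exact_mod_cast h.C_pos

theorem con_nonneg (h : I.Admissible) (i j : Fin n) : 0 ≤ I.con i j := by
  simpa [con] using h.Q_nonneg i j

theorem con_symm (h : I.Admissible) : I.con.IsSymm := by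
  have := h.psd.1
  rwa [IsHermitian, conjTranspose_eq_transpose_of_trivial] at this

theorem con_psd (h : I.Admissible) (x : Fin n → ℝ) : 0 ≤ x ⬝ᵥ I.con *ᵥ x := by
  simpa using h.psd.dotProduct_mulVec_nonneg x

theorem hess_nonpos (h : I.Admissible) (i j : Fin n) : I.hess i j ≤ 0 := by
  have h1 : (I.A i j : ℝ) ≤ 0 := by exact_mod_cast h.A_nonpos i j
  have h2 : (I.A j i : ℝ) ≤ 0 := by exact_mod_cast h.A_nonpos j i
  simp only [hess, of_apply]; linarith

theorem vertex_nonneg (h : I.Admissible) (z : Fin n → ℝ) (hz : ∀ i, z i = 0 ∨ z i = 1) :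
    0 ≤ quadFun I.hess I.lin z := by
  rw [← obj_eq]; exact h.vertices z hz

theorem obj_nonneg (h : I.Admissible) {x : Fin n → ℝ} (hx : ∀ i, 0 ≤ x i ∧ x i ≤ 1) :
    0 ≤ quadFun I.hess I.lin x :=
  quadFun_nonneg_of_vertices hess_symm (fun i => h.hess_nonpos i i) h.vertex_nonneg hx

theorem diag_add_lin_nonneg (h : I.Admissible) (i : Fin n) : 0 ≤ I.lin i + I.hess i i / 2 := by
  have h1 := h.vertex_nonneg (Pi.single i 1) fun j => by
    rcases eq_or_ne j i with rfl | hji <;> simp [*]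
  rw [quadFun_single hess_symm] at h1
  linarith

theorem lin_nonneg (h : I.Admissible) (i : Fin n) : 0 ≤ I.lin i := by
  have h1 := h.diag_add_lin_nonneg i
  have h2 := h.hess_nonpos i i
  linarith

/-- The value at the vertex e_i + e_j is the sum of the two linear coefficients, the entry H_ij and
half of two nonpositive diagonal entries. This bound takes the place of a smoothness assumption in
the error of second order. -/
theorem hess_ge (h : I.Admissible) (i j : Fin n) : -(I.lin i + I.lin j) ≤ I.hess i j := by
  rcases eq_or_ne i j with rfl | hij
  · have := h.diag_add_lin_nonneg i
    linarith
  · have h1 := h.vertex_nonneg (Pi.single i 1 + Pi.single j 1) fun k => by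
      rcases eq_or_ne k i with rfl | hki
      · simp [hij]
      · rcases eq_or_ne k j with rfl | hkj <;> simp [*]
    rw [quadFun_add_single hess_symm, quadFun_single hess_symm] at h1
    have h2 : quadGrad I.hess I.lin (Pi.single i 1) j = I.lin j + I.hess i j := by
      have := hess_symm (I := I)
      simp [quadGrad, mulVec_single, this.apply i j]
    have h3 := h.hess_nonpos i i
    have h4 := h.hess_nonpos j j
    rw [h2] at h1
    linarith

theorem scale_mem (h : I.Admissible) (i : Fin n) : 0 < I.scale i ∧ I.scale i ≤ 1 := by
  unfold scale
  have hC := h.C_pos'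
  split
  · rename_i h1
    exact ⟨div_pos hC (hC.trans h1), (div_le_one (hC.trans h1)).2 h1.le⟩
  · simp

theorem scale_mul_diag_le (h : I.Admissible) (i : Fin n) : I.scale i * I.con i i ≤ I.C := by
  unfold scale
  have hC := h.C_pos'
  split
  · rename_i h1
    rw [div_mul_cancel₀ _ (hC.trans h1).ne']
  · rename_i h1
    rw [one_mul]; exact not_lt.1 h1

/-- All terms of qᵀx are nonnegative, so qᵀx ≤ C forces Q_ii x_i ≤ C. The quadratic constraint alone
would give this only for x_i². -/
theorem le_scale (h : I.Admissible) {x : Fin n → ℝ} (hx : x ∈ I.feasible) (i : Fin n) :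
    x i ≤ I.scale i := by
  rw [mem_feasible_iff] at hx
  unfold scale
  split
  · rename_i h1
    rw [le_div_iff₀ (h.C_pos'.trans h1), mul_comm]
    refine le_trans ?_ hx.2.2
    exact Finset.single_le_sum (f := fun j => I.con j j * x j)
      (fun j _ => mul_nonneg (h.con_nonneg j j) (hx.1 j).1) (Finset.mem_univ i)
  · exact (hx.1 i).2

theorem objSize_nonneg (h : I.Admissible) : 0 ≤ I.objSize :=
  Finset.sum_nonneg fun i _ => mul_nonneg (h.scale_mem i).1.le (h.lin_nonneg i)

/-- The optimum is not much smaller than the size of the objective. -/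
theorem objSize_le (h : I.Admissible) {OPT : ℝ} (hO : ∀ x ∈ I.feasible, I.obj x ≤ OPT) :
    I.objSize ≤ 4 * n * OPT := by
  have hi : ∀ i, I.scale i * I.lin i ≤ 4 * OPT := fun i => by
    obtain ⟨hu0, hu1⟩ := h.scale_mem i
    have hd := h.scale_mul_diag_le i
    have hq := h.con_nonneg i i
    have hl := h.lin_nonneg i
    -- Halving matters: at u_i e_i the quadratic part could cancel the linear part. At u_i/2 it
    -- takes away at most u_i² a_i / 4, which leaves a value of at least u_i a_i / 4.
    have h1 := hO (Pi.single i (I.scale i / 2)) (by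
      rw [mem_feasible_iff]
      refine ⟨fun j => ?_, ?_, ?_⟩
      · rcases eq_or_ne j i with rfl | hji
        · simp only [Pi.single_eq_same]; constructor <;> linarith
        · simp [hji]
      · rw [single_dotProduct, mulVec_single]
        have : (I.scale i / 2) * (I.con i i * (I.scale i / 2)) ≤ I.C := by
          have : I.scale i * (I.scale i * I.con i i) ≤ 1 * (I.scale i * I.con i i) :=
            mul_le_mul_of_nonneg_right hu1 (by positivity)
          have h0 : 0 ≤ I.scale i * I.con i i := by positivity
          nlinarith
        simpa [div_eq_mul_inv] using this
      · rw [dotProduct_single]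
        nlinarith)
    rw [obj_eq, quadFun_single hess_symm] at h1
    have h2 := h.diag_add_lin_nonneg i
    nlinarith [mul_nonneg hu0.le h2, mul_nonneg hu0.le hl, mul_nonneg hu0.le (sub_nonneg.2 hu1),
      mul_nonneg (mul_nonneg hu0.le (sub_nonneg.2 hu1)) hl, mul_nonneg (mul_nonneg hu0.le hu0.le) h2]
  have := Finset.sum_le_sum fun i (_ : i ∈ Finset.univ) => hi i
  rw [Finset.sum_const, Finset.card_univ, Fintype.card_fin, nsmul_eq_mul] at this
  unfold objSize
  linarith

theorem exists_isGreatest (h : I.Admissible) : ∃ OPT, IsGreatest (I.obj '' I.feasible) OPT := by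
  have hc : Continuous I.obj := by unfold obj; fun_prop
  have hcl : IsClosed I.feasible := by
    have e : I.feasible = (⋂ i, {x | 0 ≤ x i ∧ x i ≤ 1}) ∩
        ({x | ∑ i, ∑ j, x i * (I.Q i j : ℝ) * x j ≤ (I.C : ℝ)} ∩
          {x | ∑ i, (I.Q i i : ℝ) * x i ≤ (I.C : ℝ)}) := by
      ext x; simp [feasible]
    rw [e]
    refine (isClosed_iInter fun i => ?_).inter ((isClosed_le ?_ ?_).inter (isClosed_le ?_ ?_))
    · exact isClosed_Icc.preimage (continuous_apply i)
    all_goals fun_prop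
  have hk : IsCompact I.feasible := by
    refine (isCompact_Icc (a := (0 : Fin n → ℝ)) (b := 1)).of_isClosed_subset hcl fun x hx => ?_
    exact ⟨fun i => (hx.1 i).1, fun i => (hx.1 i).2⟩
  have hne : I.feasible.Nonempty := by
    refine ⟨0, (mem_feasible_iff 0).2 ⟨fun i => by simp, ?_, ?_⟩⟩ <;> simp [h.C_pos'.le]
  obtain ⟨x, hx, hmax⟩ := hk.exists_isMaxOn hne hc.continuousOn
  exact ⟨_, ⟨x, hx, rfl⟩, by rintro _ ⟨y, hy, rfl⟩; exact hmax hy⟩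

theorem isNormalized (h : I.Admissible) (hM : 0 < I.objSize) :
    IsNormalized (Matrix.of fun i j => I.scale i * I.scale j * I.hess i j / I.objSize)
      (Matrix.of fun i j => I.scale i * I.scale j * I.con i j / I.C)
      (fun i => I.scale i * I.lin i / I.objSize)
      (fun i => I.scale i * I.con i i / I.C) I.scale := by
  have hC := h.C_pos'
  have hu := h.scale_mem
  have hQ0 : ∀ i j, 0 ≤ I.scale i * I.scale j * I.con i j / I.C := fun i j =>
    div_nonneg (mul_nonneg (mul_nonneg (hu i).1.le (hu j).1.le) (h.con_nonneg i j)) hC.le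
  have hq : ∀ i, 0 ≤ I.scale i * I.con i i / I.C ∧ I.scale i * I.con i i / I.C ≤ 1 := fun i =>
    ⟨div_nonneg (mul_nonneg (hu i).1.le (h.con_nonneg i i)) hC.le,
      (div_le_one hC).2 (h.scale_mul_diag_le i)⟩
  have hpsd : ∀ x : Fin n → ℝ,
      0 ≤ x ⬝ᵥ (Matrix.of fun i j => I.scale i * I.scale j * I.con i j / I.C) *ᵥ x := fun x => by
    rw [quadForm_scale]; exact div_nonneg (h.con_psd _) hC.le
  have hQs : ∀ i j, I.con i j = I.con j i := fun i j => (h.con_symm.apply i j).symm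
  have hHs : ∀ i j, I.hess i j = I.hess j i := fun i j => (hess_symm.apply i j).symm
  refine ⟨?_, fun i j => ?_, fun i j => ?_, fun i => ?_, ?_, fun y hy hy1 => ?_, ?_, hpsd,
    fun i j => ⟨hQ0 i j, ?_⟩, hq, fun i => ⟨(hu i).1.le, (hu i).2⟩⟩
  · ext i j
    simp only [transpose_apply, of_apply, hHs j i]
    ring
  · exact div_nonpos_of_nonpos_of_nonneg (mul_nonpos_of_nonneg_of_nonpos
      (mul_nonneg (hu i).1.le (hu j).1.le) (h.hess_nonpos i j)) hM.le
  · simp only [of_apply]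
    rw [← add_div, ← neg_div]
    refine div_le_div_of_nonneg_right ?_ hM.le
    have h1 := mul_le_mul_of_nonneg_left (h.hess_ge i j) (mul_nonneg (hu i).1.le (hu j).1.le)
    have h2 := mul_nonneg (mul_nonneg (hu i).1.le (h.lin_nonneg i)) (sub_nonneg.2 (hu j).2)
    have h3 := mul_nonneg (mul_nonneg (hu j).1.le (h.lin_nonneg j)) (sub_nonneg.2 (hu i).2)
    linarith
  · exact div_nonneg (mul_nonneg (hu i).1.le (h.lin_nonneg i)) hM.le
  · rw [← Finset.sum_div]; exact div_self hM.ne'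
  · rw [quadFun_scale]
    exact div_nonneg (h.obj_nonneg fun i => ⟨mul_nonneg (hu i).1.le (hy i), hy1 i⟩) hM.le
  · ext i j
    simp only [transpose_apply, of_apply, hQs j i]
    ring
  · have hdiag : ∀ i, I.scale i * I.scale i * I.con i i / I.C ≤ 1 := fun i => by
      have h1 := mul_le_mul_of_nonneg_left (hq i).2 (hu i).1.le
      have h2 := (hu i).2
      have e : I.scale i * I.scale i * I.con i i / I.C =
        I.scale i * (I.scale i * I.con i i / I.C) := by ring
      rw [e]; linarith
    -- Entries off the diagonal are controlled by the diagonal: the form at e_i - e_j gives 2Q_ij ≤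
    -- Q_ii + Q_jj ≤ 2.
    have h1 := hpsd (Pi.single i 1 - Pi.single j 1)
    rw [mulVec_sub, sub_dotProduct, dotProduct_sub, dotProduct_sub] at h1
    simp only [single_dotProduct, mulVec_single, MulOpposite.op_one, one_smul, one_mul, col_apply,
      of_apply] at h1
    have h2 : I.scale j * I.scale i * I.con j i / I.C = I.scale i * I.scale j * I.con i j / I.C := by
      rw [hQs j i]; ring
    rw [h2] at h1
    simp only [of_apply]
    linarith [hdiag i, hdiag j]

/-- Scaling of a feasible point. -/
theorem scaled_feasible (h : I.Admissible) {x : Fin n → ℝ} (hx : x ∈ I.feasible) :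
    ∃ y : Fin n → ℝ, (fun i => I.scale i * y i) = x ∧ (∀ i, 0 ≤ y i ∧ y i ≤ 1) ∧
      y ⬝ᵥ (Matrix.of fun i j => I.scale i * I.scale j * I.con i j / I.C) *ᵥ y ≤ 1 ∧
      (fun i => I.scale i * I.con i i / I.C) ⬝ᵥ y ≤ 1 := by
  have hx' := (mem_feasible_iff x).1 hx
  have hu := h.scale_mem
  have hC := h.C_pos'
  have e : (fun i => I.scale i * (x i / I.scale i)) = x := by
    funext i; rw [mul_div_cancel₀ _ (hu i).1.ne']
  refine ⟨fun i => x i / I.scale i, e, fun i => ?_, ?_, ?_⟩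
  · exact ⟨div_nonneg (hx'.1 i).1 (hu i).1.le, (div_le_one (hu i).1).2 (h.le_scale hx i)⟩
  · rw [quadForm_scale, e, div_le_one hC]; exact hx'.2.1
  · rw [dotProduct_scale (fun i => I.con i i), e, div_le_one hC]; exact hx'.2.2

/-- Shrinking of an almost feasible point. -/
theorem shrunk_feasible (h : I.Admissible) {y : Fin n → ℝ} (hy : ∀ i, 0 ≤ y i)
    (huy : ∀ i, I.scale i * y i ≤ 1) {s : ℝ} (hs : 1 ≤ s)
    (h1 : y ⬝ᵥ (Matrix.of fun i j => I.scale i * I.scale j * I.con i j / I.C) *ᵥ y ≤ s)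
    (h2 : (fun i => I.scale i * I.con i i / I.C) ⬝ᵥ y ≤ s) :
    (fun i => I.scale i * y i / s) ∈ I.feasible ∧
      quadFun I.hess I.lin (fun i => I.scale i * y i) / s ≤
        I.obj (fun i => I.scale i * y i / s) := by
  have hs0 : 0 < s := by linarith
  have hu := h.scale_mem
  have hC := h.C_pos'
  have hx0 : ∀ i, 0 ≤ I.scale i * y i := fun i => mul_nonneg (hu i).1.le (hy i)
  set x : Fin n → ℝ := fun i => I.scale i * y i with hx
  have e : (fun i => I.scale i * y i / s) = (s⁻¹ : ℝ) • x := by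
    funext i; simp only [hx, Pi.smul_apply, smul_eq_mul]; ring
  rw [quadForm_scale, div_le_iff₀ hC] at h1
  rw [dotProduct_scale (fun i => I.con i i), div_le_iff₀ hC] at h2
  have hs1 : s⁻¹ ≤ 1 := inv_le_one_of_one_le₀ hs
  rw [e]
  refine ⟨(mem_feasible_iff _).2 ⟨fun i => ?_, ?_, ?_⟩, ?_⟩
  · have := hx0 i
    exact ⟨mul_nonneg (inv_nonneg.2 hs0.le) this, mul_le_one₀ hs1 this (huy i)⟩
  -- The form scales with s⁻² and was at most sC before, so s ≤ s² suffices.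
  · rw [quadForm_smul, inv_pow, inv_mul_le_iff₀ (by positivity)]
    nlinarith [mul_le_mul_of_nonneg_right hs hs0.le]
  · rw [dotProduct_smul, smul_eq_mul, inv_mul_le_iff₀ hs0]
    exact h2
  · rw [obj_eq, div_eq_inv_mul]
    exact quadFun_smul_ge h.hess_nonpos _ hx0 (inv_nonneg.2 hs0.le) hs1

end Admissible

end Problem

end QuadApprox

namespace QuadApprox

open Matrix

/-! ### The rational computation as an instance of the real iteration -/

namespace Problem

variable {n : ℕ} (I : Problem n)

/-- The input of the algorithm. -/
def data (E : ℕ) : Data where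
  n := n
  E := E
  C := I.C
  a i := if hi : i < n then I.a ⟨i, hi⟩ else 0
  A i j := if h : i < n ∧ j < n then I.A ⟨i, h.1⟩ ⟨j, h.2⟩ else 0
  Q i j := if h : i < n ∧ j < n then I.Q ⟨i, h.1⟩ ⟨j, h.2⟩ else 0

variable {I} {E : ℕ}

theorem data_u (i : Fin n) : ((I.data E).u i : ℝ) = I.scale i := by
  simp only [Data.u, data, i.2, and_self, dite_true, scale, con, map_apply, Fin.eta, Rat.cast_lt]
  split <;> simp

theorem data_M : ((I.data E).M : ℝ) = I.objSize := by
  unfold Data.M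
  change ((∑ _ ∈ Finset.range n, _ : ℚ) : ℝ) = _
  rw [Finset.sum_range, Rat.cast_sum]
  refine Finset.sum_congr rfl fun i _ => ?_
  rw [Rat.cast_mul, data_u i]
  simp [data, lin]

theorem data_scaledQ (i j : Fin n) :
    ((I.data E).scaledQ i j : ℝ) = I.scale i * I.scale j * I.con i j / I.C := by
  simp only [Data.scaledQ, Rat.cast_mul, Rat.cast_div, data_u]
  simp [data, con]

theorem data_scaledDiag (i : Fin n) :
    ((I.data E).scaledDiag i : ℝ) = I.scale i * I.con i i / I.C := by
  simp only [Data.scaledDiag, Rat.cast_mul, Rat.cast_div, data_u]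
  simp [data, con]

theorem data_scaledH (i j : Fin n) :
    ((I.data E).scaledH i j : ℝ) = I.scale i * I.scale j * I.hess i j / I.objSize := by
  simp only [Data.scaledH, Rat.cast_mul, Rat.cast_div, data_u, data_M]
  simp [data, hess]

theorem data_scaledLin (i : Fin n) :
    ((I.data E).scaledLin i : ℝ) = I.scale i * I.lin i / I.objSize := by
  simp only [Data.scaledLin, Rat.cast_mul, Rat.cast_div, data_u, data_M]
  simp [data, lin]

/-- The scaled constraint matrix. -/
noncomputable def matQ (I : Problem n) : Matrix (Fin n) (Fin n) ℝ :=
  Matrix.of fun i j => I.scale i * I.scale j * I.con i j / I.C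

/-- The scaled linear constraint. -/
noncomputable def vecQ (I : Problem n) : Fin n → ℝ := fun i => I.scale i * I.con i i / I.C

/-- The scaled Hessian. -/
noncomputable def matH (I : Problem n) : Matrix (Fin n) (Fin n) ℝ :=
  Matrix.of fun i j => I.scale i * I.scale j * I.hess i j / I.objSize

/-- The scaled linear part of the objective. -/
noncomputable def vecH (I : Problem n) : Fin n → ℝ := fun i => I.scale i * I.lin i / I.objSize

/-- A rational vector as a point of real space. -/
def toReal (n : ℕ) (z : ℕ → ℚ) : Fin n → ℝ := fun i => (z i : ℝ)

theorem data_mulQ (z : ℕ → ℚ) (i : Fin n) :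
    ((I.data E).mulQ z i : ℝ) = (I.matQ *ᵥ toReal n z) i := by
  unfold Data.mulQ
  change ((∑ _ ∈ Finset.range n, _ : ℚ) : ℝ) = _
  rw [Finset.sum_range, Rat.cast_sum]
  refine Finset.sum_congr rfl fun j _ => ?_
  rw [Rat.cast_mul, data_scaledQ i j]
  rfl

theorem data_mulH (z : ℕ → ℚ) (i : Fin n) :
    ((I.data E).mulH z i : ℝ) = (I.matH *ᵥ toReal n z) i := by
  unfold Data.mulH
  change ((∑ _ ∈ Finset.range n, _ : ℚ) : ℝ) = _
  rw [Finset.sum_range, Rat.cast_sum]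
  refine Finset.sum_congr rfl fun j _ => ?_
  rw [Rat.cast_mul, data_scaledH i j]
  rfl

theorem data_formQ (z : ℕ → ℚ) :
    ((I.data E).formQ z : ℝ) = toReal n z ⬝ᵥ I.matQ *ᵥ toReal n z := by
  unfold Data.formQ
  change ((∑ _ ∈ Finset.range n, _ : ℚ) : ℝ) = _
  rw [Finset.sum_range, Rat.cast_sum]
  refine Finset.sum_congr rfl fun j _ => ?_
  rw [Rat.cast_mul, data_mulQ z j]
  rfl

theorem data_formDiag (z : ℕ → ℚ) : ((I.data E).formDiag z : ℝ) = I.vecQ ⬝ᵥ toReal n z := by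
  unfold Data.formDiag
  change ((∑ _ ∈ Finset.range n, _ : ℚ) : ℝ) = _
  rw [Finset.sum_range, Rat.cast_sum]
  refine Finset.sum_congr rfl fun j _ => ?_
  rw [Rat.cast_mul, data_scaledDiag j]
  rfl

theorem cast_indicator (c : ℚ) : ((Data.indicator c : ℚ) : ℝ) = exceeds c := by
  unfold Data.indicator exceeds
  have : (1 : ℝ) < c ↔ 1 < c := by exact_mod_cast Iff.rfl
  by_cases h : 1 < c <;> simp [h, this]

theorem data_rawStep (y z : ℕ → ℚ) (i : Fin n) :
    ((I.data E).rawStep y z i : ℝ) = toReal n z i + 1 / (invStep n E : ℝ) *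
      gain I.matH I.matQ I.vecH I.vecQ I.scale (penalty E) (toReal n y) (toReal n z) i := by
  unfold Data.rawStep gain violationGrad quadGrad
  push_cast
  rw [cast_indicator, cast_indicator, data_formQ, data_formDiag, data_mulQ, data_mulH, data_u,
    data_scaledLin, data_scaledDiag]
  simp only [Pi.add_apply]
  change _ + _ / ((invStep n E : ℕ) : ℝ) = _
  simp only [toReal, vecH, vecQ, data]
  ring

theorem Admissible.data_valid (h : I.Admissible) (hE : 0 < E) : (I.data E).Valid where
  C_pos := h.C_pos
  Q_nonneg i j := by
    simp only [data]
    split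
    · exact h.Q_nonneg _ _
    · exact le_rfl
  E_pos := hE

theorem Admissible.isStep (h : I.Admissible) (hE : 0 < E) (t : ℕ) :
    IsStep I.matH I.matQ I.vecH I.vecQ I.scale (penalty E) (invStep n E) (numIter n E)
      (gridDen n E) (toReal n ((I.data E).iter t).1) (toReal n ((I.data E).iter t).2)
      (toReal n ((I.data E).iter (t + 1)).1) (toReal n ((I.data E).iter (t + 1)).2) := by
  have hv := h.data_valid hE
  have hr := fun i : Fin n => hv.round_le (((I.data E).iter t).1 i + (1 - (I.data E).u i *
    ((I.data E).iter t).1 i) * ((I.data E).iter t).2 i / (numIter n E : ℚ))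
  have e : ∀ i : Fin n, ((((I.data E).iter t).1 i + (1 - (I.data E).u i *
      ((I.data E).iter t).1 i) * ((I.data E).iter t).2 i / (numIter n E : ℚ) : ℚ) : ℝ) =
      toReal n ((I.data E).iter t).1 i + (1 - I.scale i * toReal n ((I.data E).iter t).1 i) *
        toReal n ((I.data E).iter t).2 i / numIter n E := fun i => by
    push_cast
    rw [data_u]
    rfl
  refine ⟨fun i => ?_, fun i => ?_, fun i => ?_, fun i => ?_, fun i => ?_⟩
  · rw [← e]
    exact Rat.cast_le.2 (hr i).1
  · rw [← e]
    have := (hr i).2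
    change _ ≤ (((I.data E).nextY _ _ _ : ℚ) : ℝ)
    have h2 : ((1 / (gridDen n E : ℚ) : ℚ) : ℝ) = 1 / (gridDen n E : ℝ) := by push_cast; rfl
    rw [← h2, ← Rat.cast_sub]
    exact Rat.cast_le.2 this
  -- The old value is a grid point below the unrounded new value, so rounding down cannot fall below
  -- it.
  · obtain ⟨hz, h0, hu, -, k, hk⟩ := hv.iter_mem t i
    have hT : (0 : ℚ) < numIter n E := by exact_mod_cast numIter_pos n hE
    have := hv.round_ge_of_grid (k := k) (x := ((I.data E).iter t).1 i + (1 - (I.data E).u i *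
      ((I.data E).iter t).1 i) * ((I.data E).iter t).2 i / (numIter n E : ℚ)) (by
        rw [← hk]
        have : 0 ≤ (1 - (I.data E).u i * ((I.data E).iter t).1 i) * ((I.data E).iter t).2 i :=
          mul_nonneg (by linarith) hz.1
        have := div_nonneg this hT.le
        linarith)
    rw [← hk] at this
    exact Rat.cast_le.2 this
  · have := (hv.iter_mem (t + 1) i).1
    exact ⟨Rat.cast_nonneg.2 this.1, (Rat.cast_le.2 this.2).trans_eq Rat.cast_one⟩
  · rw [← data_rawStep]
    have h1 := hv.round_le (Data.clamp ((I.data E).rawStep ((I.data E).iter t).1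
      ((I.data E).iter t).2 i))
    change |(((I.data E).round (Data.clamp _) : ℚ) : ℝ) - _| ≤ _
    have h2 : max (0 : ℝ) (min 1 ((I.data E).rawStep ((I.data E).iter t).1
        ((I.data E).iter t).2 i : ℝ)) = ((Data.clamp ((I.data E).rawStep ((I.data E).iter t).1
        ((I.data E).iter t).2 i) : ℚ) : ℝ) := by
      rw [Data.clamp_eq]; push_cast; rfl
    have h3 : (1 : ℝ) / (gridDen n E : ℝ) = ((1 / (gridDen n E : ℚ) : ℚ) : ℝ) := by push_cast; rfl
    rw [h2, h3, ← Rat.cast_sub, ← Rat.cast_abs, Rat.cast_le, abs_le]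
    have h0 : 0 ≤ 1 / (gridDen n E : ℚ) := by positivity
    have e1 : (I.data E).n = n := rfl
    have e2 : (I.data E).E = E := rfl
    rw [e1, e2] at h1
    constructor <;> linarith

theorem data_shrink (y : ℕ → ℚ) : (1 : ℝ) ≤ (I.data E).shrink y ∧
    toReal n y ⬝ᵥ I.matQ *ᵥ toReal n y ≤ (I.data E).shrink y ∧
    I.vecQ ⬝ᵥ toReal n y ≤ (I.data E).shrink y ∧
    ∀ r : ℝ, 1 ≤ r → toReal n y ⬝ᵥ I.matQ *ᵥ toReal n y ≤ r → I.vecQ ⬝ᵥ toReal n y ≤ r →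
      ((I.data E).shrink y : ℝ) ≤ r := by
  rw [← data_formQ (E := E), ← data_formDiag (E := E)]
  unfold Data.shrink
  have h : ∀ a b c : ℚ, a ≤ c → b ≤ c → (a : ℝ) ≤ c ∧ (b : ℝ) ≤ c := fun a b c h1 h2 =>
    ⟨Rat.cast_le.2 h1, Rat.cast_le.2 h2⟩
  refine ⟨?_, ?_, ?_, fun r h1 h2 h3 => ?_⟩
  · have : (1 : ℚ) ≤ (I.data E).shrink y := by unfold Data.shrink; split_ifs <;> linarith
    exact_mod_cast this
  · rw [Rat.cast_le]; split_ifs <;> linarith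
  · rw [Rat.cast_le]; split_ifs <;> linarith
  · split_ifs <;> first | assumption | simpa using h1

/-- The additive error 8/((n+1)E), multiplied by M ≤ 4n·OPT, costs at most 32·OPT/E; division by the
shrinking factor s ≤ 1 + 1/E costs one more OPT/E. This is the constant 33. -/
theorem Admissible.result_spec (h : I.Admissible) (hE : 0 < E) :
    toReal n (I.data E).result ∈ I.feasible ∧
      ∃ OPT : ℝ, IsGreatest (I.obj '' I.feasible) OPT ∧ 0 ≤ OPT ∧
        (Real.exp (-1) - 33 / E) * OPT ≤ I.obj (toReal n (I.data E).result) := by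
  have hv := h.data_valid hE
  have hE' : (1 : ℝ) ≤ E := by exact_mod_cast hE
  set yq := ((I.data E).iter (numIter n E)).1 with hyq
  set y := toReal n yq with hy
  set s : ℝ := ((I.data E).shrink yq : ℝ) with hs
  obtain ⟨hs1, hsQ, hsq, hsr⟩ := data_shrink (I := I) (E := E) yq
  have hmem := fun i : Fin n => hv.iter_mem (numIter n E) i
  have hy0 : ∀ i, 0 ≤ y i := fun i => Rat.cast_nonneg.2 (hmem i).2.1
  have huy : ∀ i, I.scale i * y i ≤ 1 := fun i => by
    have := (hmem i).2.2.1
    rw [← data_u (E := E)]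
    change ((_ : ℚ) : ℝ) * ((_ : ℚ) : ℝ) ≤ 1
    exact_mod_cast this
  have hres : toReal n (I.data E).result = fun i => I.scale i * y i / s := by
    funext i
    simp only [toReal, Data.result, Rat.cast_div, Rat.cast_mul]
    rw [data_u]
    rfl
  obtain ⟨hf, hobj⟩ := h.shrunk_feasible hy0 huy hs1 hsQ hsq
  obtain ⟨OPT, hO⟩ := h.exists_isGreatest
  have hO' : ∀ x ∈ I.feasible, I.obj x ≤ OPT := fun x hx => hO.2 ⟨x, hx, rfl⟩
  have hnonneg : ∀ x ∈ I.feasible, 0 ≤ I.obj x := fun x hx => by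
    rw [obj_eq]; exact h.obj_nonneg hx.1
  obtain ⟨x, hx, hxO⟩ := hO.1
  have hO0 : 0 ≤ OPT := hxO ▸ hnonneg x hx
  rw [hres]
  refine ⟨hf, OPT, hO, hO0, ?_⟩
  obtain ⟨w, hw, hw1, hwQ, hwq⟩ := h.scaled_feasible hx
  -- If M = 0 the normalization breaks down, but then all linear coefficients vanish, the optimum is
  -- zero, and feasibility of the output is enough.
  rcases h.objSize_nonneg.eq_or_lt with hM | hM
  · have hOPT : OPT = 0 := by
      refine le_antisymm ?_ hO0
      have h1 := quadFun_le_linear h.hess_nonpos I.lin (fun i => (hx.1 i).1 : 0 ≤ x)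
      have h2 : I.lin ⬝ᵥ x = 0 := by
        have h3 := (Finset.sum_eq_zero_iff_of_nonneg fun i _ =>
          mul_nonneg (h.scale_mem i).1.le (h.lin_nonneg i)).1 hM.symm
        refine Finset.sum_eq_zero fun i hi => ?_
        have h4 := h3 i hi
        rcases mul_eq_zero.1 h4 with h5 | h5
        · exact absurd h5 (h.scale_mem i).1.ne'
        · rw [h5, zero_mul]
      rw [← hxO, obj_eq]; linarith
    rw [hOPT, mul_zero]
    exact hnonneg _ hf
  · have hN := h.isNormalized hM
    have hg := greedy_guarantee (n := n) hE hN
      (y := fun t => toReal n ((I.data E).iter t).1) (z := fun t => toReal n ((I.data E).iter t).2)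
      (by funext i; simp [toReal, Data.iter]) (by funext i; simp [toReal, Data.iter])
      (fun t => h.isStep hE t) hw1 hwQ hwq
    obtain ⟨g1, g2, g3⟩ := hg
    have hinv : 0 < 1 / (E : ℝ) := by positivity
    have hsE : s ≤ 1 + 1 / E := hsr _ (by linarith) g2 g3
    rw [quadFun_scale, quadFun_scale, hw, ← obj_eq, hxO] at g1
    have hsize := h.objSize_le hO'
    set V := quadFun I.hess I.lin (fun i => I.scale i * y i) with hV
    have hn0 : (0 : ℝ) ≤ n := by positivity
    have hs0 : 0 < s := by linarith
    have g4 : Real.exp (-1) * OPT - 32 * OPT / E ≤ V := by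
      have k1 := mul_le_mul_of_nonneg_right g1 hM.le
      rw [sub_mul, div_mul_cancel₀ _ hM.ne', mul_assoc, div_mul_cancel₀ _ hM.ne'] at k1
      have k2 : 8 / ((n + 1) * E) * I.objSize ≤ 32 * OPT / E := by
        rw [div_mul_eq_mul_div, div_le_div_iff₀ (by positivity) (by positivity)]
        have : I.objSize ≤ 4 * (n + 1) * OPT := by nlinarith
        nlinarith
      linarith
    have hexp : Real.exp (-1) ≤ 1 := Real.exp_le_one_iff.2 (by norm_num)
    set v := Real.exp (-1) * OPT - 32 * OPT / E with hvdef
    have hvO : v ≤ OPT := by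
      have h1 : Real.exp (-1) * OPT ≤ 1 * OPT := mul_le_mul_of_nonneg_right hexp hO0
      have h2 : 0 ≤ 32 * OPT / E := by positivity
      linarith
    have e1 : (Real.exp (-1) - 33 / E) * OPT = v - 1 / E * OPT := by
      rw [hvdef]; ring
    rw [e1]
    -- For v ≤ 0 the claimed bound is not positive, and nonnegativity of the objective on S settles
    -- it.
    rcases le_or_gt v 0 with hv0 | hv0
    · have := mul_nonneg hinv.le hO0
      have := hnonneg _ hf
      linarith
    · refine le_trans ?_ hobj
      rw [le_div_iff₀ hs0]
      refine le_trans ?_ g4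
      rcases le_or_gt (v - 1 / E * OPT) 0 with h1 | h1
      · exact (mul_nonpos_of_nonpos_of_nonneg h1 hs0.le).trans hv0.le
      -- From v ≤ OPT it follows that (v - OPT/E)(1 + 1/E) ≤ v.
      · have k1 := mul_le_mul_of_nonneg_left hsE h1.le
        have k2 : 1 / E * v ≤ 1 / E * OPT := mul_le_mul_of_nonneg_left hvO hinv.le
        have k3 : 0 ≤ 1 / (E : ℝ) * (1 / E * OPT) := by positivity
        nlinarith

end Problem

end QuadApprox

namespace QuadApprox

/-! ### The polynomial time bound and the conclusion -/

namespace Problem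

variable {n : ℕ} (I : Problem n)

/-- The cells of the initial store are bounded by the size of the input. -/
theorem load_small (ε : ℚ) : (I.load ε).Small (I.size + bitSize ε) := by
  have hε := one_le_bitSize ε
  have hC := one_le_bitSize I.C
  have hA : ∀ i j, bitSize (I.A i j) ≤ ∑ i, ∑ j, bitSize (I.A i j) := fun i j =>
    (Finset.single_le_sum (f := fun j => bitSize (I.A i j)) (fun _ _ => Nat.zero_le _)
      (Finset.mem_univ j)).trans (Finset.single_le_sum (f := fun i => ∑ j, bitSize (I.A i j))
      (fun _ _ => Nat.zero_le _) (Finset.mem_univ i))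
  have hQ : ∀ i j, bitSize (I.Q i j) ≤ ∑ i, ∑ j, bitSize (I.Q i j) := fun i j =>
    (Finset.single_le_sum (f := fun j => bitSize (I.Q i j)) (fun _ _ => Nat.zero_le _)
      (Finset.mem_univ j)).trans (Finset.single_le_sum (f := fun i => ∑ j, bitSize (I.Q i j))
      (fun _ _ => Nat.zero_le _) (Finset.mem_univ i))
  have ha : ∀ i, bitSize (I.a i) ≤ ∑ i, bitSize (I.a i) := fun i =>
    Finset.single_le_sum (f := fun i => bitSize (I.a i)) (fun _ _ => Nat.zero_le _)
      (Finset.mem_univ i)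
  have hn := bitSize_natCast_le n
  intro r i j
  unfold load size
  split
  · omega
  · omega
  · omega
  · split
    · exact (ha _).trans (by omega)
    · rw [bitSize_zero]; omega
  · split
    · exact (hA _ _).trans (by omega)
    · rw [bitSize_zero]; omega
  · split
    · exact (hQ _ _).trans (by omega)
    · rw [bitSize_zero]; omega
  · rw [bitSize_zero]; omega

theorem load_loaded (ε : ℚ) (E : ℕ) : Loaded (I.data E) (I.load ε) :=
  ⟨rfl, rfl, fun _ => rfl, fun _ _ => rfl, fun _ _ => rfl⟩

/-- A bound for the numbers in memory in terms of the input. -/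
theorem data_bounded (ε : ℚ) {E : ℕ} (hE : 0 < E) :
    (I.data E).Bounded (I.size + bitSize ε + (2 * gridDen n E + 1)) := by
  have h := I.load_small ε
  have le : I.size + bitSize ε ≤ I.size + bitSize ε + (2 * gridDen n E + 1) :=
    Nat.le_add_right _ _
  exact ⟨(h 2 0 0).trans le, fun i => (h 3 i 0).trans le, fun i j => (h 4 i j).trans le,
    fun i j => (h 5 i j).trans le, Nat.le_add_left _ _, hE⟩

end Problem

theorem numIter_mono {n n' E E' : ℕ} (hn : n ≤ n') (hE : E ≤ E') :
    numIter n E ≤ numIter n' E' := by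
  unfold numIter invStep penalty
  gcongr

open Polynomial in
/-- The number of iterations as a polynomial. -/
noncomputable def numIterPoly : ℕ[X] :=
  (X + 1) ^ 2 * ((X + 1) ^ 4 * (16 * X) ^ 2 * X) * X

theorem numIterPoly_eval (v : ℕ) : numIterPoly.eval v = numIter v v := by
  simp [numIterPoly, numIter, invStep, penalty]

open Polynomial in
/-- The running time as a polynomial. -/
noncomputable def timePoly : ℕ[X] :=
  C Code.main.factor * (1000 * ((X + 1) ^ 2 * (X + (2 * numIterPoly ^ 2 + 1))) + 1) *
    (100 * (X + 1) ^ 2 * numIterPoly)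

theorem le_timePoly_eval {n E N v : ℕ} (hn : n ≤ v) (hE : E ≤ v) (hN : N ≤ v) :
    Code.main.factor * (1000 * ((n + 1) ^ 2 * (N + (2 * gridDen n E + 1))) + 1) *
      (100 * (n + 1) ^ 2 * numIter n E) ≤ timePoly.eval v := by
  have h := numIter_mono hn hE
  have e : timePoly.eval v = Code.main.factor *
      (1000 * ((v + 1) ^ 2 * (v + (2 * numIter v v ^ 2 + 1))) + 1) *
      (100 * (v + 1) ^ 2 * numIter v v) := by
    simp only [timePoly, Polynomial.eval_mul, Polynomial.eval_add, Polynomial.eval_pow,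
      Polynomial.eval_C, Polynomial.eval_X, Polynomial.eval_one, Polynomial.eval_ofNat,
      numIterPoly_eval]
  rw [e, gridDen]
  gcongr

end QuadApprox

theorem corollary1 :
    ∃ (P : QuadApprox.Prog) (p : Polynomial ℕ) (c : ℝ),
      ∀ (n : ℕ) (I : QuadApprox.Problem n) (ε : ℚ), 0 < ε →
        (∀ i j, I.A i j ≤ 0) →
        (∀ z : Fin n → ℝ, (∀ i, z i = 0 ∨ z i = 1) → 0 ≤ I.obj z) →
        (∀ i j, 0 ≤ I.Q i j) →
        (I.Q.map (fun q : ℚ => (q : ℝ))).PosSemidef →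
        0 < I.C →
        ∃ (s : QuadApprox.Store) (t : ℕ),
          QuadApprox.Exec P (I.load ε) s t ∧
          t ≤ p.eval (I.size + QuadApprox.bitSize ε + ⌈1 / ε⌉₊) ∧
          QuadApprox.output n s ∈ I.feasible ∧
          ∃ OPT : ℝ, IsGreatest (I.obj '' I.feasible) OPT ∧
            (1 / Real.exp 1 - c * (ε : ℝ)) * OPT ≤ I.obj (QuadApprox.output n s) := by
  refine ⟨QuadApprox.Code.main, QuadApprox.timePoly, 33, fun n I ε hε hA hv hQ hpsd hC => ?_⟩
  have h : I.Admissible := ⟨hA, hv, hQ, hpsd, hC⟩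
  have hinv : 0 < 1 / ε := by positivity
  -- This accuracy satisfies 1/E ≤ ε and is itself one of the summands at which the time polynomial
  -- is evaluated.
  set E := ⌈1 / ε⌉₊ with hEdef
  have hE : 0 < E := Nat.ceil_pos.2 hinv
  have hfloor : (0 : ℚ) - ((⌊(0 : ℚ) - 1 / I.load ε 1 0 0⌋ : ℤ) : ℚ) = (I.data E).E := by
    change (0 : ℚ) - ((⌊(0 : ℚ) - 1 / ε⌋ : ℤ) : ℚ) = (E : ℚ)
    rw [zero_sub, zero_sub, Int.floor_neg, Int.cast_neg, neg_neg, hEdef,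
      natCast_ceil_eq_intCast_ceil hinv.le]
  have hd := I.data_bounded ε hE
  have hval := h.data_valid hE
  obtain ⟨s, m, hrun, hm, hout⟩ := QuadApprox.run_main hd hval (I.load_loaded ε E) hfloor
    (fun _ => rfl) (fun _ => rfl)
  have hsmall : (I.load ε).Small ((I.data E).sizeBound
      (I.size + QuadApprox.bitSize ε + (2 * QuadApprox.gridDen n E + 1))) := fun r i j => by
    have h1 := I.load_small ε r i j
    have h2 := hd.mul_le
    unfold QuadApprox.Data.sizeBound
    omega
  obtain ⟨t, hexec, ht, -⟩ := hrun.exec hsmall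
  have houtput : QuadApprox.output n s = QuadApprox.Problem.toReal n (I.data E).result := by
    funext i
    exact congrArg _ (hout i i.2)
  obtain ⟨hf, OPT, hO, hO0, hobj⟩ := h.result_spec hE
  refine ⟨s, t, hexec, ?_, houtput ▸ hf, OPT, hO, ?_⟩
  · have hn : n ≤ I.size := by unfold QuadApprox.Problem.size; omega
    exact (ht.trans (Nat.mul_le_mul_left _ hm)).trans
      (QuadApprox.le_timePoly_eval (n := n) (E := E) (by omega) (by omega) (by omega))
  · rw [houtput]
    refine le_trans (mul_le_mul_of_nonneg_right ?_ hO0) hobj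
    have h1 : 1 / (E : ℝ) ≤ ε := by
      have h2 : 1 / ε ≤ (E : ℚ) := Nat.le_ceil _
      have h3 : 1 / (E : ℚ) ≤ ε := by
        rw [div_le_comm₀ (by exact_mod_cast hE) hε]; exact h2
      have h4 : ((1 / (E : ℚ) : ℚ) : ℝ) ≤ ε := Rat.cast_le.2 h3
      simpa using h4
    have h5 : (33 : ℝ) / E = 33 * (1 / E) := by ring
    rw [Real.exp_neg, one_div, h5]
    linarith
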